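/- **Setting.** Write $J(q)=\sum_{j\ge-1}c(j)q^j=q^{-1}+196884q+\cdots$ for the normalized modular function, let $I=\{(j,k): j\in\{-1,1,2,\dots\},\ 1\le k\le c(j)\}$, and let $A=(-(j+p))_{(j,k),(p,q)\in I}$. Let $\mathfrak g(A)$ be the complex Lie algebra with generators $h_{jk},e_{jk},f_{jk}$ ($(j,k)\in I$) and relations $[h_{jk},h_{pq}]=0$, $[h_{jk},e_{pq}]=-(j+p)e_{pq}$, $[h_{jk},f_{pq}]=(j+p)f_{pq}$, $[e_{jk},f_{pq}]=\delta_{jp}\delta_{kq}h_{jk}$, and $(\mathrm{ad}\,e_{-1,1})^je_{jk}=(\mathrm{ad}\,f_{-1,1})^jf_{jk}=0$ for $j\ge1$. The Monster Lie algebra is $\mathfrak m=\mathfrak g(A)/\mathfrak z$, with $\mathfrak z$ the center. Let $\mathfrak h_A$ be the span of the $h_{jk}$, let $\mathfrak d_0$ be the span of the derivations $D_{jk}$, $(j,k)\ne(\pm1,1)$, of $\mathfrak g(A)$ that send $e_{jk}\mapsto e_{jk}$, $f_{jk}\mapsto-f_{jk}$ and all other generators to $0$, and let $\mathfrak h^e=\mathfrak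 d_0\oplus\mathfrak h_A\subset\mathfrak d_0\ltimes\mathfrak g(A)$. For $\alpha\in(\mathfrak h^e)^*$ put $\mathfrak m_\alpha=\{x\in\mathfrak g(A):[h,x]=\alpha(h)x\ \ \forall h\in\mathfrak h^e\}$, regarded also as a subspace of $\mathfrak m$; then $\mathfrak m_0$ becomes $\mathfrak h=\mathfrak h_A/\mathfrak z$. The set of roots is $\Delta=\{\alpha\ne0:\mathfrak m_\alpha\ne0\}$, and $\Delta_+$ is the set of roots that are sums of simple roots (the weights of the $e_{jk}$). For roots $\alpha,\beta$, the root span $\Sigma(\alpha,\beta)$ is the smallest subset of $\Delta$ that contains $\alpha+\beta$ if this is a root, and contains $\gamma+\alpha$, resp. $\gamma+\beta$, whenever it contains $\gamma$ and $\gamma+\alpha$, resp. $\gamma+\beta$, is a root. A positive root system is a set $\Pi\subseteq\Delta$ with $\Pi\cap(-\Pi)=\emptyset$, $\Pi\cup(-\Pi)=\Delta$, and $\alpha+\beta\in\Pi$ whenever $\alpha,\beta\in\Pi$ and $\alpha+\beta\in\Delta$. For a set $\Pi$ of roots let $\widehat{\mathfrak m}^{\Pi}$ be the space of families $y=(y_\gamma)$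 with $y_\gamma\in\mathfrak m_\gamma$ and $y_\gamma\neq0$ for only finitely many $\gamma\notin\Pi$ (so $\widehat{\mathfrak m}^{\Pi}=\mathfrak n^{-\Pi}\oplus\mathfrak h\oplus\prod_{\alpha\in\Pi}\mathfrak m_\alpha$ for a positive root system $\Pi$). A series of operators on $\widehat{\mathfrak m}^{\Pi}$ is pro-summable if, applied to any $y$, it has only finitely many nonzero terms in each component; $\exp(\mathrm{ad}\,x)=\sum_n(\mathrm{ad}\,x)^n/n!$ is understood in this sense. Limits of operators are taken pointwise, for the product topology of the components. Let $\widehat U^+$ be the group of Lie algebra automorphisms $\varphi$ of $\widehat{\mathfrak m}^{\Delta_+}$ such that $\varphi$ and $\varphi^{-1}$ are unipotent, meaning that $\varphi(y)-y$ has nonzero components only in degrees $\mu+\kappa$ with $y_\mu\ne0$ and $\kappa$ a nonempty sum of elements of $\Delta_+$. For a positive root system $\Pi$ let $\widehat U^{\Pi}$ be the closed subgroup of the group of linear automorphisms of $\widehat{\mathfrak m}^{\Pi}$ generated by the operators $\exp(\mathrm{ad}\,x)$ that are well defined, for $x\in\mathfrak m_\gamma$, $\gamma\in\Pi$. Write $(X,Y)=XYX^{-1}Y^{-1}$.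 For roots $\alpha,\beta$ put $S=\{(i,j): i,j\ge1,\ i\alpha+j\beta\in\Sigma(\alpha,\beta)\}$. (If $\alpha,\beta$ are linearly independent, $(i,j)\mapsto i\alpha+j\beta$ identifies $S$ with $\Sigma(\alpha,\beta)$.) Fix an enumeration of $\mathbb Z_{\ge0}^2$ in which $(i,j)$ precedes $(i',j')$ whenever $(i,j)\ne(i',j')$, $i\le i'$ and $j\le j'$. Products over $S$ are taken in the induced order, are read from right to left, and, if infinite, are the limits of their finite partial products. **Theorem.** (1) Let $\alpha,\beta\in\Delta_+$, $x_\alpha\in\mathfrak m_\alpha$, $y_\beta\in\mathfrak m_\beta$. Then there is a unique family $z_{ij}\in\mathfrak m_{i\alpha+j\beta}$, $(i,j)\in S$, such that for all $u,v\in\mathbb C$ the operators below are well defined elements of $\widehat U^+$ and $$\bigl(\exp(u\,\mathrm{ad}\,x_\alpha),\exp(v\,\mathrm{ad}\,y_\beta)\bigr)=\prod_{(i,j)\in S}\exp\bigl(u^iv^j\,\mathrm{ad}\,z_{ij}\bigr).\qquad(*)$$ Moreover $z_{11}=[x_\alpha,y_\beta]$ (where $z_{11}:=0$ if $(1,1)\notin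 S$). (2) Let $\alpha,\beta\in\Delta$, $x_\alpha\in\mathfrak m_\alpha$, $y_\beta\in\mathfrak m_\beta$. There are elements $Z_{ij}$ of the free Lie algebra over $\mathbb C$ on two generators such that the following holds for every positive root system $\Pi$ containing $\alpha$ and $\beta$ for which the exponentials are well defined on $\widehat{\mathfrak m}^{\Pi}$, in the sense that for every $\delta\in(\mathfrak h^e)^*$ only finitely many pairs $(i,j)\in\mathbb Z_{\ge0}^2$ satisfy $\delta-i\alpha-j\beta\in\Pi$ (this is automatic if $\Pi=\{\gamma\in\Delta:\lambda(\gamma)>0\}$ for an additive $\lambda:(\mathfrak h^e)^*\to\mathbb R$). There is a unique family $z_{ij}\in\mathfrak m_{i\alpha+j\beta}$, $(i,j)\in S$, such that for all $u,v\in\mathbb C$ the operators in $(*)$ are well defined elements of $\widehat U^{\Pi}$ and $(*)$ holds. Moreover $z_{11}=[x_\alpha,y_\beta]$, and, with $z_{ij}:=0$ for $(i,j)\notin S$, each $z_{ij}$ is the value $Z_{ij}(x_\alpha,y_\beta)$; in particular it is given by an expression in the free Lie algebra generated by $x_\alpha,y_\beta$ that does not depend on $\Pi$. -/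

import Mathlib

open Filter Topology

namespace Monster

noncomputable section

/-! ### The modular function and the index set -/

/-- The Eisenstein series `E₄ = 1 + 240 ∑ σ₃(n) qⁿ`, as a formal power series in `q`. -/
def eisenstein4 : PowerSeries ℚ :=
  1 + (240 : ℚ) • PowerSeries.mk fun n => (ArithmeticFunction.sigma 3 n : ℚ)

/-- The Eisenstein series `E₆ = 1 - 504 ∑ σ₅(n) qⁿ`, as a formal power series in `q`. -/
def eisenstein6 : PowerSeries ℚ :=
  1 - (504 : ℚ) • PowerSeries.mk fun n => (ArithmeticFunction.sigma 5 n : ℚ)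

/-- The `q`-expansion of the normalized modular function `J = j - 744`, where
`j = 1728 E₄³ / (E₄³ - E₆²)`. -/
def modularJ : LaurentSeries ℚ :=
  1728 * (eisenstein4 : LaurentSeries ℚ) ^ 3 /
    ((eisenstein4 : LaurentSeries ℚ) ^ 3 - (eisenstein6 : LaurentSeries ℚ) ^ 2) - 744

/-- `c(j)`: the coefficient of `q ^ j` in `J`. -/
def c (j : ℤ) : ℚ := HahnSeries.coeff modularJ j

/-- The index set `I`: pairs `(j, k)` with `j ∈ {-1, 1, 2, 3, …}` and `1 ≤ k ≤ c(j)`. -/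
def Idx : Type :=
  {p : ℤ × ℕ // (p.1 = -1 ∨ 1 ≤ p.1) ∧ 1 ≤ p.2 ∧ (p.2 : ℚ) ≤ c p.1}

/-- The entries `-(j + p)` of the Borcherds Cartan matrix. -/
def cartan (i i' : Idx) : ℤ := -(i.1.1 + i'.1.1)

/-! ### The Lie algebra `𝔤(A)`, by generators and relations -/

/-- The generators `h_{jk}`, `e_{jk}`, `f_{jk}`. -/
inductive Gen : Type
  | H : Idx → Gen
  | E : Idx → Gen
  | F : Idx → Gen

/-- The free Lie algebra on the generators. -/
abbrev Fr : Type := FreeLieAlgebra ℂ Gen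

/-- The free generator `h_{jk}`. -/
abbrev frH (i : Idx) : Fr := FreeLieAlgebra.of ℂ (Gen.H i)

/-- The free generator `e_{jk}`. -/
abbrev frE (i : Idx) : Fr := FreeLieAlgebra.of ℂ (Gen.E i)

/-- The free generator `f_{jk}`. -/
abbrev frF (i : Idx) : Fr := FreeLieAlgebra.of ℂ (Gen.F i)

/-- The defining relators. In the last two, `s` is the index `(-1, 1)`. -/
inductive Relator : Fr → Prop
  | hh (i i' : Idx) : Relator ⁅frH i, frH i'⁆
  | he (i i' : Idx) : Relator (⁅frH i, frE i'⁆ - (cartan i i' : ℂ) • frE i')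
  | hf (i i' : Idx) : Relator (⁅frH i, frF i'⁆ + (cartan i i' : ℂ) • frF i')
  | ef (i : Idx) : Relator (⁅frE i, frF i⁆ - frH i)
  | ef_ne (i i' : Idx) (hne : i ≠ i') : Relator ⁅frE i, frF i'⁆
  | ee (s i : Idx) (hs : s.1.1 = -1) (hi : 1 ≤ i.1.1) :
      Relator (((LieAlgebra.ad ℂ Fr (frE s)) ^ i.1.1.toNat) (frE i))
  | ff (s i : Idx) (hs : s.1.1 = -1) (hi : 1 ≤ i.1.1) :
      Relator (((LieAlgebra.ad ℂ Fr (frF s)) ^ i.1.1.toNat) (frF i))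

/-- The ideal generated by the relators. -/
def relIdeal : LieIdeal ℂ Fr := LieSubmodule.lieSpan ℂ Fr {x | Relator x}

/-- The Lie algebra `𝔤(A)` of the Borcherds Cartan matrix `A`. -/
abbrev GA : Type := Fr ⧸ relIdeal

/-- The quotient map from the free Lie algebra onto `𝔤(A)`. -/
def toGA : Fr →ₗ⁅ℂ⁆ GA :=
  { (LieSubmodule.Quotient.mk' relIdeal : Fr →ₗ[ℂ] GA) with
    map_lie' := fun {x y} => LieSubmodule.Quotient.mk_bracket relIdeal x y }

/-- The element `h_{jk}` of `𝔤(A)`. -/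
def gaH (i : Idx) : GA := toGA (frH i)

/-- The element `e_{jk}` of `𝔤(A)`. -/
def gaE (i : Idx) : GA := toGA (frE i)

/-- The element `f_{jk}` of `𝔤(A)`. -/
def gaF (i : Idx) : GA := toGA (frF i)

theorem toGA_surjective : Function.Surjective toGA :=
  LieSubmodule.Quotient.surjective_mk' relIdeal

theorem toGA_relator {x : Fr} (hx : Relator x) : toGA x = 0 :=
  (LieSubmodule.Quotient.mk_eq_zero (N := relIdeal)).2 (LieSubmodule.subset_lieSpan hx)

/-! ### The degree derivations of `𝔤(A)`

For `w : I → ℂ` there is a unique derivation of `𝔤(A)` that kills every `h_{jk}` and multiplies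
`e_{jk}` by `w_{jk}` and `f_{jk}` by `-w_{jk}`. It is built as the `ε`-part of a Lie algebra
homomorphism from `𝔤(A)` to `ℂ[ε] ⊗ 𝔤(A)`. -/

open scoped TensorProduct

/-- The `ε⁰`-part of an element of `ℂ[ε] ⊗ 𝔤(A)`. -/
def dualFst : DualNumber ℂ ⊗[ℂ] GA →ₗ[ℂ] GA :=
  (TensorProduct.lid ℂ GA).toLinearMap ∘ₗ
    TensorProduct.map (TrivSqZeroExt.fstHom ℂ ℂ ℂ).toLinearMap LinearMap.id

/-- The `ε¹`-part of an element of `ℂ[ε] ⊗ 𝔤(A)`. -/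
def dualSnd : DualNumber ℂ ⊗[ℂ] GA →ₗ[ℂ] GA :=
  (TensorProduct.lid ℂ GA).toLinearMap ∘ₗ
    TensorProduct.map (TrivSqZeroExt.sndHom ℂ ℂ) LinearMap.id

theorem dualFst_tmul (a : DualNumber ℂ) (x : GA) : dualFst (a ⊗ₜ x) = a.fst • x := by
  simp [dualFst]

theorem dualSnd_tmul (a : DualNumber ℂ) (x : GA) : dualSnd (a ⊗ₜ x) = a.snd • x := by
  simp [dualSnd]

theorem dualFst_lie (z z' : DualNumber ℂ ⊗[ℂ] GA) :
    dualFst ⁅z, z'⁆ = ⁅dualFst z, dualFst z'⁆ := by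
  induction z with
  | zero => rw [show ⁅(0 : DualNumber ℂ ⊗[ℂ] GA), z'⁆ = 0 from zero_lie (L := DualNumber ℂ ⊗[ℂ] GA) (M := DualNumber ℂ ⊗[ℂ] GA) z']; simp
  | add a b ha hb => rw [show ⁅a + b, z'⁆ = ⁅a, z'⁆ + ⁅b, z'⁆ from add_lie a b z']; simp [ha, hb]
  | tmul a x =>
    induction z' with
    | zero => rw [show ⁅a ⊗ₜ[ℂ] x, (0 : DualNumber ℂ ⊗[ℂ] GA)⁆ = 0 from
      lie_zero (L := DualNumber ℂ ⊗[ℂ] GA) (M := DualNumber ℂ ⊗[ℂ] GA) _]; simp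
    | add c d hc hd =>
      rw [show ⁅a ⊗ₜ[ℂ] x, c + d⁆ = ⁅a ⊗ₜ[ℂ] x, c⁆ + ⁅a ⊗ₜ[ℂ] x, d⁆ from
        lie_add (L := DualNumber ℂ ⊗[ℂ] GA) (M := DualNumber ℂ ⊗[ℂ] GA) _ c d]
      simp [hc, hd]
    | tmul b y =>
      simp [LieAlgebra.ExtendScalars.bracket_tmul, dualFst_tmul, smul_smul, mul_comm]

theorem dualSnd_lie (z z' : DualNumber ℂ ⊗[ℂ] GA) :
    dualSnd ⁅z, z'⁆ = ⁅dualFst z, dualSnd z'⁆ + ⁅dualSnd z, dualFst z'⁆ := by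
  induction z with
  | zero => rw [show ⁅(0 : DualNumber ℂ ⊗[ℂ] GA), z'⁆ = 0 from zero_lie (L := DualNumber ℂ ⊗[ℂ] GA) (M := DualNumber ℂ ⊗[ℂ] GA) z']; simp
  | add a b ha hb =>
    rw [show ⁅a + b, z'⁆ = ⁅a, z'⁆ + ⁅b, z'⁆ from add_lie a b z']
    simp only [add_lie, map_add, ha, hb]; abel
  | tmul a x =>
    induction z' with
    | zero => rw [show ⁅a ⊗ₜ[ℂ] x, (0 : DualNumber ℂ ⊗[ℂ] GA)⁆ = 0 from
      lie_zero (L := DualNumber ℂ ⊗[ℂ] GA) (M := DualNumber ℂ ⊗[ℂ] GA) _]; simp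
    | add c d hc hd =>
      rw [show ⁅a ⊗ₜ[ℂ] x, c + d⁆ = ⁅a ⊗ₜ[ℂ] x, c⁆ + ⁅a ⊗ₜ[ℂ] x, d⁆ from
        lie_add (L := DualNumber ℂ ⊗[ℂ] GA) (M := DualNumber ℂ ⊗[ℂ] GA) _ c d]
      simp only [lie_add, map_add, hc, hd]; abel
    | tmul b y =>
      simp [LieAlgebra.ExtendScalars.bracket_tmul, dualFst_tmul, dualSnd_tmul, smul_smul, add_smul,
        mul_comm]

/-- The values on the generators of the homomorphism to `ℂ[ε] ⊗ 𝔤(A)`. -/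
def degVal (w : Idx → ℂ) : Gen → DualNumber ℂ ⊗[ℂ] GA
  | Gen.H i => 1 ⊗ₜ gaH i
  | Gen.E i => (1 + w i • DualNumber.eps : DualNumber ℂ) ⊗ₜ gaE i
  | Gen.F i => (1 - w i • DualNumber.eps : DualNumber ℂ) ⊗ₜ gaF i

/-- The homomorphism from the free Lie algebra to `ℂ[ε] ⊗ 𝔤(A)`. -/
def degFree (w : Idx → ℂ) : Fr →ₗ⁅ℂ⁆ DualNumber ℂ ⊗[ℂ] GA := FreeLieAlgebra.lift ℂ (degVal w)

theorem degFree_H (w : Idx → ℂ) (i : Idx) : degFree w (frH i) = 1 ⊗ₜ gaH i := by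
  simp [degFree, degVal]

theorem degFree_E (w : Idx → ℂ) (i : Idx) :
    degFree w (frE i) = (1 + w i • DualNumber.eps : DualNumber ℂ) ⊗ₜ gaE i := by
  simp [degFree, degVal]

theorem degFree_F (w : Idx → ℂ) (i : Idx) :
    degFree w (frF i) = (1 - w i • DualNumber.eps : DualNumber ℂ) ⊗ₜ gaF i := by
  simp [degFree, degVal]

theorem hom_ad_pow {L : Type} [LieRing L] [LieAlgebra ℂ L] (φ : Fr →ₗ⁅ℂ⁆ L) (x y : Fr) (n : ℕ) :
    φ (((LieAlgebra.ad ℂ Fr x) ^ n) y) = ((LieAlgebra.ad ℂ L (φ x)) ^ n) (φ y) := by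
  induction n with
  | zero => simp
  | succ n ih => simp [pow_succ', ih]

theorem ad_pow_tmul (a b : DualNumber ℂ) (x y : GA) (n : ℕ) :
    ((LieAlgebra.ad ℂ (DualNumber ℂ ⊗[ℂ] GA) (a ⊗ₜ x)) ^ n) (b ⊗ₜ y) =
      (a ^ n * b) ⊗ₜ ((LieAlgebra.ad ℂ GA x) ^ n) y := by
  induction n with
  | zero => simp
  | succ n ih =>
    simp [pow_succ', ih, LieAlgebra.ExtendScalars.bracket_tmul, mul_assoc]

theorem degFree_relator (w : Idx → ℂ) {x : Fr} (hx : Relator x) : degFree w x = 0 := by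
  have h0 := toGA_relator hx
  cases hx with
  | hh i i' =>
    rw [LieHom.map_lie] at h0
    rw [LieHom.map_lie, degFree_H, degFree_H, LieAlgebra.ExtendScalars.bracket_tmul]
    simp only [gaH, h0, TensorProduct.tmul_zero]
  | he i i' =>
    rw [map_sub, LieHom.map_lie, map_smul, sub_eq_zero] at h0
    rw [map_sub, LieHom.map_lie, map_smul, degFree_H, degFree_E,
      LieAlgebra.ExtendScalars.bracket_tmul]
    simp only [gaH, gaE, h0, one_mul, TensorProduct.tmul_smul, sub_self]
  | hf i i' =>
    rw [map_add, LieHom.map_lie, map_smul, add_eq_zero_iff_eq_neg] at h0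
    rw [map_add, LieHom.map_lie, map_smul, degFree_H, degFree_F,
      LieAlgebra.ExtendScalars.bracket_tmul]
    simp only [gaH, gaF, h0, one_mul, TensorProduct.tmul_smul, TensorProduct.tmul_neg,
      neg_add_cancel]
  | ef i =>
    rw [map_sub, LieHom.map_lie, sub_eq_zero] at h0
    have hu : (1 + w i • DualNumber.eps : DualNumber ℂ) * (1 - w i • DualNumber.eps) = 1 := by
      ext <;> simp
    rw [map_sub, LieHom.map_lie, degFree_H, degFree_E, degFree_F,
      LieAlgebra.ExtendScalars.bracket_tmul, hu]
    simp only [gaH, gaE, gaF, h0, sub_self]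
  | ef_ne i i' hne =>
    rw [LieHom.map_lie] at h0
    rw [LieHom.map_lie, degFree_E, degFree_F, LieAlgebra.ExtendScalars.bracket_tmul]
    simp only [gaE, gaF, h0, TensorProduct.tmul_zero]
  | ee s i hs hi =>
    rw [hom_ad_pow] at h0
    rw [hom_ad_pow, degFree_E, degFree_E, ad_pow_tmul]
    simp only [gaE, h0, TensorProduct.tmul_zero]
  | ff s i hs hi =>
    rw [hom_ad_pow] at h0
    rw [hom_ad_pow, degFree_F, degFree_F, ad_pow_tmul]
    simp only [gaF, h0, TensorProduct.tmul_zero]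

theorem relIdeal_le_ker (w : Idx → ℂ) : relIdeal ≤ (degFree w).ker :=
  LieSubmodule.lieSpan_le.2 fun _ hx => LieHom.mem_ker.2 (degFree_relator w hx)

/-- The induced linear map from `𝔤(A)` to `ℂ[ε] ⊗ 𝔤(A)`. -/
def degLin (w : Idx → ℂ) : GA →ₗ[ℂ] DualNumber ℂ ⊗[ℂ] GA :=
  Submodule.liftQ relIdeal.toSubmodule (degFree w : Fr →ₗ[ℂ] DualNumber ℂ ⊗[ℂ] GA)
    fun _ hx => LieHom.mem_ker.1 (relIdeal_le_ker w hx)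

theorem degLin_toGA (w : Idx → ℂ) (x : Fr) : degLin w (toGA x) = degFree w x := rfl

theorem degLin_lie (w : Idx → ℂ) (x y : GA) : degLin w ⁅x, y⁆ = ⁅degLin w x, degLin w y⁆ := by
  obtain ⟨x, rfl⟩ := toGA_surjective x
  obtain ⟨y, rfl⟩ := toGA_surjective y
  rw [← LieHom.map_lie, degLin_toGA, degLin_toGA, degLin_toGA, LieHom.map_lie]

theorem dualFst_degLin (w : Idx → ℂ) (x : GA) : dualFst (degLin w x) = x := by
  obtain ⟨x, rfl⟩ := toGA_surjective x
  rw [degLin_toGA]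
  let φ : Fr →ₗ⁅ℂ⁆ GA :=
    { dualFst ∘ₗ (degFree w : Fr →ₗ[ℂ] DualNumber ℂ ⊗[ℂ] GA) with
      map_lie' := fun {x y} => by
        simp [dualFst_lie] }
  have hφ : φ = toGA := by
    apply FreeLieAlgebra.hom_ext
    rintro (i | i | i)
    · change dualFst (degFree w (frH i)) = toGA (frH i)
      simp [degFree_H, dualFst_tmul, gaH]
    · change dualFst (degFree w (frE i)) = toGA (frE i)
      simp [degFree_E, dualFst_tmul, gaE]
    · change dualFst (degFree w (frF i)) = toGA (frF i)
      simp [degFree_F, dualFst_tmul, gaF]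
  exact DFunLike.congr_fun hφ x

/-- The derivation of `𝔤(A)` with `h_{jk} ↦ 0`, `e_{jk} ↦ w_{jk} e_{jk}`,
`f_{jk} ↦ -w_{jk} f_{jk}`. -/
def degDer (w : Idx → ℂ) : LieDerivation ℂ GA GA where
  toLinearMap := dualSnd ∘ₗ degLin w
  leibniz' x y := by
    simp only [LinearMap.comp_apply, degLin_lie, dualSnd_lie, dualFst_degLin]
    rw [← lie_skew y, sub_neg_eq_add]

theorem degDer_H (w : Idx → ℂ) (i : Idx) : degDer w (gaH i) = 0 := by
  change dualSnd (degFree w (frH i)) = 0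
  simp [degFree_H, dualSnd_tmul]

theorem degDer_E (w : Idx → ℂ) (i : Idx) : degDer w (gaE i) = w i • gaE i := by
  change dualSnd (degFree w (frE i)) = _
  simp [degFree_E, dualSnd_tmul]

theorem degDer_F (w : Idx → ℂ) (i : Idx) : degDer w (gaF i) = -(w i • gaF i) := by
  change dualSnd (degFree w (frF i)) = _
  simp [degFree_F, dualSnd_tmul]

/-! ### The extended algebra, roots and root spaces -/

open Classical in
/-- The derivation `D_{jk}` of `𝔤(A)`. -/
def derD (i : Idx) : LieDerivation ℂ GA GA := degDer fun i' => if i' = i then 1 else 0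

/-- The (abelian) Lie algebra `𝔡₀` of derivations spanned by the `D_{jk}` with
`(j, k) ≠ (-1, 1), (1, 1)`. -/
def d0 : LieSubalgebra ℂ (LieDerivation ℂ GA GA) :=
  LieSubalgebra.lieSpan ℂ _ {D | ∃ i : Idx, i.1 ≠ (-1, 1) ∧ i.1 ≠ (1, 1) ∧ D = derD i}

/-- The extended Lie algebra `𝔤ᵉ = 𝔡₀ ⋉ 𝔤(A)`. -/
abbrev GExt : Type := LieAlgebra.SemiDirectSum GA d0 d0.incl

/-- The inclusion of `𝔤(A)` in `𝔤ᵉ`. -/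
abbrev incl : GA →ₗ⁅ℂ⁆ GExt := LieAlgebra.SemiDirectSum.inl d0.incl

/-- The Cartan subalgebra `𝔥_A`, spanned by the `h_{jk}`. -/
def cartanA : Submodule ℂ GA := Submodule.span ℂ (Set.range gaH)

/-- The Cartan subalgebra `𝔥ᵉ = 𝔡₀ ⊕ 𝔥_A` of `𝔤ᵉ`. -/
def cartanExt : Submodule ℂ GExt :=
  cartanA.map (incl : GA →ₗ[ℂ] GExt) ⊔
    (⊤ : Submodule ℂ d0).map (LieAlgebra.SemiDirectSum.inr d0.incl : d0 →ₗ[ℂ] GExt)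

/-- The dual `(𝔥ᵉ)^*`. -/
abbrev Wt : Type := Module.Dual ℂ cartanExt

/-- The space `𝔪_α = {x ∈ 𝔤(A) | [h, x] = α(h) x for all h ∈ 𝔥ᵉ}`. -/
def rootSpaceGA (α : Wt) : Submodule ℂ GA where
  carrier := {x | ∀ h : cartanExt, ⁅(h : GExt), incl x⁆ = α h • incl x}
  zero_mem' h := by rw [map_zero, lie_zero, smul_zero]
  add_mem' {x y} hx hy h := by rw [map_add, lie_add, hx h, hy h, smul_add]
  smul_mem' t x hx h := by rw [map_smul, lie_smul, hx h, smul_comm]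

/-- The set `Δ` of roots. -/
def roots : Set Wt := {α | α ≠ 0 ∧ rootSpaceGA α ≠ ⊥}

/-- `α` is the simple root `α_{jk}`. -/
def IsSimpleRoot (i : Idx) (α : Wt) : Prop :=
  ∀ h : cartanExt, ⁅(h : GExt), incl (gaE i)⁆ = α h • incl (gaE i)

/-- The set `Δ₊` of positive roots: the roots that are sums of simple roots. -/
def posRoots : Set Wt :=
  {α | α ∈ roots ∧ α ∈ AddSubmonoid.closure {σ : Wt | ∃ i : Idx, IsSimpleRoot i σ}}

/-- The Monster Lie algebra `𝔪 = 𝔤(A) / 𝔷`. -/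
abbrev MLie : Type := GA ⧸ LieAlgebra.center ℂ GA

/-- The space `𝔪_α`, regarded as a subspace of `𝔪`. For `α = 0` this is `𝔥 = 𝔥_A / 𝔷`. -/
def rootSpace (α : Wt) : Submodule ℂ MLie :=
  (rootSpaceGA α).map (LieSubmodule.Quotient.mk' (LieAlgebra.center ℂ GA) : GA →ₗ[ℂ] MLie)

/-- The root span `Σ(α, β)`. -/
inductive RootSpan (α β : Wt) : Wt → Prop
  | base (h : α + β ∈ roots) : RootSpan α β (α + β)
  | left (γ : Wt) (hγ : RootSpan α β γ) (h : γ + α ∈ roots) : RootSpan α β (γ + α)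
  | right (γ : Wt) (hγ : RootSpan α β γ) (h : γ + β ∈ roots) : RootSpan α β (γ + β)

/-- Positive root systems. -/
structure IsPositiveSystem (P : Set Wt) : Prop where
  subset : P ⊆ roots
  disjoint : ∀ α, α ∈ P → -α ∉ P
  cover : ∀ α ∈ roots, α ∈ P ∨ -α ∈ P
  add_mem : ∀ α ∈ P, ∀ β ∈ P, α + β ∈ roots → α + β ∈ P

/-! ### Completions and groups -/

/-- The completion `𝔪̂^P = 𝔫^{-P} ⊕ 𝔥 ⊕ ∏_{α ∈ P} 𝔪_α`: families `y` with `y_γ ∈ 𝔪_γ` for all `γ`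
and with `y_γ ≠ 0` for only finitely many `γ ∉ P`. -/
def completion (P : Set Wt) : Submodule ℂ (Wt → MLie) where
  carrier := {y | (∀ γ, y γ ∈ rootSpace γ) ∧ {γ | γ ∉ P ∧ y γ ≠ 0}.Finite}
  zero_mem' := ⟨fun γ => Submodule.zero_mem _, by simp⟩
  add_mem' {y y'} hy hy' := ⟨fun γ => Submodule.add_mem _ (hy.1 γ) (hy'.1 γ),
    (hy.2.union hy'.2).subset fun γ hγ => by
      by_cases h : y γ = 0
      · refine Or.inr ⟨hγ.1, fun h' => hγ.2 ?_⟩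
        rw [Pi.add_apply, h, h', add_zero]
      · exact Or.inl ⟨hγ.1, h⟩⟩
  smul_mem' t y hy := ⟨fun γ => Submodule.smul_mem _ t (hy.1 γ),
    hy.2.subset fun γ hγ => ⟨hγ.1, fun h => hγ.2 (by rw [Pi.smul_apply, h, smul_zero])⟩⟩

/-- The group of linear automorphisms of `𝔪̂^P`. The product is composition. -/
abbrev LinAut (P : Set Wt) : Type := completion P ≃ₗ[ℂ] completion P

/-- For `x ∈ 𝔪_α`, `φ` is the operator `exp(ad x) = ∑ (ad x)ⁿ / n!` on `𝔪̂^P`, and this series is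
pro-summable. The operator `ad x` has degree `α`, so `((ad x)ⁿ y)_γ = (ad x)ⁿ y_{γ - nα}`. -/
def IsExpAd {P : Set Wt} (α : Wt) (x : MLie) (φ : LinAut P) : Prop :=
  ∀ (y : completion P) (γ : Wt),
    {n : ℕ | ((LieAlgebra.ad ℂ MLie x) ^ n) (y.1 (γ - n • α)) ≠ 0}.Finite ∧
    (φ y).1 γ = ∑ᶠ n : ℕ,
      ((n.factorial : ℂ)⁻¹) • ((LieAlgebra.ad ℂ MLie x) ^ n) (y.1 (γ - n • α))

/-- `s N → φ` in the topology of pointwise convergence, where `𝔪̂^P` carries the product topology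
of its components `𝔪_γ`. Convergence in the finite dimensional space `𝔪_γ` is tested on linear
functionals. -/
def TendstoPtwise {P : Set Wt} (s : ℕ → LinAut P) (φ : LinAut P) : Prop :=
  ∀ (y : completion P) (γ : Wt) (f : Module.Dual ℂ MLie),
    Tendsto (fun N => f ((s N y).1 γ)) atTop (𝓝 (f ((φ y).1 γ)))

/-- `z = [x, y]` in `𝔪̂^P`: in each degree the bracket is a finite sum, and it equals the component
of `z`. -/
def IsBracket {P : Set Wt} (x y z : completion P) : Prop :=
  ∀ γ : Wt, {μ : Wt | ⁅x.1 μ, y.1 (γ - μ)⁆ ≠ 0}.Finite ∧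
    z.1 γ = ∑ᶠ μ : Wt, ⁅x.1 μ, y.1 (γ - μ)⁆

/-- `φ(y) - y` only has components in degrees `μ + κ`, with `μ` a degree in which `y` has a nonzero
component and `κ` a nonempty sum of elements of `P`. -/
def RaisesDegree {P : Set Wt} (φ : LinAut P) : Prop :=
  ∀ (y : completion P) (γ : Wt), (φ y).1 γ ≠ y.1 γ →
    ∃ μ κ : Wt, y.1 μ ≠ 0 ∧ κ ∈ AddSubsemigroup.closure P ∧ γ = μ + κ

theorem RaisesDegree.mul {P : Set Wt} {φ ψ : LinAut P} (hφ : RaisesDegree φ) (hψ : RaisesDegree ψ) :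
    RaisesDegree (φ * ψ) := by
  intro y γ h
  change (φ (ψ y)).1 γ ≠ y.1 γ at h
  by_cases h1 : (φ (ψ y)).1 γ = (ψ y).1 γ
  · exact hψ y γ (h1 ▸ h)
  · obtain ⟨μ, κ, hμ, hκ, rfl⟩ := hφ (ψ y) γ h1
    by_cases h2 : (ψ y).1 μ = y.1 μ
    · exact ⟨μ, κ, h2 ▸ hμ, hκ, rfl⟩
    · obtain ⟨ν, κ', hν, hκ', rfl⟩ := hψ y μ h2
      exact ⟨ν, κ' + κ, hν, AddSubsemigroup.add_mem _ hκ' hκ, add_assoc _ _ _⟩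

/-- The group of unipotent Lie algebra automorphisms of `𝔪̂^P`, for a `P` such that the bracket of
`𝔪` extends to `𝔪̂^P`: automorphisms which, with their inverses, are the identity up to terms of
higher degree. For `P = Δ₊` this is the group `Û⁺`. -/
def unipotentAut (P : Set Wt) : Subgroup (LinAut P) where
  carrier := {φ | (∀ x y z, IsBracket x y z ↔ IsBracket (φ x) (φ y) (φ z)) ∧
    RaisesDegree φ ∧ RaisesDegree φ⁻¹}
  one_mem' := ⟨fun _ _ _ => Iff.rfl, fun _ _ h => absurd rfl h, fun _ _ h => absurd rfl h⟩
  mul_mem' {φ ψ} hφ hψ := ⟨fun x y z => (hψ.1 x y z).trans (hφ.1 _ _ _), hφ.2.1.mul hψ.2.1, by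
    rw [mul_inv_rev]; exact hψ.2.2.mul hφ.2.2⟩
  inv_mem' {φ} hφ := ⟨fun x y z => by
    rw [hφ.1 (φ⁻¹ x) (φ⁻¹ y) (φ⁻¹ z)]
    change _ ↔ IsBracket ((φ * φ⁻¹) x) ((φ * φ⁻¹) y) ((φ * φ⁻¹) z)
    rw [mul_inv_cancel]
    rfl, hφ.2.2, by rw [inv_inv]; exact hφ.2.1⟩

/-- The complete group `Û^P`: the closed subgroup generated by the operators `exp(ad x)`, for
`x ∈ 𝔪_γ` and `γ ∈ P`. -/
def UHat (P : Set Wt) : Subgroup (LinAut P) :=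
  sInf {K : Subgroup (LinAut P) |
    (∀ γ ∈ P, ∀ x ∈ rootSpace γ, ∀ φ : LinAut P, IsExpAd γ x φ → φ ∈ K) ∧
    (∀ (s : ℕ → LinAut P) (φ : LinAut P), (∀ n, s n ∈ K) → TendstoPtwise s φ → φ ∈ K)}

/-! ### The commutator relation -/

/-- The pairs `(i, j)` of positive integers with `iα + jβ ∈ Σ(α, β)`. -/
def spanPairs (α β : Wt) : Set (ℕ × ℕ) :=
  {p | 1 ≤ p.1 ∧ 1 ≤ p.2 ∧ RootSpan α β (p.1 • α + p.2 • β)}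

/-- An enumeration of the pairs `(i, j)` that is compatible with height: `(i, j)` comes before
`(i', j')` whenever `i ≤ i'` and `j ≤ j'`. -/
def RespectsHeight (e : ℕ ≃ ℕ × ℕ) : Prop :=
  ∀ p q : ℕ × ℕ, p ≤ q → e.symm p ≤ e.symm q

/-- A family `z_{ij} ∈ 𝔪_{iα + jβ}` for `iα + jβ ∈ Σ(α, β)`, extended by `0` to all pairs. -/
def IsSpanFamily (α β : Wt) (z : ℕ × ℕ → MLie) : Prop :=
  ∀ p, (p ∈ spanPairs α β → z p ∈ rootSpace (p.1 • α + p.2 • β)) ∧ (p ∉ spanPairs α β → z p = 0)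

/-- The partial products, read from right to left: `W (e (N - 1)) ⋯ W (e 1) W (e 0)`. -/
def partialProd {G : Type} [Group G] (e : ℕ ≃ ℕ × ℕ) (W : ℕ × ℕ → G) : ℕ → G
  | 0 => 1
  | N + 1 => W (e N) * partialProd e W N

/-- In the group `U`, for all `u, v ∈ ℂ`, all exponentials below are well defined and
`(exp(u ad x), exp(v ad y)) = ∏ exp(uⁱ vʲ ad z_{ij})`, where the product is over the pairs `(i, j)`
with `iα + jβ ∈ Σ(α, β)`, in the order given by `e`. -/
def CommutatorRelation {P : Set Wt} (U : Subgroup (LinAut P)) (e : ℕ ≃ ℕ × ℕ) (α β : Wt)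
    (x y : MLie) (z : ℕ × ℕ → MLie) : Prop :=
  ∀ u v : ℂ, ∃ (X Y : LinAut P) (W : ℕ × ℕ → LinAut P),
    X ∈ U ∧ IsExpAd α (u • x) X ∧
    Y ∈ U ∧ IsExpAd β (v • y) Y ∧
    (∀ p ∈ spanPairs α β,
      W p ∈ U ∧ IsExpAd (p.1 • α + p.2 • β) ((u ^ p.1 * v ^ p.2) • z p) (W p)) ∧
    (∀ p ∉ spanPairs α β, W p = 1) ∧
    TendstoPtwise (partialProd e W) (X * Y * X⁻¹ * Y⁻¹)

/-- Products of powers of the operators `ad x` and `ad y`, with `x ∈ 𝔪_α` and `y ∈ 𝔪_β`, form a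
pro-summable family on `𝔪̂^P`: only finitely many of the degrees `δ - iα - jβ` are in `P`. -/
def ProSummablePair (P : Set Wt) (α β : Wt) : Prop :=
  ∀ δ : Wt, {p : ℕ × ℕ | δ - p.1 • α - p.2 • β ∈ P}.Finite

end

end Monster

open Filter Topology
open scoped TensorProduct

namespace Monster

noncomputable section

attribute [local instance] LieRing.ofAssociativeRing

/-! ### The simple root vectors are nonzero -/

section SerreRelation

variable {L : Type*} [LieRing L] [LieAlgebra ℂ L] {e f h : Idx → L}

/-! The core is a formal factorization in two commuting variables u, v. Over an associative algebra
with a graded family of "Lie" subspaces, call a series F Lie-like if E(F) = D F with D a Lie series,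
E being the Euler derivation, and if conjugation by F preserves Lie series (`IsLieLike`). Products
of Lie-like series are Lie-like, and so are the exponentials exp(uⁱvʲz) with z Lie of degree (i, j).
If p is the first nonconstant position where a Lie-like F with constant term 1 is nonzero, E(F) = D
F reads |p| F_p = D_p there, so F_p is Lie (`leading_coeff_mem`). Hence exponentials can be split
off on the right, one by one, in the order of the enumeration. This is done for the commutator of
exp(ux) and exp(vy) in the enveloping algebra of the free Lie algebra on x, y
(`exists_universal_factorization`). It yields elements Z_ij that know nothing about roots or Π. On
the axes u = 0 and v = 0 the commutator is 1, so only i, j ≥ 1 occur, and its coefficient at uv is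
xy − yx. Neither the Campbell–Hausdorff formula nor the injectivity of the free Lie algebra into its
envelope is used.

The factorization is then mapped to operators on 𝔪 by the adjoint representation. A series whose
coefficient at n has degree n₀α + n₁β acts on the completion, because each component of the result
is a finite sum, and this action is multiplicative (`IsAdmissible.act`). In each component the
partial products become constant, so they converge. A right-normed bracket of x and y adds α or β
one at a time, so Z_ij(x, y) vanishes unless iα + jβ ∈ Σ(α, β) (`IsAdmissible.lift_homLie`).

For uniqueness, both sides are applied to an element of 𝔥 that measures height. The component in
degree iα + jβ is polynomial in u and v, and comparing coefficients isolates the pair (i, j). There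
the newest factor contributes [z_ij, h] = −height(iα + jβ) z_ij, while the earlier factors agree by
induction. Roots have nonzero height, so z_ij is determined.

What has to be known about 𝔤(A) is therefore modest. The vectors e_jk are nonzero, which makes the
simple roots well defined; this is seen in a simple highest weight module. The indices (−1, 1) and
(1, 1) exist, since c(−1) = 1 and c(1) = 196884, and a combination of their h's takes the value j +
2 ≥ 1 on α_jk. Every root is plus or minus a sum of simple roots, by the triangular decomposition.
`IsAdmissible` collects the closure and finiteness properties used on the completion; Δ₊ and the
positive systems of part (2) both have them. For part (1) one also checks that exp(ad x) preserves
the partially defined bracket of the completion. -/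

theorem lie_h_ad_pow (hf : ∀ i i', ⁅h i, f i'⁆ = -(cartan i i' : ℂ) • f i') (s i : Idx) (n : ℕ) :
    ⁅h s, ((LieAlgebra.ad ℂ L (f s)) ^ n) (f i)⁆ =
      -((n : ℂ) * cartan s s + cartan s i) • ((LieAlgebra.ad ℂ L (f s)) ^ n) (f i) := by
  induction n with
  | zero => simp [hf]
  | succ n ih =>
    rw [pow_succ', Module.End.mul_apply, LieAlgebra.ad_apply, leibniz_lie, ih, hf, smul_lie,
      lie_smul, ← add_smul]
    congr 1
    push_cast
    ring

/-- The Serre element `(ad f_s)ʲ f_i` commutes with every `e_k`. -/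
theorem lie_serre_eq_zero (hf : ∀ i i', ⁅h i, f i'⁆ = -(cartan i i' : ℂ) • f i')
    (ef : ∀ i, ⁅e i, f i⁆ = h i) (ef_ne : ∀ i i', i ≠ i' → ⁅e i, f i'⁆ = 0)
    (s i k : Idx) (hs : s.1.1 = -1) (hi : 1 ≤ i.1.1) :
    ⁅e k, ((LieAlgebra.ad ℂ L (f s)) ^ i.1.1.toNat) (f i)⁆ = 0 := by
  have hsi : s ≠ i := by rintro rfl; omega
  by_cases hks : k = s
  · subst hks
    -- The `sl₂` computation for s. The coefficient is −(n + 1)(n + a_si) because a_ss = 2, and a_si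
    -- = 1 − j makes it vanish at n + 1 = j.
    have key : ∀ n : ℕ, ⁅e k, ((LieAlgebra.ad ℂ L (f k)) ^ (n + 1)) (f i)⁆ =
        -(((n : ℂ) + 1) * (n + cartan k i)) • ((LieAlgebra.ad ℂ L (f k)) ^ n) (f i) := by
      intro n
      induction n with
      | zero => simp [ef, hf, leibniz_lie (e k), ef_ne _ _ hsi]
      | succ n ih =>
        rw [pow_succ', Module.End.mul_apply, LieAlgebra.ad_apply, leibniz_lie, ih, ef,
          lie_h_ad_pow hf, lie_smul]
        conv_lhs =>
          enter [2, 2]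
          rw [← LieAlgebra.ad_apply ℂ, ← Module.End.mul_apply, ← pow_succ']
        rw [← add_smul]
        congr 1
        have : (cartan k k : ℂ) = 2 := by norm_num [cartan, hs]
        rw [this]
        push_cast
        ring
    obtain ⟨n, hn⟩ : ∃ n : ℕ, i.1.1 = n + 1 := ⟨(i.1.1 - 1).toNat, by omega⟩
    have h1 : i.1.1.toNat = n + 1 := by omega
    have h2 : (n : ℂ) + cartan k i = 0 := by
      have : (n : ℤ) + cartan k i = 0 := by simp [cartan, hs, hn]
      exact_mod_cast this
    rw [h1, key, h2, mul_zero, neg_zero, zero_smul]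
  · have hstep : ∀ n : ℕ, ⁅e k, ((LieAlgebra.ad ℂ L (f s)) ^ n) (f i)⁆ =
        ((LieAlgebra.ad ℂ L (f s)) ^ n) ⁅e k, f i⁆ := by
      intro n
      induction n with
      | zero => simp
      | succ n ih =>
        rw [pow_succ', Module.End.mul_apply, LieAlgebra.ad_apply, leibniz_lie, ih,
          ef_ne _ _ hks, zero_lie, zero_add, Module.End.mul_apply, LieAlgebra.ad_apply]
    rw [hstep]
    by_cases hki : k = i
    · subst hki
      obtain ⟨n, hn⟩ : ∃ n : ℕ, k.1.1 = n + 1 := ⟨(k.1.1 - 1).toNat, by omega⟩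
      have h1 : k.1.1.toNat = n + 1 := by omega
      have h2 : ⁅f s, h k⁆ = (cartan k s : ℂ) • f s := by
        rw [← lie_skew, hf, neg_smul, neg_neg]
      rw [h1, ef, pow_succ, Module.End.mul_apply, LieAlgebra.ad_apply, h2, map_smul]
      -- One `ad f_s` turns h_i into a_is f_s. For j = 1 the factor a_is = 1 − j is zero; for j ≥ 2
      -- another `ad f_s` kills f_s.
      rcases n with _ | n
      · simp [cartan, hs, hn]
      · rw [pow_succ, Module.End.mul_apply, LieAlgebra.ad_apply, lie_self, map_zero, smul_zero]
    · rw [ef_ne _ _ hki, map_zero]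

end SerreRelation

/-! ### The Verma module whose highest weight is 1 on every h_i, and its maximal submodule. -/

/-- The space underlying the Verma module, with a basis of words in the `f_i`. -/
def Words : Type := List Idx →₀ ℂ

instance : AddCommGroup Words := inferInstanceAs (AddCommGroup (List Idx →₀ ℂ))

instance : Module ℂ Words := inferInstanceAs (Module ℂ (List Idx →₀ ℂ))

/-- The basis vector of a word. -/
def word (l : List Idx) : Words := Finsupp.single l (1 : ℂ)

/-- The linear map with given values on the words. -/
def wordLin {M : Type*} [AddCommGroup M] [Module ℂ M] (v : List Idx → M) : Words →ₗ[ℂ] M :=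
  Finsupp.linearCombination ℂ v

theorem wordLin_word {M : Type*} [AddCommGroup M] [Module ℂ M] (v : List Idx → M) (l : List Idx) :
    wordLin v (word l) = v l :=
  (Finsupp.linearCombination_single ℂ (1 : ℂ) l).trans (one_smul ℂ _)

theorem wordLin_ext {M : Type*} [AddCommGroup M] [Module ℂ M] {φ ψ : Words →ₗ[ℂ] M}
    (h : ∀ l, φ (word l) = ψ (word l)) : φ = ψ :=
  Finsupp.lhom_ext' fun l => LinearMap.ext_ring (h l)

/-- The operator `f_i` on words. -/
def vermaF (i : Idx) : Module.End ℂ Words := wordLin fun l => word (i :: l)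

/-- The weight of a word, for `h_i`. -/
def wordWt (i : Idx) (l : List Idx) : ℂ := 1 - (l.map fun k => (cartan i k : ℂ)).sum

/-- The operator `h_i` on words. -/
def vermaH (i : Idx) : Module.End ℂ Words := wordLin fun l => wordWt i l • word l

open Classical in
/-- The operator `e_k` on a basis word. -/
def vermaEWord (k : Idx) : List Idx → Words
  | [] => 0
  | i :: l => vermaF i (vermaEWord k l) + if k = i then vermaH k (word l) else 0

/-- The operator `e_k` on words. -/
def vermaE (k : Idx) : Module.End ℂ Words := wordLin (vermaEWord k)

theorem vermaF_single (i : Idx) (l : List Idx) : vermaF i (word l) = word (i :: l) :=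
  wordLin_word _ _

theorem vermaH_single (i : Idx) (l : List Idx) : vermaH i (word l) = wordWt i l • word l :=
  wordLin_word _ _

theorem vermaE_single (k : Idx) (l : List Idx) : vermaE k (word l) = vermaEWord k l :=
  wordLin_word _ _

theorem wordWt_cons (i k : Idx) (l : List Idx) :
    wordWt i (k :: l) = wordWt i l - cartan i k := by
  simp [wordWt]; ring

theorem verma_hh (i i' : Idx) : ⁅vermaH i, vermaH i'⁆ = 0 := by
  refine wordLin_ext fun l => ?_
  simp only [Ring.lie_def, LinearMap.sub_apply, Module.End.mul_apply, vermaH_single, map_smul,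
    LinearMap.zero_apply]
  rw [smul_comm, sub_self]

theorem verma_hf (i i' : Idx) : ⁅vermaH i, vermaF i'⁆ = -(cartan i i' : ℂ) • vermaF i' := by
  refine wordLin_ext fun l => ?_
  simp only [Ring.lie_def, LinearMap.sub_apply, Module.End.mul_apply, vermaF_single, vermaH_single,
    map_smul, wordWt_cons, LinearMap.smul_apply, ← sub_smul]
  congr 1
  ring

theorem verma_hf_apply (i i' : Idx) (w : Words) :
    vermaH i (vermaF i' w) = vermaF i' (vermaH i w) - (cartan i i' : ℂ) • vermaF i' w := by
  have := LinearMap.congr_fun (verma_hf i i') w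
  simp only [Ring.lie_def, LinearMap.sub_apply, Module.End.mul_apply, LinearMap.smul_apply] at this
  rw [sub_eq_iff_eq_add] at this
  rw [this, neg_smul]; abel

theorem verma_he_apply_word (i k : Idx) (l : List Idx) :
    vermaH i (vermaEWord k l) = wordWt i l • vermaEWord k l + (cartan i k : ℂ) • vermaEWord k l := by
  induction l with
  | nil => simp [vermaEWord]
  | cons m l ih =>
    rw [vermaEWord, map_add, verma_hf_apply, ih, wordWt_cons]
    by_cases hk : k = m
    · subst hk
      simp only [if_true, vermaH_single, map_add, map_smul]
      module
    · simp only [if_neg hk, map_add, map_smul, map_zero]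
      module

theorem verma_he (i i' : Idx) : ⁅vermaH i, vermaE i'⁆ = (cartan i i' : ℂ) • vermaE i' := by
  refine wordLin_ext fun l => ?_
  simp only [Ring.lie_def, LinearMap.sub_apply, Module.End.mul_apply, vermaE_single, vermaH_single,
    map_smul, LinearMap.smul_apply, verma_he_apply_word]
  module

open Classical in
theorem verma_ef_apply (k i : Idx) (w : Words) :
    vermaE k (vermaF i w) = vermaF i (vermaE k w) + if k = i then vermaH k w else 0 := by
  have : vermaE k * vermaF i = vermaF i * vermaE k + if k = i then vermaH k else 0 := by
    refine wordLin_ext fun l => ?_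
    simp only [Module.End.mul_apply, LinearMap.add_apply, vermaF_single, vermaE_single, vermaEWord]
    split_ifs <;> simp
  have := LinearMap.congr_fun this w
  simp only [Module.End.mul_apply, LinearMap.add_apply] at this
  rw [this]
  split_ifs <;> simp

theorem verma_ef (i : Idx) : ⁅vermaE i, vermaF i⁆ = vermaH i := by
  refine LinearMap.ext fun w => ?_
  simp [Ring.lie_def, verma_ef_apply]

theorem verma_ef_ne (i i' : Idx) (hne : i ≠ i') : ⁅vermaE i, vermaF i'⁆ = 0 := by
  refine LinearMap.ext fun w => ?_
  simp [Ring.lie_def, verma_ef_apply, hne]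

/-- The highest weight vector. -/
def vac : Words := word []

/-- The coefficient of the highest weight vector. -/
def vacCoeff : Words →ₗ[ℂ] ℂ := wordLin fun l => if l.isEmpty then 1 else 0

theorem vermaE_vac (k : Idx) : vermaE k vac = 0 := by
  simp [vac, vermaE_single, vermaEWord]

theorem vacCoeff_vermaF (i : Idx) (w : Words) : vacCoeff (vermaF i w) = 0 := by
  have : vacCoeff ∘ₗ vermaF i = 0 := by
    refine wordLin_ext fun l => ?_
    simp [vacCoeff, vermaF_single, wordLin_word]
  exact LinearMap.congr_fun this w

theorem vacCoeff_vermaH (i : Idx) (w : Words) : vacCoeff (vermaH i w) = vacCoeff w := by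
  have : vacCoeff ∘ₗ vermaH i = vacCoeff := by
    refine wordLin_ext fun l => ?_
    rcases l with _ | ⟨k, l⟩ <;> simp [vacCoeff, vermaH_single, wordLin_word, wordWt]
  exact LinearMap.congr_fun this w

/-- Apply the operators `e_k`, for `k` in a list, one after the other. -/
def vermaEs : List Idx → Words → Words
  | [], w => w
  | k :: l, w => vermaEs l (vermaE k w)

theorem vermaEs_add (l : List Idx) (w w' : Words) :
    vermaEs l (w + w') = vermaEs l w + vermaEs l w' := by
  induction l generalizing w w' with
  | nil => rfl
  | cons k l ih => simp [vermaEs, ih]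

theorem vermaEs_smul (l : List Idx) (t : ℂ) (w : Words) :
    vermaEs l (t • w) = t • vermaEs l w := by
  induction l generalizing w with
  | nil => rfl
  | cons k l ih => simp [vermaEs, ih]

/-- The maximal proper submodule of the Verma module. -/
def vermaMax : Submodule ℂ Words where
  carrier := {w | ∀ l, vacCoeff (vermaEs l w) = 0}
  zero_mem' l := by
    rw [← zero_smul ℂ (0 : Words), vermaEs_smul, map_smul, zero_smul]
  add_mem' hw hw' l := by rw [vermaEs_add, map_add, hw, hw', add_zero]
  smul_mem' t w hw l := by rw [vermaEs_smul, map_smul, hw, smul_zero]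

theorem vermaE_mem_max (k : Idx) {w : Words} (hw : w ∈ vermaMax) : vermaE k w ∈ vermaMax :=
  fun l => hw (k :: l)

theorem vermaH_mem_max (i : Idx) {w : Words} (hw : w ∈ vermaMax) : vermaH i w ∈ vermaMax := by
  intro l
  induction l generalizing w with
  | nil => exact (vacCoeff_vermaH i w).trans (hw [])
  | cons k l ih =>
    have h1 := LinearMap.congr_fun (verma_he i k) w
    simp only [Ring.lie_def, LinearMap.sub_apply, Module.End.mul_apply, LinearMap.smul_apply] at h1
    have h2 : vermaE k (vermaH i w) = vermaH i (vermaE k w) + (-(cartan i k : ℂ)) • vermaE k w := by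
      rw [neg_smul, ← h1]; abel
    rw [vermaEs, h2, vermaEs_add, map_add, ih (vermaE_mem_max k hw), vermaEs_smul, map_smul,
      vermaE_mem_max k hw l, smul_zero, add_zero]

theorem vermaF_mem_max (i : Idx) {w : Words} (hw : w ∈ vermaMax) : vermaF i w ∈ vermaMax := by
  intro l
  induction l generalizing w with
  | nil => exact vacCoeff_vermaF i w
  | cons k l ih =>
    rw [vermaEs, verma_ef_apply, vermaEs_add, map_add, ih (vermaE_mem_max k hw), zero_add]
    split_ifs
    · exact vermaH_mem_max k hw l
    · exact vermaMax.zero_mem l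

/-- The action of the free Lie algebra on the Verma module, on generators. -/
def vermaVal : Gen → Module.End ℂ Words
  | Gen.H i => vermaH i
  | Gen.E i => vermaE i
  | Gen.F i => vermaF i

/-- The operators that preserve the maximal submodule. -/
def vermaStab : LieSubalgebra ℂ (Module.End ℂ Words) where
  carrier := {φ | ∀ w ∈ vermaMax, φ w ∈ vermaMax}
  zero_mem' _ _ := vermaMax.zero_mem
  add_mem' h h' w hw := vermaMax.add_mem (h w hw) (h' w hw)
  smul_mem' t _ h w hw := vermaMax.smul_mem t (h w hw)
  lie_mem' h h' w hw := vermaMax.sub_mem (h _ (h' w hw)) (h' _ (h w hw))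

theorem vermaVal_mem (g : Gen) : vermaVal g ∈ vermaStab := by
  rcases g with i | i | i
  · exact fun w hw => vermaH_mem_max i hw
  · exact fun w hw => vermaE_mem_max i hw
  · exact fun w hw => vermaF_mem_max i hw

/-- The action of the free Lie algebra on the Verma module. -/
def vermaRep : Fr →ₗ⁅ℂ⁆ vermaStab :=
  FreeLieAlgebra.lift ℂ fun g => ⟨vermaVal g, vermaVal_mem g⟩

theorem vermaRep_of (g : Gen) :
    (vermaRep (FreeLieAlgebra.of ℂ g) : Module.End ℂ Words) = vermaVal g := by
  simp [vermaRep]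

/-- The elements of the free Lie algebra that act as `0` on the simple quotient. -/
def vermaKer : LieIdeal ℂ Fr where
  carrier := {x | ∀ w, (vermaRep x : Module.End ℂ Words) w ∈ vermaMax}
  zero_mem' w := by simp
  add_mem' {x y} hx hy w := by
    rw [map_add]; exact vermaMax.add_mem (hx w) (hy w)
  smul_mem' t x hx w := by
    rw [map_smul]; exact vermaMax.smul_mem t (hx w)
  lie_mem {x y} hy w := by
    rw [LieHom.map_lie, LieSubalgebra.coe_bracket, Ring.lie_def]
    exact vermaMax.sub_mem ((vermaRep x).2 _ (hy w)) (hy _)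

/-! ### The Serre relations on the simple quotient. -/

theorem serreE_vac (s i : Idx) (n : ℕ) :
    ((LieAlgebra.ad ℂ (Module.End ℂ Words) (vermaE s)) ^ n) (vermaE i) vac = 0 := by
  induction n with
  | zero => exact vermaE_vac i
  | succ n ih =>
    rw [pow_succ', Module.End.mul_apply, LieAlgebra.ad_apply, Ring.lie_def, LinearMap.sub_apply,
      Module.End.mul_apply, Module.End.mul_apply, ih, vermaE_vac, map_zero, map_zero, sub_zero]

theorem vacCoeff_serreF (s i : Idx) (n : ℕ) (w : Words) :
    vacCoeff (((LieAlgebra.ad ℂ (Module.End ℂ Words) (vermaF s)) ^ n) (vermaF i) w) = 0 := by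
  induction n generalizing w with
  | zero => exact vacCoeff_vermaF i w
  | succ n ih =>
    rw [pow_succ', Module.End.mul_apply, LieAlgebra.ad_apply, Ring.lie_def, LinearMap.sub_apply,
      Module.End.mul_apply, Module.End.mul_apply, map_sub, ih, vacCoeff_vermaF, sub_zero]

theorem coe_vermaRep_ad_pow (x y : Fr) (n : ℕ) :
    (vermaRep (((LieAlgebra.ad ℂ Fr x) ^ n) y) : Module.End ℂ Words) =
      ((LieAlgebra.ad ℂ (Module.End ℂ Words) (vermaRep x)) ^ n) (vermaRep y) := by
  induction n with
  | zero => simp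
  | succ n ih => simp [pow_succ', ih]

/-- The Serre element in the e's kills the highest weight vector and commutes with every f_k, so it
kills every word. The commutation is `lie_serre_eq_zero` with e and f exchanged and h replaced by
−h. -/
theorem serreE_eq_zero (s i : Idx) (hs : s.1.1 = -1) (hi : 1 ≤ i.1.1) :
    ((LieAlgebra.ad ℂ (Module.End ℂ Words) (vermaE s)) ^ i.1.1.toNat) (vermaE i) = 0 := by
  refine wordLin_ext fun l => ?_
  induction l with
  | nil => exact serreE_vac s i _
  | cons k l ih =>
    have h1 := lie_serre_eq_zero (e := vermaF) (f := vermaE) (h := fun i => -vermaH i)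
      (fun i i' => by rw [neg_lie, verma_he, neg_smul])
      (fun i => by rw [← lie_skew, verma_ef])
      (fun i i' hne => by rw [← lie_skew, verma_ef_ne _ _ hne.symm, neg_zero]) s i k hs hi
    have h2 := LinearMap.congr_fun h1 (word l)
    rw [Ring.lie_def, LinearMap.sub_apply, Module.End.mul_apply, Module.End.mul_apply, ih,
      LinearMap.zero_apply, map_zero, zero_sub, neg_eq_zero,
      vermaF_single] at h2
    exact h2

theorem vermaEs_serreF (s i : Idx) (hs : s.1.1 = -1) (hi : 1 ≤ i.1.1) (l : List Idx) (w : Words) :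
    vermaEs l (((LieAlgebra.ad ℂ (Module.End ℂ Words) (vermaF s)) ^ i.1.1.toNat) (vermaF i) w) =
      ((LieAlgebra.ad ℂ (Module.End ℂ Words) (vermaF s)) ^ i.1.1.toNat) (vermaF i)
        (vermaEs l w) := by
  induction l generalizing w with
  | nil => rfl
  | cons k l ih =>
    have h1 := lie_serre_eq_zero verma_hf verma_ef verma_ef_ne s i k hs hi
    have h2 := LinearMap.congr_fun h1 w
    rw [Ring.lie_def, LinearMap.sub_apply, Module.End.mul_apply, Module.End.mul_apply,
      LinearMap.zero_apply, sub_eq_zero] at h2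
    rw [vermaEs, h2, ih, vermaEs]

/-- All relations except the Serre relation in the f's hold on the Verma module itself. The Serre
element in the f's need not act as zero there, but it commutes with every e_k and its image has no
highest weight component. So no string of e_k leads from its image to the highest weight vector,
which means that the image lies in the maximal submodule. -/
theorem relIdeal_le_vermaKer : relIdeal ≤ vermaKer := by
  refine LieSubmodule.lieSpan_le.2 fun x hx => ?_
  have of_zero : (vermaRep x : Module.End ℂ Words) = 0 → x ∈ vermaKer := fun h w => by
    rw [h]; exact vermaMax.zero_mem
  cases hx with
  | hh i i' =>
    refine of_zero ?_
    simpa [vermaRep_of, vermaVal] using verma_hh i i'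
  | he i i' =>
    refine of_zero ?_
    simpa [vermaRep_of, vermaVal, sub_eq_zero] using verma_he i i'
  | hf i i' =>
    refine of_zero ?_
    simpa [vermaRep_of, vermaVal, add_eq_zero_iff_eq_neg, neg_smul] using verma_hf i i'
  | ef i =>
    refine of_zero ?_
    simpa [vermaRep_of, vermaVal, sub_eq_zero] using verma_ef i
  | ef_ne i i' hne =>
    refine of_zero ?_
    simpa [vermaRep_of, vermaVal] using verma_ef_ne i i' hne
  | ee s i hs hi =>
    refine of_zero ?_
    rw [coe_vermaRep_ad_pow, vermaRep_of, vermaRep_of]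
    exact serreE_eq_zero s i hs hi
  | ff s i hs hi =>
    intro w l
    rw [coe_vermaRep_ad_pow, vermaRep_of, vermaRep_of]
    change vacCoeff (vermaEs l (((LieAlgebra.ad ℂ (Module.End ℂ Words) (vermaF s)) ^
      i.1.1.toNat) (vermaF i) w)) = 0
    rw [vermaEs_serreF s i hs hi, vacCoeff_serreF]

/-- On the highest weight vector v one has e_i f_i v = h_i v = v, so e_i acts nontrivially on the
simple quotient. This is why the highest weight was chosen to be 1 on every h_i. -/
theorem gaE_ne_zero (i : Idx) : gaE i ≠ 0 := by
  intro h
  have h1 : frE i ∈ relIdeal := (LieSubmodule.Quotient.mk_eq_zero (N := relIdeal)).1 h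
  have h2 := relIdeal_le_vermaKer h1 (vermaF i vac) []
  rw [vermaRep_of] at h2
  change vacCoeff (vermaE i (vermaF i vac)) = 0 at h2
  rw [verma_ef_apply, vermaE_vac, map_zero, if_pos rfl, zero_add, vacCoeff_vermaH] at h2
  simp [vacCoeff, vac, wordLin_word] at h2

/-! ### The coefficients `c(-1)` and `c(1)` -/

section Coefficients

open PowerSeries

theorem coeff_eisenstein4 :
    coeff 0 eisenstein4 = 1 ∧ coeff 1 eisenstein4 = 240 ∧ coeff 2 eisenstein4 = 2160 ∧
      coeff 3 eisenstein4 = 6720 := by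
  have h2 : ArithmeticFunction.sigma 3 2 = 9 := by rw [ArithmeticFunction.sigma_apply]; rfl
  have h3 : ArithmeticFunction.sigma 3 3 = 28 := by rw [ArithmeticFunction.sigma_apply]; rfl
  refine ⟨?_, ?_, ?_, ?_⟩ <;>
    simp only [eisenstein4, map_add, map_smul, coeff_mk, coeff_one, h2, h3,
      ArithmeticFunction.sigma_one, ArithmeticFunction.map_zero] <;> norm_num

theorem coeff_eisenstein6 :
    coeff 0 eisenstein6 = 1 ∧ coeff 1 eisenstein6 = -504 ∧ coeff 2 eisenstein6 = -16632 ∧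
      coeff 3 eisenstein6 = -122976 := by
  have h2 : ArithmeticFunction.sigma 5 2 = 33 := by rw [ArithmeticFunction.sigma_apply]; rfl
  have h3 : ArithmeticFunction.sigma 5 3 = 244 := by rw [ArithmeticFunction.sigma_apply]; rfl
  refine ⟨?_, ?_, ?_, ?_⟩ <;>
    simp only [eisenstein6, map_sub, map_smul, coeff_mk, coeff_one, h2, h3,
      ArithmeticFunction.sigma_one, ArithmeticFunction.map_zero] <;> norm_num

theorem coeff_mul_le_three (f g : PowerSeries ℚ) :
    coeff 0 (f * g) = coeff 0 f * coeff 0 g ∧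
    coeff 1 (f * g) = coeff 0 f * coeff 1 g + coeff 1 f * coeff 0 g ∧
    coeff 2 (f * g) = coeff 0 f * coeff 2 g + coeff 1 f * coeff 1 g + coeff 2 f * coeff 0 g ∧
    coeff 3 (f * g) = coeff 0 f * coeff 3 g + coeff 1 f * coeff 2 g + coeff 2 f * coeff 1 g +
      coeff 3 f * coeff 0 g := by
  refine ⟨?_, ?_, ?_, ?_⟩ <;>
    simp [PowerSeries.coeff_mul, Finset.Nat.antidiagonal_succ, -coeff_zero_eq_constantCoeff] <;> ring

theorem coeff_eisenstein4_cube :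
    coeff 0 (eisenstein4 ^ 3) = 1 ∧ coeff 1 (eisenstein4 ^ 3) = 720 ∧
      coeff 2 (eisenstein4 ^ 3) = 179280 ∧ coeff 3 (eisenstein4 ^ 3) = 16954560 := by
  obtain ⟨a0, a1, a2, a3⟩ := coeff_eisenstein4
  obtain ⟨b0, b1, b2, b3⟩ := coeff_mul_le_three eisenstein4 eisenstein4
  obtain ⟨c0, c1, c2, c3⟩ := coeff_mul_le_three (eisenstein4 * eisenstein4) eisenstein4
  rw [a0, a1, a2, a3] at *
  rw [b0, b1, b2, b3] at *
  rw [pow_three', c0, c1, c2, c3]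
  norm_num

theorem coeff_eisenstein6_sq :
    coeff 0 (eisenstein6 ^ 2) = 1 ∧ coeff 1 (eisenstein6 ^ 2) = -1008 ∧
      coeff 2 (eisenstein6 ^ 2) = 220752 ∧ coeff 3 (eisenstein6 ^ 2) = 16519104 := by
  obtain ⟨a0, a1, a2, a3⟩ := coeff_eisenstein6
  obtain ⟨b0, b1, b2, b3⟩ := coeff_mul_le_three eisenstein6 eisenstein6
  rw [a0, a1, a2, a3] at *
  rw [pow_two, b0, b1, b2, b3]
  norm_num

/-- Write E₄³ − E₆² = q d. Then J + 744 = q⁻¹K with K d = 1728 E₄³, and this is solved for the first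
three coefficients of K using d = 1728 − 41472 q + 435456 q² + ⋯. -/
theorem exists_modularJ_eq : ∃ K : PowerSeries ℚ,
    modularJ = (K : LaurentSeries ℚ) * HahnSeries.single (-1) 1 - 744 ∧
      coeff 0 K = 1 ∧ coeff 2 K = 196884 := by
  obtain ⟨a0, a1, a2, a3⟩ := coeff_eisenstein4_cube
  obtain ⟨b0, b1, b2, b3⟩ := coeff_eisenstein6_sq
  obtain ⟨d, hd⟩ : X ∣ eisenstein4 ^ 3 - eisenstein6 ^ 2 := by
    rw [X_dvd_iff, ← coeff_zero_eq_constantCoeff_apply, map_sub, a0, b0, sub_self]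
  have d0 : coeff 0 d = 1728 := by
    rw [← coeff_succ_X_mul 0 d, ← hd, zero_add, map_sub, a1, b1]; norm_num
  have d1 : coeff 1 d = -41472 := by
    rw [← coeff_succ_X_mul 1 d, ← hd, map_sub, a2, b2]; norm_num
  have d2 : coeff 2 d = 435456 := by
    rw [← coeff_succ_X_mul 2 d, ← hd, map_sub, a3, b3]; norm_num
  have hc : constantCoeff d ≠ 0 := by
    rw [← coeff_zero_eq_constantCoeff_apply, d0]; norm_num
  have hd0 : d ≠ 0 := by rintro rfl; simp at hc
  set K : PowerSeries ℚ := (1728 : ℚ) • (eisenstein4 ^ 3) * d⁻¹ with hK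
  have hKd : K * d = (1728 : ℚ) • (eisenstein4 ^ 3) := by
    rw [hK, mul_assoc, PowerSeries.inv_mul_cancel d hc, mul_one]
  obtain ⟨k0, k1, k2, -⟩ := coeff_mul_le_three K d
  rw [hKd, map_smul, smul_eq_mul] at k0 k1 k2
  rw [a0, d0] at k0
  have K0 : coeff 0 K = 1 := by linarith
  rw [a1, d0, d1, K0] at k1
  have K1 : coeff 1 K = 744 := by linarith
  rw [a2, d0, d1, d2, K0, K1] at k2
  refine ⟨K, ?_, K0, by linarith⟩
  have hdL : (d : LaurentSeries ℚ) ≠ 0 := by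
    intro h
    exact hd0 (HahnSeries.ofPowerSeries_injective (h.trans (map_zero _).symm))
  have hX : (HahnSeries.single 1 1 : LaurentSeries ℚ) ≠ 0 := by simp
  have hX' : (HahnSeries.single (-1) 1 : LaurentSeries ℚ) * HahnSeries.single 1 1 = 1 := by
    rw [HahnSeries.single_mul_single]; simp
  have e1 : (eisenstein4 : LaurentSeries ℚ) ^ 3 - (eisenstein6 : LaurentSeries ℚ) ^ 2 =
      HahnSeries.single 1 1 * (d : LaurentSeries ℚ) := by
    rw [← PowerSeries.coe_X, ← PowerSeries.coe_mul, ← hd]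
    simp
  have e2 : (1728 : LaurentSeries ℚ) * (eisenstein4 : LaurentSeries ℚ) ^ 3 =
      (K : LaurentSeries ℚ) * (d : LaurentSeries ℚ) := by
    have h1728 : algebraMap ℚ (PowerSeries ℚ) 1728 = 1728 := map_ofNat _ 1728
    rw [← PowerSeries.coe_mul, hKd, Algebra.smul_def, h1728, map_mul, map_pow, map_ofNat]
  rw [modularJ, e1, e2]
  congr 1
  rw [div_eq_iff (mul_ne_zero hX hdL)]
  rw [← mul_assoc, mul_assoc (K : LaurentSeries ℚ) _ (HahnSeries.single 1 1), hX', mul_one]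

theorem c_neg_one : c (-1) = 1 := by
  obtain ⟨K, h, h0, -⟩ := exists_modularJ_eq
  have h744 : HahnSeries.coeff (744 : LaurentSeries ℚ) (-1) = 0 := by
    rw [show (744 : LaurentSeries ℚ) = HahnSeries.C (744 : ℚ) from (map_ofNat _ 744).symm,
      HahnSeries.C_apply, HahnSeries.coeff_single_of_ne (by norm_num)]
  rw [c, h, HahnSeries.coeff_sub, h744, sub_zero]
  have h1 := HahnSeries.coeff_mul_single_add (r := (1 : ℚ)) (x := (K : LaurentSeries ℚ))
    (a := ((0 : ℕ) : ℤ)) (b := -1)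
  rw [mul_one, LaurentSeries.coeff_coe_powerSeries, h0] at h1
  exact h1

theorem c_one : c 1 = 196884 := by
  obtain ⟨K, h, -, h2⟩ := exists_modularJ_eq
  have h744 : HahnSeries.coeff (744 : LaurentSeries ℚ) 1 = 0 := by
    rw [show (744 : LaurentSeries ℚ) = HahnSeries.C (744 : ℚ) from (map_ofNat _ 744).symm,
      HahnSeries.C_apply, HahnSeries.coeff_single_of_ne (by norm_num)]
  rw [c, h, HahnSeries.coeff_sub, h744, sub_zero]
  have h1 := HahnSeries.coeff_mul_single_add (r := (1 : ℚ)) (x := (K : LaurentSeries ℚ))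
    (a := ((2 : ℕ) : ℤ)) (b := -1)
  rw [mul_one, LaurentSeries.coeff_coe_powerSeries, h2] at h1
  exact h1

end Coefficients

/-- The index `(-1, 1)`. -/
def idxNegOne : Idx := ⟨(-1, 1), Or.inl rfl, le_rfl, by simp [c_neg_one]⟩

/-- The index `(1, 1)`. -/
def idxOne : Idx := ⟨(1, 1), Or.inr le_rfl, le_rfl, by simp [c_one]⟩

theorem neg_one_le_idx (i : Idx) : -1 ≤ i.1.1 := by
  rcases i.2.1 with h | h <;> omega

theorem finite_idx_le (n : ℤ) : {i : Idx | i.1.1 ≤ n}.Finite := by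
  have h : (⋃ j ∈ Set.Icc (-1) n, Prod.mk j '' {k : ℕ | (k : ℚ) ≤ c j}).Finite := by
    refine (Set.finite_Icc _ _).biUnion fun j _ => Set.Finite.image _ ?_
    refine (Set.finite_Iic ⌊c j⌋₊).subset fun k hk => ?_
    exact Nat.le_floor hk
  refine Set.Finite.of_finite_image (h.subset ?_) Subtype.val_injective.injOn
  rintro _ ⟨i, hi, rfl⟩
  simp only [Set.mem_iUnion]
  exact ⟨i.1.1, ⟨neg_one_le_idx i, hi⟩, i.1.2, i.2.2.2, rfl⟩

/-! ### The action of the extended Cartan subalgebra -/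

/-- The action of the extended algebra on `𝔤(A)`. -/
def extAct : GExt →ₗ[ℂ] Module.End ℂ GA where
  toFun h := LieAlgebra.ad ℂ GA h.left + (h.right : LieDerivation ℂ GA GA).toLinearMap
  map_add' h h' := by
    refine LinearMap.ext fun x => ?_
    simp only [LieAlgebra.SemiDirectSum.add_eq_mk, LinearMap.add_apply, LieAlgebra.ad_apply, add_lie]
    change _ + _ + ((h.right : LieDerivation ℂ GA GA) x + (h'.right : LieDerivation ℂ GA GA) x) = _
    change _ = _ + (h.right : LieDerivation ℂ GA GA) x + (_ + (h'.right : LieDerivation ℂ GA GA) x)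
    abel
  map_smul' t h := by
    refine LinearMap.ext fun x => ?_
    simp only [LieAlgebra.SemiDirectSum.smul_eq_mk, LinearMap.add_apply, LieAlgebra.ad_apply,
      smul_lie, RingHom.id_apply, LinearMap.smul_apply, smul_add]
    rfl

theorem extAct_apply (h : GExt) (x : GA) :
    extAct h x = ⁅h.left, x⁆ + (h.right : LieDerivation ℂ GA GA) x := rfl

theorem lie_incl (h : GExt) (x : GA) : ⁅h, incl x⁆ = incl (extAct h x) := by
  rw [extAct_apply]
  simp

theorem incl_injective : Function.Injective incl :=
  LieAlgebra.SemiDirectSum.inl_injective _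

theorem mem_rootSpaceGA {α : Wt} {x : GA} :
    x ∈ rootSpaceGA α ↔ ∀ h : cartanExt, extAct h x = α h • x := by
  refine forall_congr' fun h => ?_
  rw [lie_incl, ← map_smul]
  exact incl_injective.eq_iff

theorem extAct_lie (h : GExt) (x y : GA) :
    extAct h ⁅x, y⁆ = ⁅extAct h x, y⁆ + ⁅x, extAct h y⁆ := by
  apply incl_injective
  rw [← lie_incl, LieHom.map_lie, leibniz_lie, lie_incl h x, lie_incl h y, map_add,
    LieHom.map_lie, LieHom.map_lie]

theorem lie_mem_rootSpaceGA {α β : Wt} {x y : GA} (hx : x ∈ rootSpaceGA α)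
    (hy : y ∈ rootSpaceGA β) : ⁅x, y⁆ ∈ rootSpaceGA (α + β) := by
  rw [mem_rootSpaceGA] at *
  intro h
  rw [extAct_lie, hx, hy, smul_lie, lie_smul, ← add_smul, LinearMap.add_apply]

theorem lie_gaH_gaH (i i' : Idx) : ⁅gaH i, gaH i'⁆ = 0 := by
  have h := toGA_relator (Relator.hh i i')
  rwa [LieHom.map_lie] at h

theorem lie_gaH_gaE (i i' : Idx) : ⁅gaH i, gaE i'⁆ = (cartan i i' : ℂ) • gaE i' := by
  have h := toGA_relator (Relator.he i i')
  rwa [map_sub, LieHom.map_lie, map_smul, sub_eq_zero] at h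

theorem lie_gaH_gaF (i i' : Idx) : ⁅gaH i, gaF i'⁆ = -(cartan i i' : ℂ) • gaF i' := by
  have h := toGA_relator (Relator.hf i i')
  rwa [map_add, LieHom.map_lie, map_smul, add_eq_zero_iff_eq_neg, ← neg_smul] at h

theorem gaH_mem_cartanA (i : Idx) : gaH i ∈ cartanA := Submodule.subset_span ⟨i, rfl⟩

theorem lie_gaE_gaF_mem (i i' : Idx) : ⁅gaE i, gaF i'⁆ ∈ cartanA := by
  by_cases hi : i = i'
  · subst hi
    have h := toGA_relator (Relator.ef i)
    rw [map_sub, LieHom.map_lie, sub_eq_zero] at h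
    exact h ▸ gaH_mem_cartanA i
  · have h := toGA_relator (Relator.ef_ne i i' hi)
    rw [LieHom.map_lie] at h
    exact h ▸ cartanA.zero_mem

/-- The linear operators that act diagonally on the generators, with opposite eigenvalues on `e_i`
and `f_i`, and with eigenvalue `0` on `h_i`. -/
def diagOp : Submodule ℂ (Module.End ℂ GA) where
  carrier := {φ | ∀ i, φ (gaH i) = 0 ∧ ∃ t : ℂ, φ (gaE i) = t • gaE i ∧ φ (gaF i) = -t • gaF i}
  zero_mem' i := ⟨rfl, 0, by simp, by simp⟩
  add_mem' {φ ψ} hφ hψ i := by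
    obtain ⟨h, t, he, hf⟩ := hφ i
    obtain ⟨h', t', he', hf'⟩ := hψ i
    refine ⟨by simp [h, h'], t + t', ?_, ?_⟩
    · rw [LinearMap.add_apply, he, he', add_smul]
    · rw [LinearMap.add_apply, hf, hf', ← add_smul, neg_add]
  smul_mem' s φ hφ i := by
    obtain ⟨h, t, he, hf⟩ := hφ i
    refine ⟨by simp [h], s * t, ?_, ?_⟩
    · rw [LinearMap.smul_apply, he, smul_smul]
    · rw [LinearMap.smul_apply, hf, smul_smul, mul_neg]

theorem degDer_mem_diagOp (w : Idx → ℂ) : (degDer w).toLinearMap ∈ diagOp := fun i =>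
  ⟨degDer_H w i, w i, degDer_E w i, (degDer_F w i).trans (neg_smul _ _).symm⟩

/-- Operators that are diagonal on the generators commute there, so the commutators admitted by a
Lie span act on the generators with eigenvalue 0. -/
theorem d0_mem_diagOp {D : LieDerivation ℂ GA GA} (hD : D ∈ d0) : D.toLinearMap ∈ diagOp := by
  induction hD using LieSubalgebra.lieSpan_induction with
  | mem D h =>
    obtain ⟨i, -, -, rfl⟩ := h
    exact degDer_mem_diagOp _
  | zero => exact diagOp.zero_mem
  | add D D' _ _ h h' => exact diagOp.add_mem h h'
  | smul t D _ h => exact diagOp.smul_mem t h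
  | lie D D' _ _ h h' =>
    intro i
    obtain ⟨h, t, he, hf⟩ := h i
    obtain ⟨h', t', he', hf'⟩ := h' i
    have key : ∀ x : GA, ⁅D, D'⁆.toLinearMap x =
      D.toLinearMap (D'.toLinearMap x) - D'.toLinearMap (D.toLinearMap x) := fun x => by
        exact LieDerivation.commutator_apply (D1 := D) (D2 := D') x
    refine ⟨by rw [key, h, h', map_zero, map_zero, sub_zero], 0, ?_, ?_⟩
    · rw [key, he, he', map_smul, map_smul, he, he', smul_comm, sub_self, zero_smul]
    · rw [key, hf, hf', map_smul, map_smul, hf, hf', smul_comm, sub_self, neg_zero, zero_smul]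

theorem extAct_mem_diagOp (h : cartanExt) : extAct h ∈ diagOp := by
  have hle : cartanExt ≤ diagOp.comap extAct := by
    refine sup_le ?_ ?_
    · rw [Submodule.map_le_iff_le_comap, cartanA, Submodule.span_le]
      rintro _ ⟨i, rfl⟩
      intro i'
      have e : ∀ x, extAct (incl (gaH i)) x = ⁅gaH i, x⁆ := fun x => by
        rw [extAct_apply]
        exact add_zero _
      refine ⟨?_, cartan i i', ?_, ?_⟩
      · exact (e _).trans (lie_gaH_gaH i i')
      · exact (e _).trans (lie_gaH_gaE i i')
      · exact (e _).trans (lie_gaH_gaF i i')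
    · rintro _ ⟨D, -, rfl⟩
      have e : extAct (LieAlgebra.SemiDirectSum.inr d0.incl D) =
          (D : LieDerivation ℂ GA GA).toLinearMap := by
        refine LinearMap.ext fun x => ?_
        change ⁅(0 : GA), x⁆ + (D : LieDerivation ℂ GA GA) x = (D : LieDerivation ℂ GA GA) x
        rw [zero_lie, zero_add]
      exact (congrArg (· ∈ diagOp) e).mpr (d0_mem_diagOp D.2)
  exact hle h.2

theorem exists_coordE (i : Idx) : ∃ f : Module.Dual ℂ GA, f (gaE i) = 1 :=
  Module.Projective.exists_dual_eq_one ℂ (gaE_ne_zero i)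

/-- The simple root `α_i`. -/
def simpleRoot (i : Idx) : Wt :=
  (exists_coordE i).choose ∘ₗ LinearMap.applyₗ (gaE i) ∘ₗ extAct ∘ₗ cartanExt.subtype

theorem extAct_gen (h : cartanExt) (i : Idx) : extAct h (gaH i) = 0 ∧
    extAct h (gaE i) = simpleRoot i h • gaE i ∧ extAct h (gaF i) = -simpleRoot i h • gaF i := by
  obtain ⟨hh, t, he, hf⟩ := extAct_mem_diagOp h i
  have : simpleRoot i h = t := by
    change (exists_coordE i).choose (extAct h (gaE i)) = t
    rw [he, map_smul, (exists_coordE i).choose_spec, smul_eq_mul, mul_one]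
  exact ⟨hh, this ▸ he, this ▸ hf⟩

theorem gaE_mem (i : Idx) : gaE i ∈ rootSpaceGA (simpleRoot i) :=
  mem_rootSpaceGA.2 fun h => (extAct_gen h i).2.1

theorem gaF_mem (i : Idx) : gaF i ∈ rootSpaceGA (-simpleRoot i) :=
  mem_rootSpaceGA.2 fun h => (extAct_gen h i).2.2

theorem cartanA_le : cartanA ≤ rootSpaceGA 0 := by
  rw [cartanA, Submodule.span_le]
  rintro _ ⟨i, rfl⟩
  refine mem_rootSpaceGA.2 fun h => ?_
  rw [(extAct_gen h i).1]
  exact (zero_smul ℂ _).symm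

/-- Uniqueness of the weight rests on e_i ≠ 0; if e_i were zero, every functional would count as a
simple root. -/
theorem isSimpleRoot_iff {i : Idx} {σ : Wt} : IsSimpleRoot i σ ↔ σ = simpleRoot i := by
  have key : IsSimpleRoot i σ ↔ gaE i ∈ rootSpaceGA σ := Iff.rfl
  rw [key, mem_rootSpaceGA]
  constructor
  · intro h
    refine LinearMap.ext fun t => smul_left_injective ℂ (gaE_ne_zero i) ?_
    exact (h t).symm.trans (extAct_gen t i).2.1
  · rintro rfl h
    exact (extAct_gen h i).2.1

theorem setOf_isSimpleRoot : {σ : Wt | ∃ i : Idx, IsSimpleRoot i σ} = Set.range simpleRoot := by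
  ext σ
  simp only [isSimpleRoot_iff, Set.mem_ofPred_eq, Set.mem_range, eq_comm]

/-! ### The height -/

/-- An element of `𝔥_A` on which the simple root `α_{jk}` has the value `j + 2`. -/
def heightGA : GA := (1 / 2 : ℂ) • gaH idxNegOne - (3 / 2 : ℂ) • gaH idxOne

theorem heightGA_mem : heightGA ∈ cartanA :=
  cartanA.sub_mem (cartanA.smul_mem _ (gaH_mem_cartanA _)) (cartanA.smul_mem _ (gaH_mem_cartanA _))

/-- The element `heightGA`, in the extended Cartan subalgebra. -/
def heightElt : cartanExt :=
  ⟨incl heightGA, Submodule.mem_sup_left (Submodule.mem_map_of_mem heightGA_mem)⟩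

/-- The height of a weight, normalized so that the simple root `α_{jk}` has height `j + 2`. -/
def height : Wt →ₗ[ℂ] ℂ := LinearMap.applyₗ heightElt

theorem extAct_heightElt (x : GA) : extAct heightElt x = ⁅heightGA, x⁆ := by
  rw [extAct_apply]
  exact add_zero _

theorem lie_heightGA {γ : Wt} {x : GA} (hx : x ∈ rootSpaceGA γ) :
    ⁅heightGA, x⁆ = height γ • x := by
  rw [← extAct_heightElt]
  exact mem_rootSpaceGA.1 hx heightElt

/-- On α_jk the elements h_{−1,1} and h_{1,1} take the values 1 − j and −1 − j, and (1 − j)/2 + 3(1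
+ j)/2 = j + 2. Since j ≥ −1, this is a positive integer. -/
theorem height_simpleRoot (i : Idx) : height (simpleRoot i) = (i.1.1 : ℂ) + 2 := by
  refine smul_left_injective ℂ (gaE_ne_zero i) ?_
  change height (simpleRoot i) • gaE i = ((i.1.1 : ℂ) + 2) • gaE i
  rw [← lie_heightGA (gaE_mem i), heightGA, sub_lie, smul_lie, smul_lie, lie_gaH_gaE, lie_gaH_gaE,
    smul_smul, smul_smul, ← sub_smul]
  congr 1
  simp only [cartan, idxNegOne, idxOne]
  push_cast
  ring

/-- The cone of sums of simple roots. -/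
abbrev posCone : AddSubmonoid Wt := AddSubmonoid.closure (Set.range simpleRoot)

theorem simpleRoot_mem_posCone (i : Idx) : simpleRoot i ∈ posCone :=
  AddSubmonoid.subset_closure ⟨i, rfl⟩

theorem mem_posRoots {α : Wt} : α ∈ posRoots ↔ α ∈ roots ∧ α ∈ posCone := by
  rw [posRoots, setOf_isSimpleRoot]
  rfl

theorem posCone_cases {κ : Wt} (h : κ ∈ posCone) :
    κ = 0 ∨ ∃ i, ∃ κ' ∈ posCone, κ = simpleRoot i + κ' := by
  induction h using AddSubmonoid.closure_induction_left with
  | zero => exact Or.inl rfl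
  | add_left x hx y hy _ =>
    obtain ⟨i, rfl⟩ := hx
    exact Or.inr ⟨i, y, hy, rfl⟩

theorem height_posCone {κ : Wt} (h : κ ∈ posCone) : ∃ n : ℕ, height κ = n ∧ (n = 0 → κ = 0) := by
  induction h using AddSubmonoid.closure_induction_left with
  | zero => exact ⟨0, by simp, fun _ => rfl⟩
  | add_left x hx y hy ih =>
    obtain ⟨i, rfl⟩ := hx
    obtain ⟨n, hn, -⟩ := ih
    have hi := neg_one_le_idx i
    refine ⟨(i.1.1 + 2).toNat + n, ?_, by omega⟩
    rw [map_add, hn, height_simpleRoot, Nat.cast_add]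
    congr 1
    have : (((i.1.1 + 2).toNat : ℤ) : ℂ) = ((i.1.1 + 2 : ℤ) : ℂ) := by
      rw [Int.toNat_of_nonneg (by omega)]
    push_cast at this
    exact this.symm

theorem height_posRoots {κ : Wt} (h : κ ∈ posRoots) : ∃ n : ℕ, height κ = n ∧ 1 ≤ n := by
  obtain ⟨h1, h2⟩ := mem_posRoots.1 h
  obtain ⟨n, hn, h0⟩ := height_posCone h2
  exact ⟨n, hn, Nat.one_le_iff_ne_zero.2 fun h => h1.1 (h0 h)⟩

/-- Split off a simple root. It uses up height at least 1, and there are only finitely many simple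
roots of bounded height because k ≤ c(j). -/
theorem finite_posCone_height_le (N : ℕ) :
    {κ : Wt | κ ∈ posCone ∧ ∃ n : ℕ, height κ = n ∧ n ≤ N}.Finite := by
  induction N with
  | zero =>
    refine (Set.finite_singleton (0 : Wt)).subset ?_
    rintro κ ⟨hκ, n, hn, hle⟩
    obtain ⟨m, hm, h0⟩ := height_posCone hκ
    have : (n : ℂ) = m := hn.symm.trans hm
    exact h0 (by have : n = m := by exact_mod_cast this
                 omega)
  | succ N ih =>
    have hfin := (ih.biUnion fun κ _ =>
      ((finite_idx_le N).image fun i => simpleRoot i + κ)).insert 0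
    refine hfin.subset ?_
    rintro κ ⟨hκ, n, hn, hle⟩
    rcases posCone_cases hκ with rfl | ⟨i, κ', hκ', rfl⟩
    · exact Set.mem_insert _ _
    · refine Set.mem_insert_of_mem _ ?_
      obtain ⟨m, hm, -⟩ := height_posCone hκ'
      have hi := neg_one_le_idx i
      rw [map_add, hm, height_simpleRoot] at hn
      have h1 : i.1.1 + 2 + m = n := by exact_mod_cast hn
      simp only [Set.mem_iUnion]
      exact ⟨κ', ⟨hκ', m, hm, by omega⟩, i, by simp only [Set.mem_ofPred_eq]; omega, rfl⟩

/-! ### The triangular decomposition -/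

theorem mem_of_generators_mem (K : LieSubalgebra ℂ GA) (hH : ∀ i, gaH i ∈ K)
    (hE : ∀ i, gaE i ∈ K) (hF : ∀ i, gaF i ∈ K) (x : GA) : x ∈ K := by
  obtain ⟨x, rfl⟩ := toGA_surjective x
  let v : Gen → K := fun g => match g with
    | Gen.H i => ⟨gaH i, hH i⟩
    | Gen.E i => ⟨gaE i, hE i⟩
    | Gen.F i => ⟨gaF i, hF i⟩
  have hv : K.incl.comp (FreeLieAlgebra.lift ℂ v) = toGA := by
    apply FreeLieAlgebra.hom_ext
    rintro (i | i | i) <;> rw [LieHom.comp_apply, FreeLieAlgebra.lift_of_apply] <;> rfl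
  rw [← hv]
  exact (FreeLieAlgebra.lift ℂ v x).2

section Triangular

variable {x y : Idx → GA}

theorem lie_cartanA_mem_lieSpan (h1 : ∀ i j, ∃ t : ℂ, ⁅gaH i, x j⁆ = t • x j)
    {h n : GA} (hh : h ∈ cartanA) (hn : n ∈ LieSubalgebra.lieSpan ℂ GA (Set.range x)) :
    ⁅h, n⁆ ∈ LieSubalgebra.lieSpan ℂ GA (Set.range x) := by
  induction hh using Submodule.span_induction with
  | zero => rw [zero_lie]; exact zero_mem _
  | add a b _ _ ha hb => rw [add_lie]; exact add_mem ha hb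
  | smul t a _ ha => rw [smul_lie]; exact LieSubalgebra.smul_mem _ t ha
  | mem a ha =>
    obtain ⟨i, rfl⟩ := ha
    induction hn using LieSubalgebra.lieSpan_induction with
    | mem n hn =>
      obtain ⟨j, rfl⟩ := hn
      obtain ⟨t, ht⟩ := h1 i j
      rw [ht]
      exact LieSubalgebra.smul_mem _ t (LieSubalgebra.subset_lieSpan ⟨j, rfl⟩)
    | zero => rw [lie_zero]; exact zero_mem _
    | add a b _ _ ha hb => rw [lie_add]; exact add_mem ha hb
    | smul t a _ ha => rw [lie_smul]; exact LieSubalgebra.smul_mem _ t ha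
    | lie a b ha' hb' ha hb =>
      rw [leibniz_lie]
      exact add_mem (LieSubalgebra.lie_mem _ ha hb') (LieSubalgebra.lie_mem _ ha' hb)

/-- `ad y_i` is a derivation that sends the generators x_j into the Cartan subalgebra, and the
Cartan subalgebra normalizes the span of the x's. Keeping x and y abstract lets this serve for (e,
f) and for (f, e). -/
theorem lie_mem_lieSpan_sup (h1 : ∀ i j, ∃ t : ℂ, ⁅gaH i, x j⁆ = t • x j)
    (h2 : ∀ i j, ⁅y i, x j⁆ ∈ cartanA) (i : Idx) {n : GA}
    (hn : n ∈ LieSubalgebra.lieSpan ℂ GA (Set.range x)) :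
    ⁅y i, n⁆ ∈ (LieSubalgebra.lieSpan ℂ GA (Set.range x)).toSubmodule ⊔ cartanA := by
  have key : ∀ a ∈ (LieSubalgebra.lieSpan ℂ GA (Set.range x)).toSubmodule ⊔ cartanA,
      ∀ b ∈ LieSubalgebra.lieSpan ℂ GA (Set.range x),
        ⁅a, b⁆ ∈ LieSubalgebra.lieSpan ℂ GA (Set.range x) := by
    intro a ha b hb
    obtain ⟨p, hp, q, hq, rfl⟩ := Submodule.mem_sup.1 ha
    rw [add_lie]
    exact add_mem (LieSubalgebra.lie_mem _ hp hb) (lie_cartanA_mem_lieSpan h1 hq hb)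
  induction hn using LieSubalgebra.lieSpan_induction with
  | mem n hn =>
    obtain ⟨j, rfl⟩ := hn
    exact Submodule.mem_sup_right (h2 i j)
  | zero => rw [lie_zero]; exact zero_mem _
  | add a b _ _ ha hb => rw [lie_add]; exact add_mem ha hb
  | smul t a _ ha => rw [lie_smul]; exact Submodule.smul_mem _ t ha
  | lie a b ha' hb' ha hb =>
    rw [leibniz_lie, ← lie_skew a]
    refine Submodule.mem_sup_left (add_mem (key _ ha _ hb') (neg_mem (key _ hb _ ha')))

theorem lieSpan_le_iSup_rootSpaceGA {w : Idx → Wt} (hx : ∀ i, x i ∈ rootSpaceGA (w i)) {n : GA}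
    (hn : n ∈ LieSubalgebra.lieSpan ℂ GA (Set.range x)) :
    n ∈ ⨆ κ ∈ AddSubmonoid.closure (Set.range w), rootSpaceGA κ := by
  induction hn using LieSubalgebra.lieSpan_induction with
  | mem n hn =>
    obtain ⟨j, rfl⟩ := hn
    exact Submodule.mem_iSup_of_mem _ (Submodule.mem_iSup_of_mem
      (AddSubmonoid.subset_closure ⟨j, rfl⟩) (hx j))
  | zero => exact zero_mem _
  | add a b _ _ ha hb => exact add_mem ha hb
  | smul t a _ ha => exact Submodule.smul_mem _ t ha
  | lie a b hna hnb ha hb =>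
    clear hna hnb
    rw [iSup_subtype'] at ha hb ⊢
    induction ha using Submodule.iSup_induction' with
    | zero => rw [zero_lie]; exact zero_mem _
    | add a a' _ _ h h' => rw [add_lie]; exact add_mem h h'
    | mem κ a ha =>
      induction hb using Submodule.iSup_induction' with
      | zero => rw [lie_zero]; exact zero_mem _
      | add b b' _ _ h h' => rw [lie_add]; exact add_mem h h'
      | mem κ' b hb =>
        exact Submodule.mem_iSup_of_mem (κ + κ') (lie_mem_rootSpaceGA ha hb)

end Triangular

/-- The span of the positive root vectors, the Cartan subalgebra and the negative root vectors. -/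
def triSum : Submodule ℂ GA :=
  ((LieSubalgebra.lieSpan ℂ GA (Set.range gaE)).toSubmodule ⊔ cartanA) ⊔
    ((LieSubalgebra.lieSpan ℂ GA (Set.range gaF)).toSubmodule ⊔ cartanA)

/-- The elements g with [g, `triSum`] ⊆ `triSum` form a subalgebra containing all generators, hence
everything. So `triSum` is itself a subalgebra, and it contains the generators. -/
theorem mem_triSum (x : GA) : x ∈ triSum := by
  have hHE : ∀ i j, ∃ t : ℂ, ⁅gaH i, gaE j⁆ = t • gaE j := fun i j => ⟨_, lie_gaH_gaE i j⟩
  have hHF : ∀ i j, ∃ t : ℂ, ⁅gaH i, gaF j⁆ = t • gaF j := fun i j => ⟨_, lie_gaH_gaF i j⟩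
  have hE : ∀ i, gaE i ∈ LieSubalgebra.lieSpan ℂ GA (Set.range gaE) := fun i =>
    LieSubalgebra.subset_lieSpan ⟨i, rfl⟩
  have hF : ∀ i, gaF i ∈ LieSubalgebra.lieSpan ℂ GA (Set.range gaF) := fun i =>
    LieSubalgebra.subset_lieSpan ⟨i, rfl⟩
  have hFE : ∀ i j, ⁅gaF i, gaE j⁆ ∈ cartanA := fun i j => by
    rw [← lie_skew]; exact neg_mem (lie_gaE_gaF_mem j i)
  have hHH : ∀ i, ∀ h ∈ cartanA, ⁅gaH i, h⁆ = 0 := by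
    intro i h hh
    induction hh using Submodule.span_induction with
    | zero => exact lie_zero _
    | add a b _ _ ha hb => rw [lie_add, ha, hb, add_zero]
    | smul t a _ ha => rw [lie_smul, ha, smul_zero]
    | mem a ha => obtain ⟨j, rfl⟩ := ha; exact lie_gaH_gaH i j
  have hxH : ∀ (g : Idx → GA), (∀ i j, ∃ t : ℂ, ⁅gaH i, g j⁆ = t • g j) → ∀ i, ∀ h ∈ cartanA,
      ⁅g i, h⁆ ∈ LieSubalgebra.lieSpan ℂ GA (Set.range g) := by
    intro g hg i h hh
    rw [← lie_skew]
    exact neg_mem (lie_cartanA_mem_lieSpan hg hh (LieSubalgebra.subset_lieSpan ⟨i, rfl⟩))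
  let K : LieSubalgebra ℂ GA :=
    { carrier := {g | ∀ s ∈ triSum, ⁅g, s⁆ ∈ triSum}
      zero_mem' := fun s _ => by rw [zero_lie]; exact zero_mem _
      add_mem' := fun ha hb s hs => by rw [add_lie]; exact add_mem (ha s hs) (hb s hs)
      smul_mem' := fun t a ha s hs => by rw [smul_lie]; exact Submodule.smul_mem _ t (ha s hs)
      lie_mem' := fun ha hb s hs => by
        rw [lie_lie]; exact sub_mem (ha _ (hb s hs)) (hb _ (ha s hs)) }
  have hK : ∀ g, g ∈ K := by
    have split : ∀ g : GA,
        (∀ n ∈ LieSubalgebra.lieSpan ℂ GA (Set.range gaE), ⁅g, n⁆ ∈ triSum) →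
        (∀ n ∈ LieSubalgebra.lieSpan ℂ GA (Set.range gaF), ⁅g, n⁆ ∈ triSum) →
        (∀ n ∈ cartanA, ⁅g, n⁆ ∈ triSum) → g ∈ K := by
      intro g h1 h2 h3 s hs
      obtain ⟨a, ha, b, hb, rfl⟩ := Submodule.mem_sup.1 hs
      obtain ⟨p, hp, q, hq, rfl⟩ := Submodule.mem_sup.1 ha
      obtain ⟨p', hp', q', hq', rfl⟩ := Submodule.mem_sup.1 hb
      rw [lie_add, lie_add, lie_add]
      exact add_mem (add_mem (h1 p hp) (h3 q hq)) (add_mem (h2 p' hp') (h3 q' hq'))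
    have inE : ∀ {n}, n ∈ LieSubalgebra.lieSpan ℂ GA (Set.range gaE) → n ∈ triSum := fun h =>
      Submodule.mem_sup_left (Submodule.mem_sup_left h)
    have inF : ∀ {n}, n ∈ LieSubalgebra.lieSpan ℂ GA (Set.range gaF) → n ∈ triSum := fun h =>
      Submodule.mem_sup_right (Submodule.mem_sup_left h)
    refine mem_of_generators_mem K (fun i => split _ ?_ ?_ ?_) (fun i => split _ ?_ ?_ ?_)
      (fun i => split _ ?_ ?_ ?_)
    · exact fun n hn => inE (lie_cartanA_mem_lieSpan hHE (gaH_mem_cartanA i) hn)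
    · exact fun n hn => inF (lie_cartanA_mem_lieSpan hHF (gaH_mem_cartanA i) hn)
    · exact fun n hn => by rw [hHH i n hn]; exact zero_mem _
    · exact fun n hn => inE (LieSubalgebra.lie_mem _ (hE i) hn)
    · exact fun n hn => Submodule.mem_sup_right (lie_mem_lieSpan_sup hHF lie_gaE_gaF_mem i hn)
    · exact fun n hn => inE (hxH gaE hHE i n hn)
    · exact fun n hn => Submodule.mem_sup_left (lie_mem_lieSpan_sup hHE hFE i hn)
    · exact fun n hn => inF (LieSubalgebra.lie_mem _ (hF i) hn)
    · exact fun n hn => inF (hxH gaF hHF i n hn)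
  let S : LieSubalgebra ℂ GA := { triSum with lie_mem' := fun {a b} _ hb => hK a b hb }
  exact mem_of_generators_mem S
    (fun i => Submodule.mem_sup_left (Submodule.mem_sup_right (gaH_mem_cartanA i)))
    (fun i => Submodule.mem_sup_left (Submodule.mem_sup_left (hE i)))
    (fun i => Submodule.mem_sup_right (Submodule.mem_sup_left (hF i))) x

theorem neg_mem_posCone {κ : Wt}
    (h : κ ∈ AddSubmonoid.closure (Set.range fun i => -simpleRoot i)) : -κ ∈ posCone := by
  induction h using AddSubmonoid.closure_induction with
  | mem x hx =>
    obtain ⟨i, rfl⟩ := hx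
    rw [neg_neg]
    exact simpleRoot_mem_posCone i
  | zero => rw [neg_zero]; exact zero_mem _
  | add a b _ _ ha hb => rw [neg_add]; exact add_mem ha hb

/-! ### Weight decomposition and the location of the roots. -/

theorem mem_iSup_rootSpaceGA (x : GA) :
    x ∈ ⨆ κ ∈ {κ : Wt | κ ∈ posCone ∨ -κ ∈ posCone}, rootSpaceGA κ := by
  have hsub : ∀ {A : Set Wt}, A ⊆ {κ : Wt | κ ∈ posCone ∨ -κ ∈ posCone} →
      ⨆ κ ∈ A, rootSpaceGA κ ≤ ⨆ κ ∈ {κ : Wt | κ ∈ posCone ∨ -κ ∈ posCone}, rootSpaceGA κ :=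
    fun h => biSup_mono h
  have h0 : cartanA ≤ ⨆ κ ∈ {κ : Wt | κ ∈ posCone ∨ -κ ∈ posCone}, rootSpaceGA κ :=
    cartanA_le.trans (le_biSup rootSpaceGA (i := (0 : Wt)) (Or.inl (zero_mem _)))
  refine (sup_le (sup_le ?_ h0) (sup_le ?_ h0) : triSum ≤ _) (mem_triSum x)
  · exact fun n hn => hsub (fun _ => Or.inl) (lieSpan_le_iSup_rootSpaceGA gaE_mem hn)
  · exact fun n hn => hsub (fun κ h => Or.inr (neg_mem_posCone h))
      (lieSpan_le_iSup_rootSpaceGA gaF_mem hn)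

/-- Independence of weight spaces: choose h with γ(h) ≠ κ(h). The operator h − κ(h) removes the
summand at κ and multiplies the total, which has weight γ, by a nonzero scalar; then induct. -/
theorem eq_zero_of_sum_mem {γ : Wt} (s : Finset Wt) (hγ : γ ∉ s) (f : Wt → GA)
    (hf : ∀ κ ∈ s, f κ ∈ rootSpaceGA κ) (hs : ∑ κ ∈ s, f κ ∈ rootSpaceGA γ) :
    ∑ κ ∈ s, f κ = 0 := by
  classical
  induction s using Finset.induction_on generalizing f with
  | empty => exact Finset.sum_empty
  | insert κ s hκ ih =>
    have hne : γ ≠ κ := fun h => hγ (h ▸ Finset.mem_insert_self _ _)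
    obtain ⟨h, hh⟩ : ∃ h, γ h ≠ κ h := by
      by_contra! hcon
      exact hne (LinearMap.ext hcon)
    have h1 : ∑ κ' ∈ s, (κ' h - κ h) • f κ' = (γ h - κ h) • ∑ κ' ∈ insert κ s, f κ' := by
      rw [sub_smul, ← mem_rootSpaceGA.1 hs h, map_sum, Finset.smul_sum,
        Finset.sum_insert hκ, Finset.sum_insert hκ,
        mem_rootSpaceGA.1 (hf κ (Finset.mem_insert_self _ _)) h, add_sub_add_left_eq_sub,
        ← Finset.sum_sub_distrib]
      refine Finset.sum_congr rfl fun κ' hκ' => ?_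
      rw [mem_rootSpaceGA.1 (hf κ' (Finset.mem_insert_of_mem hκ')) h, sub_smul]
    have h2 := ih (fun h => hγ (Finset.mem_insert_of_mem h)) (fun κ' => (κ' h - κ h) • f κ')
      (fun κ' hκ' => Submodule.smul_mem _ _ (hf κ' (Finset.mem_insert_of_mem hκ')))
      (by rw [h1]; exact Submodule.smul_mem _ _ hs)
    rw [h1] at h2
    exact (smul_eq_zero.1 h2).resolve_left (sub_ne_zero.2 hh)

theorem eq_zero_of_mem_iSup {A : Set Wt} {γ : Wt} (hγ : γ ∉ A) {x : GA}
    (hx : x ∈ ⨆ κ ∈ A, rootSpaceGA κ) (hxγ : x ∈ rootSpaceGA γ) : x = 0 := by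
  have key : ∃ s : Finset Wt, ∃ f : Wt → GA, (↑s ⊆ A) ∧ (∀ κ, f κ ∈ rootSpaceGA κ) ∧
      x = ∑ κ ∈ s, f κ := by
    classical
    rw [Submodule.mem_iSup_iff_exists_finsupp] at hx
    obtain ⟨f, hf, rfl⟩ := hx
    refine ⟨f.support.filter (· ∈ A), f, by intro κ; simp, fun κ => ?_, ?_⟩
    · have h := hf κ
      by_cases hκ : κ ∈ A
      · simpa [hκ] using h
      · have : f κ = 0 := by simpa [hκ] using h
        rw [this]; exact zero_mem _
    · rw [Finsupp.sum, Finset.sum_filter_of_ne]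
      intro κ _ h0
      by_contra hκ
      have h := hf κ
      exact h0 (by simpa [hκ] using h)
  obtain ⟨s, f, hs, hf, rfl⟩ := key
  exact eq_zero_of_sum_mem s (fun h => hγ (hs h)) f (fun κ _ => hf κ) hxγ

/-- A nonzero vector of weight γ lies in the sum of the weight spaces over the two cones, so by
independence γ is one of those weights. The symmetry of Δ under negation is not involved. -/
theorem roots_subset {γ : Wt} (h : γ ∈ roots) : γ ∈ posCone ∨ -γ ∈ posCone := by
  obtain ⟨x, hx, hx0⟩ := (Submodule.ne_bot_iff _).1 h.2
  by_contra hcon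
  exact hx0 (eq_zero_of_mem_iSup hcon (mem_iSup_rootSpaceGA x) hx)

theorem height_ne_zero {γ : Wt} (h : γ ∈ roots) : height γ ≠ 0 := by
  intro h0
  rcases roots_subset h with h1 | h1
  · obtain ⟨n, hn, hz⟩ := height_posCone h1
    rw [h0] at hn
    exact h.1 (hz (by exact_mod_cast hn.symm))
  · obtain ⟨n, hn, hz⟩ := height_posCone h1
    rw [map_neg, h0, neg_zero] at hn
    exact h.1 (neg_eq_zero.1 (hz (by exact_mod_cast hn.symm)))

/-! ### Root spaces of the Monster Lie algebra -/

/-- The quotient map from `𝔤(A)` to `𝔪`. -/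
def toMLie : GA →ₗ[ℂ] MLie :=
  (LieSubmodule.Quotient.mk' (LieAlgebra.center ℂ GA) : GA →ₗ[ℂ] MLie)

theorem toMLie_lie (x y : GA) : toMLie ⁅x, y⁆ = ⁅toMLie x, toMLie y⁆ :=
  LieSubmodule.Quotient.mk_bracket (LieAlgebra.center ℂ GA) x y

theorem mem_rootSpace {α : Wt} {x : MLie} :
    x ∈ rootSpace α ↔ ∃ w ∈ rootSpaceGA α, toMLie w = x := Iff.rfl

theorem lie_mem_rootSpace {α β : Wt} {x y : MLie} (hx : x ∈ rootSpace α) (hy : y ∈ rootSpace β) :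
    ⁅x, y⁆ ∈ rootSpace (α + β) := by
  obtain ⟨v, hv, rfl⟩ := mem_rootSpace.1 hx
  obtain ⟨w, hw, rfl⟩ := mem_rootSpace.1 hy
  exact mem_rootSpace.2 ⟨_, lie_mem_rootSpaceGA hv hw, toMLie_lie v w⟩

theorem mem_roots_of_rootSpace_ne_bot {κ : Wt} (hκ : κ ≠ 0) (h : rootSpace κ ≠ ⊥) : κ ∈ roots := by
  refine ⟨hκ, fun h0 => h ?_⟩
  rw [rootSpace, h0, Submodule.map_bot]

theorem rootSpace_ne_bot {κ : Wt} {x : MLie} (hx : x ∈ rootSpace κ) (h0 : x ≠ 0) :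
    rootSpace κ ≠ ⊥ := fun h => h0 ((Submodule.eq_bot_iff _).1 h x hx)

/-- The element of `𝔥` that measures the height. -/
def heightM : MLie := toMLie heightGA

theorem heightM_mem : heightM ∈ rootSpace 0 :=
  mem_rootSpace.2 ⟨_, cartanA_le heightGA_mem, rfl⟩

theorem lie_heightM {γ : Wt} {x : MLie} (hx : x ∈ rootSpace γ) :
    ⁅x, heightM⁆ = -height γ • x := by
  obtain ⟨w, hw, rfl⟩ := mem_rootSpace.1 hx
  rw [heightM, ← toMLie_lie, ← lie_skew, lie_heightGA hw, map_neg, map_smul, neg_smul]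

/-- The bracket with `heightM` is multiplication by a nonzero scalar on 𝔪_γ. This lets the action of
ad z on a single element recover z. -/
theorem eq_of_lie_heightM_eq {γ : Wt} (hγ : γ ∈ roots) {x y : MLie} (hx : x ∈ rootSpace γ)
    (hy : y ∈ rootSpace γ) (h : ⁅x, heightM⁆ = ⁅y, heightM⁆) : x = y := by
  rw [lie_heightM hx, lie_heightM hy] at h
  exact smul_right_injective _ (neg_ne_zero.2 (height_ne_zero hγ)) h

/-! ### Sets of roots for which the operators are defined -/

/-- The properties of a set `P` of roots and of `α, β ∈ P` under which the products of exponentials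
of elements of `𝔪_α` and `𝔪_β` act on the completion. -/
structure IsAdmissible (P : Set Wt) (α β : Wt) : Prop where
  left_mem : α ∈ P
  right_mem : β ∈ P
  subset : P ⊆ roots
  disjoint : ∀ μ ∈ P, -μ ∉ P
  add_mem : ∀ μ ∈ P, ∀ ν ∈ P, μ + ν ∈ roots → μ + ν ∈ P
  summable : ProSummablePair P α β
  finite_below : ∀ μ : Wt,
    {p : ℕ × ℕ | rootSpace (μ + p.1 • α + p.2 • β) ≠ ⊥ ∧ μ + p.1 • α + p.2 • β ∉ P}.Finite

/-- At δ + α, a pair with iα + jβ = δ leaves exactly α, which is in P. -/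
theorem ProSummablePair.finite_eq {P : Set Wt} {α β : Wt} (h : ProSummablePair P α β) (hα : α ∈ P)
    (δ : Wt) : {p : ℕ × ℕ | p.1 • α + p.2 • β = δ}.Finite := by
  refine (h (δ + α)).subset ?_
  rintro p rfl
  change _ ∈ P
  convert hα using 1
  abel

theorem IsPositiveSystem.isAdmissible {P : Set Wt} {α β : Wt} (hP : IsPositiveSystem P)
    (hα : α ∈ P) (hβ : β ∈ P) (h : ProSummablePair P α β) : IsAdmissible P α β where
  left_mem := hα
  right_mem := hβ
  subset := hP.subset
  disjoint := hP.disjoint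
  add_mem := hP.add_mem
  summable := h
  finite_below μ := by
    -- A degree μ + iα + jβ outside P with nonzero space is either 0 or the negative of an element
    -- of P. Both cases are controlled by pro-summability, applied directly or through `finite_eq`
    -- at −μ.
    refine ((h (-μ)).union (h.finite_eq hα (-μ))).subset ?_
    rintro p ⟨h1, h2⟩
    by_cases h0 : μ + p.1 • α + p.2 • β = 0
    · right
      change _ = _
      rw [eq_neg_iff_add_eq_zero, ← h0]
      abel
    · left
      have h3 := (hP.cover _ (mem_roots_of_rootSpace_ne_bot h0 h1)).resolve_left h2
      change _ ∈ P
      convert h3 using 1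
      abel

theorem posRoots_add_mem : ∀ μ ∈ posRoots, ∀ ν ∈ posRoots, μ + ν ∈ roots → μ + ν ∈ posRoots :=
  fun _ hμ _ hν h => mem_posRoots.2
    ⟨h, add_mem (mem_posRoots.1 hμ).2 (mem_posRoots.1 hν).2⟩

theorem finite_nat_pair_add_le (N : ℕ) : {p : ℕ × ℕ | p.1 + p.2 ≤ N}.Finite := by
  refine ((Set.finite_Iic N).prod (Set.finite_Iic N)).subset ?_
  rintro p hp
  have : p.1 + p.2 ≤ N := hp
  exact ⟨by simp only [Set.mem_Iic]; omega, by simp only [Set.mem_Iic]; omega⟩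

/-- The heights of α and β are positive integers, so a prescribed height bounds i + j; this gives
both finiteness conditions. That a root outside Δ₊ is the negative of a sum of simple roots comes
from `roots_subset`. -/
theorem isAdmissible_posRoots {α β : Wt} (hα : α ∈ posRoots) (hβ : β ∈ posRoots) :
    IsAdmissible posRoots α β := by
  obtain ⟨a, ha, ha1⟩ := height_posRoots hα
  obtain ⟨b, hb, hb1⟩ := height_posRoots hβ
  -- One solution, if there is any, bounds all the others. The sign s = 1 is used for degrees δ − iα
  -- − jβ in Δ₊ and s = −1 for degrees μ + iα + jβ in the negative cone.
  have le_of : ∀ (δ : Wt) (s : ℂ), {p : ℕ × ℕ | ∃ n : ℕ,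
      height δ = s * (n + p.1 * a + p.2 * b)}.Finite ∨ s = 0 := by
    intro δ s
    by_cases hs : s = 0
    · exact Or.inr hs
    left
    by_cases hne : ∃ p : ℕ × ℕ, ∃ n : ℕ, height δ = s * (n + p.1 * a + p.2 * b)
    · obtain ⟨q, m, hq⟩ := hne
      refine (finite_nat_pair_add_le (m + q.1 * a + q.2 * b)).subset ?_
      rintro p ⟨n, hp⟩
      rw [hq] at hp
      have h1 := mul_left_cancel₀ hs hp
      have h2 : m + q.1 * a + q.2 * b = n + p.1 * a + p.2 * b := by exact_mod_cast h1
      change p.1 + p.2 ≤ _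
      rw [h2]
      nlinarith [Nat.zero_le p.1, Nat.zero_le p.2]
    · convert Set.finite_empty
      ext p
      simp only [Set.mem_empty_iff_false, iff_false]
      exact fun h => hne ⟨p, h⟩
  refine ⟨hα, hβ, fun μ hμ => hμ.1, ?_, posRoots_add_mem, ?_, ?_⟩
  · intro μ hμ hμ'
    obtain ⟨n, hn, h1⟩ := height_posRoots hμ
    obtain ⟨m, hm, -⟩ := height_posRoots hμ'
    rw [map_neg, hn] at hm
    have : (n : ℂ) + m = 0 := by rw [← hm]; ring
    have : n + m = 0 := by exact_mod_cast this
    omega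
  · intro δ
    refine ((le_of δ 1).resolve_right one_ne_zero).subset fun p hp => ?_
    obtain ⟨n, hn, -⟩ := height_posRoots hp
    refine ⟨n, ?_⟩
    rw [map_sub, map_sub, map_nsmul, map_nsmul, ha, hb, nsmul_eq_mul, nsmul_eq_mul] at hn
    rw [← hn]
    ring
  · intro μ
    refine ((le_of μ (-1)).resolve_right (by norm_num)).subset fun p hp => ?_
    obtain ⟨h1, h2⟩ := hp
    have h3 : -(μ + p.1 • α + p.2 • β) ∈ posCone := by
      by_cases h0 : μ + p.1 • α + p.2 • β = 0
      · rw [h0, neg_zero]; exact zero_mem _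
      · have hr := mem_roots_of_rootSpace_ne_bot h0 h1
        exact (roots_subset hr).resolve_left fun h => h2 (mem_posRoots.2 ⟨hr, h⟩)
    obtain ⟨n, hn, -⟩ := height_posCone h3
    refine ⟨n, ?_⟩
    rw [map_neg, map_add, map_add, map_nsmul, map_nsmul, ha, hb, nsmul_eq_mul, nsmul_eq_mul] at hn
    rw [← hn]
    ring

theorem IsAdmissible.add_ne_zero {P : Set Wt} {α β μ ν : Wt} (h : IsAdmissible P α β) (hμ : μ ∈ P)
    (hν : ν ∈ P) : μ + ν ≠ 0 := by
  intro h0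
  rw [add_eq_zero_iff_eq_neg] at h0
  exact h.disjoint ν hν (h0 ▸ hμ)

/-! ### Exponentials in rings of formal power series -/

section Formal

open MvPowerSeries

set_option linter.unusedSectionVars false

variable {σ : Type} {A : Type*} [Ring A] [Algebra ℂ A]

/-- The power series `∑ zᵏ Tᵏ / k!`. -/
def expSeries (z : A) : PowerSeries A := PowerSeries.mk fun k => ((k.factorial : ℂ)⁻¹) • z ^ k

theorem expSeries_add {z w : A} (h : Commute z w) :
    expSeries (z + w) = expSeries z * expSeries w := by
  ext n
  rw [PowerSeries.coeff_mul, expSeries, PowerSeries.coeff_mk, h.add_pow', Finset.smul_sum]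
  refine Finset.sum_congr rfl fun p hp => ?_
  rw [Finset.HasAntidiagonal.mem_antidiagonal] at hp
  simp only [expSeries, PowerSeries.coeff_mk]
  rw [smul_mul_smul_comm, ← Nat.cast_smul_eq_nsmul ℂ, smul_smul]
  congr 1
  subst hp
  rw [Nat.cast_add_choose]
  have h1 : ((p.1 + p.2).factorial : ℂ) ≠ 0 := by exact_mod_cast Nat.factorial_ne_zero _
  have h2 : (p.1.factorial : ℂ) ≠ 0 := by exact_mod_cast Nat.factorial_ne_zero _
  have h3 : (p.2.factorial : ℂ) ≠ 0 := by exact_mod_cast Nat.factorial_ne_zero _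
  field_simp

theorem expSeries_zero : expSeries (0 : A) = 1 := by
  ext n
  rcases n with _ | n <;> simp [expSeries, PowerSeries.coeff_one]

theorem expSeries_mul_neg (z : A) : expSeries z * expSeries (-z) = 1 := by
  rw [← expSeries_add ((Commute.refl z).neg_right), add_neg_cancel, expSeries_zero]

/-- The coefficients of `exp(Tz) f exp(-Tz)` are iterated commutators. -/
theorem coeff_expSeries_conj (z f : A) (n : ℕ) :
    PowerSeries.coeff n (expSeries z * PowerSeries.C f * expSeries (-z)) =
      ((n.factorial : ℂ)⁻¹) • ((LieAlgebra.ad ℂ A z) ^ n) f := by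
  -- `ad z` is left minus right multiplication by z. These commute, so exp(T ad z) factors by the
  -- exponential law in `End A`.
  have hc : Commute (LinearMap.mulLeft ℂ z) (-LinearMap.mulRight ℂ z) :=
    (LinearMap.commute_mulLeft_right z z).neg_right
  have had : LieAlgebra.ad ℂ A z = LinearMap.mulLeft ℂ z + -LinearMap.mulRight ℂ z := by
    refine LinearMap.ext fun w => ?_
    simp [Ring.lie_def, sub_eq_add_neg]
  have h := congrArg (fun F : PowerSeries (Module.End ℂ A) => PowerSeries.coeff n F f)
    (expSeries_add hc)
  simp only [← had, expSeries, PowerSeries.coeff_mk, PowerSeries.coeff_mul, LinearMap.smul_apply,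
    LinearMap.sum_apply, Module.End.mul_apply] at h
  rw [h, PowerSeries.coeff_mul]
  refine Finset.sum_congr rfl fun p _ => ?_
  have h1 : ((-LinearMap.mulRight ℂ z) ^ p.2) f = f * (-z) ^ p.2 := by
    induction p.2 with
    | zero => simp
    | succ k ih => simp [pow_succ', ih, pow_succ (-z), mul_assoc]
  rw [PowerSeries.coeff_mul_C, expSeries, expSeries, PowerSeries.coeff_mk, PowerSeries.coeff_mk, h1,
    LinearMap.pow_mulLeft, map_smul, LinearMap.mulLeft_apply, smul_mul_assoc, smul_mul_smul_comm,
    mul_assoc, smul_smul]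

/-- The monomial `k ↦ k • p`, as an additive map. -/
theorem smul_le_smul_iff_of_ne_zero {p : σ →₀ ℕ} (hp : p ≠ 0) (k l : ℕ) :
    k • p ≤ l • p ↔ k ≤ l := by
  obtain ⟨s, hs⟩ := Finsupp.ne_iff.1 hp
  constructor
  · intro h
    have := h s
    simp only [Finsupp.smul_apply, smul_eq_mul] at this
    exact Nat.le_of_mul_le_mul_right this (Nat.pos_of_ne_zero hs)
  · intro h t
    simp only [Finsupp.smul_apply, smul_eq_mul]
    exact Nat.mul_le_mul_right _ h

theorem smul_injective_of_ne_zero {p : σ →₀ ℕ} (hp : p ≠ 0) :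
    Function.Injective fun k : ℕ => k • p := fun k l h =>
  le_antisymm ((smul_le_smul_iff_of_ne_zero hp k l).1 h.le)
    ((smul_le_smul_iff_of_ne_zero hp l k).1 h.ge)

variable [Finite σ]

/-- The substitution `T ↦ Uᵖ`. -/
def substMono (p : σ →₀ ℕ) (hp : p ≠ 0) : PowerSeries A →+* MvPowerSeries σ A :=
  (HahnSeries.toMvPowerSeries : HahnSeries (σ →₀ ℕ) A ≃+* MvPowerSeries σ A).toRingHom.comp
    ((HahnSeries.embDomainRingHom (multiplesHom (σ →₀ ℕ) p) (smul_injective_of_ne_zero hp)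
      (smul_le_smul_iff_of_ne_zero hp)).comp
      (HahnSeries.toPowerSeries : HahnSeries ℕ A ≃+* PowerSeries A).symm.toRingHom)

theorem coeff_substMono_smul {p : σ →₀ ℕ} (hp : p ≠ 0) (f : PowerSeries A) (k : ℕ) :
    coeff (k • p) (substMono p hp f) = PowerSeries.coeff k f := by
  rw [← HahnSeries.coeff_toPowerSeries_symm]
  change coeff (k • p) (HahnSeries.toMvPowerSeries _) = _
  rw [HahnSeries.coeff_toMvPowerSeries]
  exact HahnSeries.embDomain_coeff

theorem coeff_substMono_of_ne {p : σ →₀ ℕ} (hp : p ≠ 0) (f : PowerSeries A) {n : σ →₀ ℕ}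
    (hn : ∀ k : ℕ, n ≠ k • p) : coeff n (substMono p hp f) = 0 := by
  change coeff n (HahnSeries.toMvPowerSeries _) = _
  rw [HahnSeries.coeff_toMvPowerSeries]
  refine HahnSeries.embDomain_of_notMem_range ?_
  rintro ⟨k, rfl⟩
  exact hn k rfl

theorem substMono_C {p : σ →₀ ℕ} (hp : p ≠ 0) (f : A) :
    substMono p hp (PowerSeries.C f) = MvPowerSeries.C f := by
  classical
  ext n
  rw [coeff_C]
  by_cases hn : ∃ k : ℕ, n = k • p
  · obtain ⟨k, rfl⟩ := hn
    rw [coeff_substMono_smul, PowerSeries.coeff_C]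
    simp [hp]
  · push Not at hn
    rw [coeff_substMono_of_ne hp _ hn, if_neg]
    simpa using hn 0

open Classical in
/-- The exponential `exp(Uᵖ z) = ∑ zᵏ Uᵏᵖ / k!` (and `1` if `p = 0`). -/
def expMono (p : σ →₀ ℕ) (z : A) : MvPowerSeries σ A :=
  if hp : p = 0 then 1 else substMono p hp (expSeries z)

theorem expMono_of_ne {p : σ →₀ ℕ} (hp : p ≠ 0) (z : A) :
    expMono p z = substMono p hp (expSeries z) := dif_neg hp

theorem expMono_zero_left (z : A) : expMono (0 : σ →₀ ℕ) z = 1 := dif_pos rfl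

theorem coeff_expMono_smul {p : σ →₀ ℕ} (hp : p ≠ 0) (z : A) (k : ℕ) :
    coeff (k • p) (expMono p z) = ((k.factorial : ℂ)⁻¹) • z ^ k := by
  rw [expMono_of_ne hp, coeff_substMono_smul, expSeries, PowerSeries.coeff_mk]

theorem coeff_expMono_of_ne {p : σ →₀ ℕ} (z : A) {n : σ →₀ ℕ}
    (hn : ∀ k : ℕ, n ≠ k • p) : coeff n (expMono p z) = 0 := by
  classical
  by_cases hp : p = 0
  · subst hp
    rw [expMono_zero_left, coeff_one, if_neg]
    simpa using hn 0
  · rw [expMono_of_ne hp, coeff_substMono_of_ne hp _ hn]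

theorem coeff_zero_expMono (p : σ →₀ ℕ) (z : A) : coeff 0 (expMono p z) = 1 := by
  classical
  by_cases hp : p = 0
  · subst hp
    rw [expMono_zero_left, coeff_one, if_pos rfl]
  · have := coeff_expMono_smul hp z 0
    simpa using this

theorem expMono_zero (p : σ →₀ ℕ) : expMono p (0 : A) = 1 := by
  by_cases hp : p = 0
  · rw [hp, expMono_zero_left]
  · rw [expMono_of_ne hp, expSeries_zero, map_one]

theorem expMono_mul_neg (p : σ →₀ ℕ) (z : A) : expMono p z * expMono p (-z) = 1 := by
  by_cases hp : p = 0
  · rw [hp, expMono_zero_left, expMono_zero_left, one_mul]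
  · rw [expMono_of_ne hp, expMono_of_ne hp, ← map_mul, expSeries_mul_neg, map_one]

theorem expMono_neg_mul (p : σ →₀ ℕ) (z : A) : expMono p (-z) * expMono p z = 1 := by
  have := expMono_mul_neg p (-z)
  rwa [neg_neg] at this

theorem map_expMono {A' : Type*} [Ring A'] [Algebra ℂ A'] (φ : A →ₐ[ℂ] A') (p : σ →₀ ℕ) (z : A) :
    MvPowerSeries.map (φ : A →+* A') (expMono p z) = expMono p (φ z) := by
  by_cases hp : p = 0
  · rw [hp, expMono_zero_left, expMono_zero_left, map_one]
  ext n
  rw [MvPowerSeries.coeff_map]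
  by_cases hn : ∃ k : ℕ, n = k • p
  · obtain ⟨k, rfl⟩ := hn
    rw [coeff_expMono_smul hp, coeff_expMono_smul hp]
    simp
  · push Not at hn
    rw [coeff_expMono_of_ne z hn, coeff_expMono_of_ne _ hn, map_zero]

/-- The derivation of the ring of power series that multiplies `Uⁿ` by the degree of `n`. -/
def eulerDer (F : MvPowerSeries σ A) : MvPowerSeries σ A := fun n => (n.degree : ℂ) • coeff n F

theorem coeff_eulerDer (F : MvPowerSeries σ A) (n : σ →₀ ℕ) :
    coeff n (eulerDer F) = (n.degree : ℂ) • coeff n F := rfl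

theorem eulerDer_mul (F G : MvPowerSeries σ A) :
    eulerDer (F * G) = eulerDer F * G + F * eulerDer G := by
  classical
  ext n
  rw [map_add, coeff_eulerDer, coeff_mul, coeff_mul, coeff_mul, Finset.smul_sum,
    ← Finset.sum_add_distrib]
  refine Finset.sum_congr rfl fun p hp => ?_
  rw [Finset.HasAntidiagonal.mem_antidiagonal] at hp
  rw [coeff_eulerDer, coeff_eulerDer, smul_mul_assoc, mul_smul_comm, ← add_smul, ← hp, map_add]
  push_cast
  rfl

/-- The Euler derivation multiplies Uᵏᵖ by k|p|, and k cancels against k!. The logarithmic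
derivative is the single monomial |p| z Uᵖ. -/
theorem eulerDer_expMono (p : σ →₀ ℕ) (z : A) :
    eulerDer (expMono p z) = monomial p ((p.degree : ℂ) • z) * expMono p z := by
  classical
  ext n
  rw [coeff_eulerDer, coeff_monomial_mul]
  by_cases hp : p = 0
  · subst hp
    rw [expMono_zero_left, coeff_one]
    by_cases hn : n = 0 <;> simp [hn]
  by_cases hn : ∃ k : ℕ, n = k • p
  · obtain ⟨k, rfl⟩ := hn
    rcases k with _ | k
    · have : ¬ p ≤ 0 := fun h => hp (le_antisymm h bot_le)
      simp [this]
    · have h1 : p ≤ (k + 1) • p := by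
        conv_lhs => rw [← one_smul ℕ p]
        exact (smul_le_smul_iff_of_ne_zero hp _ _).2 (by omega)
      have h2 : (k + 1) • p - p = k • p := by
        rw [add_smul, one_smul, add_tsub_cancel_right]
      rw [if_pos h1, h2, coeff_expMono_smul hp, coeff_expMono_smul hp, smul_mul_smul_comm,
        ← pow_succ', smul_smul, map_nsmul]
      congr 1
      rw [Nat.factorial_succ, smul_eq_mul]
      have h3 : (k.factorial : ℂ) ≠ 0 := by exact_mod_cast Nat.factorial_ne_zero _
      have h4 : (k : ℂ) + 1 ≠ 0 := by exact_mod_cast Nat.succ_ne_zero k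
      push_cast
      field_simp
  · push Not at hn
    rw [coeff_expMono_of_ne z hn, smul_zero]
    split_ifs with h
    · rw [coeff_expMono_of_ne, mul_zero]
      intro k hk
      apply hn (k + 1)
      rw [add_smul, one_smul, ← hk, tsub_add_cancel_of_le h]
    · rfl

/-! ### Lie series -/

variable {S : (σ →₀ ℕ) → Submodule ℂ A}

/-- The series whose coefficients belong to a given family of submodules. -/
def IsLieSeries (S : (σ →₀ ℕ) → Submodule ℂ A) (F : MvPowerSeries σ A) : Prop :=
  ∀ n, coeff n F ∈ S n

theorem IsLieSeries.add {F G : MvPowerSeries σ A} (hF : IsLieSeries S F) (hG : IsLieSeries S G) :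
    IsLieSeries S (F + G) := fun n => by
  rw [map_add]; exact add_mem (hF n) (hG n)

theorem isLieSeries_monomial {p : σ →₀ ℕ} {z : A} (hz : z ∈ S p) :
    IsLieSeries S (monomial p z) := by
  classical
  intro n
  rw [coeff_monomial]
  split_ifs with h
  · exact h ▸ hz
  · exact zero_mem _

/-- The family `S` is closed under commutators. -/
def IsGradedLie (S : (σ →₀ ℕ) → Submodule ℂ A) : Prop :=
  ∀ p q, ∀ a ∈ S p, ∀ b ∈ S q, a * b - b * a ∈ S (p + q)

theorem IsGradedLie.ad_pow_mem (hS : IsGradedLie S) {p q : σ →₀ ℕ} {a b : A} (ha : a ∈ S p)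
    (hb : b ∈ S q) (k : ℕ) : ((LieAlgebra.ad ℂ A a) ^ k) b ∈ S (k • p + q) := by
  induction k with
  | zero => simpa using hb
  | succ k ih =>
    rw [pow_succ', Module.End.mul_apply, add_smul, one_smul, add_comm (k • p), add_assoc]
    exact hS _ _ _ ha _ ih

theorem coeff_mul_mul_eq_zero {F G H : MvPowerSeries σ A} {n : σ →₀ ℕ}
    (hG : ∀ m ≤ n, coeff m G = 0) : coeff n (F * G * H) = 0 := by
  classical
  rw [coeff_mul]
  refine Finset.sum_eq_zero fun p hp => ?_
  rw [coeff_mul, Finset.sum_eq_zero, zero_mul]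
  intro q hq
  rw [Finset.HasAntidiagonal.mem_antidiagonal] at hp hq
  rw [hG, mul_zero]
  rw [← hp, ← hq]
  exact le_add_right le_add_self

/-- Conjugating f Uᵐ gives the sum of (ad z)ᵏ f Uᵏᵖ⁺ᵐ / k!, whose coefficients are Lie. A general F
reduces to its finitely many monomials with m ≤ n, since the others do not affect the coefficient at
n. -/
theorem IsLieSeries.conj_expMono (hS : IsGradedLie S) {p : σ →₀ ℕ} {z : A} (hz : z ∈ S p)
    {F : MvPowerSeries σ A} (hF : IsLieSeries S F) :
    IsLieSeries S (expMono p z * F * expMono p (-z)) := by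
  classical
  by_cases hp : p = 0
  · subst hp
    rwa [expMono_zero_left, expMono_zero_left, one_mul, mul_one]
  have hmono : ∀ m, ∀ f ∈ S m, IsLieSeries S (expMono p z * monomial m f * expMono p (-z)) := by
    intro m f hf n
    have e1 : (monomial m f : MvPowerSeries σ A) =
        monomial m 1 * substMono p hp (PowerSeries.C f) := by
      rw [substMono_C, ← monomial_zero_eq_C_apply, monomial_mul_monomial, add_zero, one_mul]
    have e0 : expMono p z * monomial m (1 : A) = monomial m 1 * expMono p z :=
      (commute_monomial (expMono p z)).2 fun _ => Commute.one_right _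
    have e2 : expMono p z * monomial m f * expMono p (-z) =
        monomial m 1 * substMono p hp (expSeries z * PowerSeries.C f * expSeries (-z)) := by
      rw [e1, ← mul_assoc, e0, map_mul, map_mul, ← expMono_of_ne hp, ← expMono_of_ne hp]
      simp only [mul_assoc]
    rw [e2, coeff_monomial_mul, one_mul]
    split_ifs with hmn
    · by_cases hn : ∃ k : ℕ, n - m = k • p
      · obtain ⟨k, hk⟩ := hn
        rw [hk, coeff_substMono_smul, coeff_expSeries_conj]
        have := hS.ad_pow_mem hz hf k
        rw [← hk, tsub_add_cancel_of_le hmn] at this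
        exact Submodule.smul_mem _ _ this
      · push Not at hn
        rw [coeff_substMono_of_ne hp _ hn]
        exact zero_mem _
    · exact zero_mem _
  intro n
  have hfin : (Set.Iic n).Finite := Set.finite_Iic n
  have hsum : coeff n (expMono p z * F * expMono p (-z)) =
      ∑ m ∈ hfin.toFinset, coeff n (expMono p z * monomial m (coeff m F) * expMono p (-z)) := by
    rw [← map_sum, ← Finset.sum_mul, ← Finset.mul_sum, ← sub_eq_zero, ← map_sub, ← sub_mul,
      ← mul_sub]
    refine coeff_mul_mul_eq_zero fun m hm => ?_
    rw [map_sub, map_sum, sub_eq_zero, Finset.sum_eq_single m]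
    · rw [coeff_monomial_same]
    · intro b _ hb
      rw [coeff_monomial_ne hb.symm]
    · intro h
      exact absurd (hfin.mem_toFinset.2 hm) h
  rw [hsum]
  exact sum_mem fun m _ => hmono m _ (hF m) n

end Formal

/-! ### Factorization of Lie-like series -/

section Factorization

open MvPowerSeries

set_option linter.unusedSectionVars false

variable {σ : Type} [Finite σ] {A : Type*} [Ring A] [Algebra ℂ A] {S : (σ →₀ ℕ) → Submodule ℂ A}

/-- The logarithmic derivative of `F` is a Lie series, and conjugation by `F` preserves the Lie
series. -/
def IsLieLike (S : (σ →₀ ℕ) → Submodule ℂ A) (F : MvPowerSeries σ A) : Prop :=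
  (∃ D, IsLieSeries S D ∧ eulerDer F = D * F) ∧
    ∀ G, IsLieSeries S G → ∃ G', IsLieSeries S G' ∧ F * G = G' * F

/-- If D and D' are the logarithmic derivatives of F and G, that of FG is D + F D' F⁻¹. This is why
invariance of Lie series under conjugation is part of `IsLieLike`. -/
theorem IsLieLike.mul {F G : MvPowerSeries σ A} (hF : IsLieLike S F) (hG : IsLieLike S G) :
    IsLieLike S (F * G) := by
  obtain ⟨⟨D, hD, eD⟩, hF⟩ := hF
  obtain ⟨⟨D', hD', eD'⟩, hG⟩ := hG
  constructor
  · obtain ⟨D'', hD'', e⟩ := hF D' hD'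
    refine ⟨D + D'', hD.add hD'', ?_⟩
    rw [eulerDer_mul, eD, eD', ← mul_assoc F, e, add_mul, mul_assoc, mul_assoc]
  · intro H hH
    obtain ⟨H', hH', e⟩ := hG H hH
    obtain ⟨H'', hH'', e'⟩ := hF H' hH'
    exact ⟨H'', hH'', by rw [mul_assoc, e, ← mul_assoc, e', mul_assoc]⟩

theorem isLieLike_expMono (hS : IsGradedLie S) {p : σ →₀ ℕ} {z : A} (hz : z ∈ S p) :
    IsLieLike S (expMono p z) :=
  ⟨⟨_, isLieSeries_monomial (Submodule.smul_mem _ _ hz), eulerDer_expMono p z⟩, fun G hG =>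
    ⟨_, hG.conj_expMono hS hz, by rw [mul_assoc, expMono_neg_mul, mul_one]⟩⟩

theorem coeff_zero_mul_eq (F G : MvPowerSeries σ A) :
    coeff 0 (F * G) = coeff 0 F * coeff 0 G := by
  simp only [coeff_zero_eq_constantCoeff_apply, map_mul]

variable (ε : ℕ ≃ (σ →₀ ℕ))

/-- Apart from the constant term `1`, the series `F` has no coefficients before position `N`. -/
def IsOneUpTo (N : ℕ) (F : MvPowerSeries σ A) : Prop :=
  ∀ n, ε.symm n < N → coeff n F = coeff n 1

variable {ε}

theorem coeff_mul_of_isOneUpTo (hε : ∀ p q, p ≤ q → ε.symm p ≤ ε.symm q) {N : ℕ}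
    {F G : MvPowerSeries σ A} (hF : IsOneUpTo ε N F) {n : σ →₀ ℕ} (hn : ε.symm n < N) :
    coeff n (F * G) = coeff n G := by
  classical
  conv_rhs => rw [← one_mul G]
  rw [coeff_mul, coeff_mul]
  refine Finset.sum_congr rfl fun p hp => ?_
  rw [Finset.HasAntidiagonal.mem_antidiagonal] at hp
  rw [hF _ ((hε _ _ (hp ▸ le_self_add)).trans_lt hn)]

theorem lt_of_le_of_ne' (hε : ∀ p q, p ≤ q → ε.symm p ≤ ε.symm q) {p q : σ →₀ ℕ} (h : p ≤ q)
    (hne : p ≠ q) : ε.symm p < ε.symm q :=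
  lt_of_le_of_ne (hε p q h) fun h' => hne (ε.symm.injective h')

/-- At p only the terms D_p · 1 and D_0 F_p of D F survive, and D_0 = 0 by looking at degree 0.
Hence |p| F_p = D_p, and one divides by |p|. -/
theorem leading_coeff_mem (hε : ∀ p q, p ≤ q → ε.symm p ≤ ε.symm q) {F : MvPowerSeries σ A}
    (hF : IsLieLike S F) {p : σ →₀ ℕ} (hp : p ≠ 0) (hN : IsOneUpTo ε (ε.symm p) F) :
    coeff p F ∈ S p := by
  classical
  obtain ⟨⟨D, hD, eD⟩, -⟩ := hF
  have hpos : ε.symm 0 < ε.symm p := lt_of_le_of_ne' hε bot_le hp.symm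
  have h0 : coeff 0 F = 1 := by rw [hN 0 hpos, coeff_one, if_pos rfl]
  have hF0 : ∀ n, n ≠ 0 → n ≤ p → n ≠ p → coeff n F = 0 := fun n h h' h'' => by
    rw [hN n (lt_of_le_of_ne' hε h' h''), coeff_one, if_neg h]
  have hsum : ∀ n, coeff n (eulerDer F) =
      ∑ q ∈ Finset.HasAntidiagonal.antidiagonal n, coeff q.1 D * coeff q.2 F := fun n => by
    rw [eD, coeff_mul]
  have hmain : coeff p (eulerDer F) = coeff p D + coeff 0 D * coeff p F := by
    rw [hsum, Finset.sum_eq_add (p, 0) (0, p)]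
    · rw [h0, mul_one]
    · intro h
      exact hp (Prod.ext_iff.1 h).1
    · rintro ⟨a, b⟩ hab ⟨h1, h2⟩
      rw [Finset.HasAntidiagonal.mem_antidiagonal] at hab
      have hb0 : b ≠ 0 := by
        rintro rfl
        exact h1 (Prod.ext (by simpa using hab) rfl)
      have hbp : b ≠ p := by
        rintro rfl
        exact h2 (Prod.ext (by simpa using hab) rfl)
      dsimp only
      rw [hF0 b hb0 (hab ▸ le_add_self) hbp, mul_zero]
    · intro h
      exact absurd (Finset.HasAntidiagonal.mem_antidiagonal.2 (add_zero p)) h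
    · intro h
      exact absurd (Finset.HasAntidiagonal.mem_antidiagonal.2 (zero_add p)) h
  have hD0 : coeff 0 D = 0 := by
    have := congrArg (coeff 0) eD
    rw [coeff_eulerDer, map_zero, Nat.cast_zero, zero_smul, coeff_zero_mul_eq, h0, mul_one] at this
    exact this.symm
  rw [hD0, zero_mul, add_zero, coeff_eulerDer] at hmain
  have hdeg : (p.degree : ℂ) ≠ 0 := by
    rw [Nat.cast_ne_zero]
    exact fun h => hp ((Finsupp.degree_eq_zero_iff p).1 h)
  have : coeff p F = ((p.degree : ℂ)⁻¹) • coeff p D := by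
    rw [← hmain, smul_smul, inv_mul_cancel₀ hdeg, one_smul]
  rw [this]
  exact Submodule.smul_mem _ _ (hD p)

/-- The exponential is 1 at all positions before p, so nothing changes there; at p the contributions
F_p and −F_p cancel. -/
theorem IsOneUpTo.mul_expMono (hε : ∀ p q, p ≤ q → ε.symm p ≤ ε.symm q) {F : MvPowerSeries σ A}
    {p : σ →₀ ℕ} (hp : p ≠ 0) (hN : IsOneUpTo ε (ε.symm p) F) :
    IsOneUpTo ε (ε.symm p + 1) (F * expMono p (-coeff p F)) := by
  classical
  have hpos : ε.symm 0 < ε.symm p := lt_of_le_of_ne' hε bot_le hp.symm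
  have h0 : coeff 0 F = 1 := by rw [hN 0 hpos, coeff_one, if_pos rfl]
  have hexp : ∀ n, n ≠ 0 → ¬ p ≤ n → coeff n (expMono p (-coeff p F)) = 0 := by
    intro n hn hpn
    refine coeff_expMono_of_ne _ fun k hk => ?_
    rcases k with _ | k
    · exact hn (by simpa using hk)
    · apply hpn
      rw [hk, add_smul, one_smul]
      exact le_add_self
  intro n hn
  rcases (Nat.lt_succ_iff.1 hn).lt_or_eq with hlt | heq
  · rw [coeff_mul_of_isOneUpTo hε hN hlt, coeff_one]
    split_ifs with h
    · rw [h, coeff_zero_expMono]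
    · exact hexp n h fun h' => absurd (hε _ _ h') (not_le.2 hlt)
  · have hnp : n = p := ε.symm.injective heq
    subst hnp
    have hE : coeff n (expMono n (-coeff n F)) = -coeff n F := by
      have := coeff_expMono_smul hp (-coeff n F) 1
      simpa using this
    rw [coeff_one, if_neg hp, coeff_mul, Finset.sum_eq_add (n, 0) (0, n)]
    · dsimp only
      rw [coeff_zero_expMono, h0, hE, mul_one, one_mul, add_neg_cancel]
    · intro h
      exact hp (Prod.ext_iff.1 h).1
    · rintro ⟨a, b⟩ hab ⟨h1, h2⟩
      rw [Finset.HasAntidiagonal.mem_antidiagonal] at hab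
      have hb0 : b ≠ 0 := by
        rintro rfl
        exact h1 (Prod.ext (by simpa using hab) rfl)
      have hbp : ¬ n ≤ b := by
        intro hle
        have hbn : b = n := le_antisymm (hab ▸ le_add_self) hle
        subst hbn
        exact h2 (Prod.ext (by simpa using hab) rfl)
      dsimp only
      rw [hexp b hb0 hbp, mul_zero]
    · intro h
      exact absurd (Finset.HasAntidiagonal.mem_antidiagonal.2 (add_zero n)) h
    · intro h
      exact absurd (Finset.HasAntidiagonal.mem_antidiagonal.2 (zero_add n)) h

/-- The series that remains after removing the first `N` exponentials from `F`. -/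
def remainder (ε : ℕ ≃ (σ →₀ ℕ)) (F : MvPowerSeries σ A) : ℕ → MvPowerSeries σ A
  | 0 => F
  | N + 1 => remainder ε F N * expMono (ε N) (-coeff (ε N) (remainder ε F N))

/-- The product of the first `N` exponentials, from right to left. -/
def expProd (ε : ℕ ≃ (σ →₀ ℕ)) (z : (σ →₀ ℕ) → A) : ℕ → MvPowerSeries σ A
  | 0 => 1
  | N + 1 => expMono (ε N) (z (ε N)) * expProd ε z N

/-- The exponents of the factorization of `F` into exponentials. -/
def factorExp (ε : ℕ ≃ (σ →₀ ℕ)) (F : MvPowerSeries σ A) (p : σ →₀ ℕ) : A :=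
  coeff p (remainder ε F (ε.symm p))

theorem remainder_mul_expProd (F : MvPowerSeries σ A) (N : ℕ) :
    remainder ε F N * expProd ε (factorExp ε F) N = F := by
  induction N with
  | zero => exact mul_one F
  | succ N ih =>
    rw [remainder, expProd, factorExp, ε.symm_apply_apply, mul_assoc, ← mul_assoc (expMono _ _),
      expMono_neg_mul, one_mul, ih]

theorem enum_zero (hε : ∀ p q, p ≤ q → ε.symm p ≤ ε.symm q) : ε 0 = 0 := by
  have h := hε 0 (ε 0) bot_le
  rw [ε.symm_apply_apply, Nat.le_zero] at h
  rw [← h, ε.apply_symm_apply]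

theorem enum_ne_zero (hε : ∀ p q, p ≤ q → ε.symm p ≤ ε.symm q) {N : ℕ} (hN : N ≠ 0) : ε N ≠ 0 :=
  fun h => hN (ε.injective (h.trans (enum_zero hε).symm))

theorem isOneUpTo_remainder (hε : ∀ p q, p ≤ q → ε.symm p ≤ ε.symm q) {F : MvPowerSeries σ A}
    (h0 : coeff 0 F = 1) (N : ℕ) : IsOneUpTo ε N (remainder ε F N) := by
  classical
  induction N with
  | zero => exact fun n hn => absurd hn (Nat.not_lt_zero _)
  | succ N ih =>
    -- Position 0 carries the exponent 0, where `expMono` is 1 by convention: nothing is removed,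
    -- and the constant term is already 1.
    rcases eq_or_ne N 0 with rfl | hN
    · intro n hn
      have : n = 0 := by
        rw [← enum_zero hε, ← ε.symm_apply_eq]
        omega
      subst this
      rw [remainder, enum_zero hε, expMono_zero_left, mul_one, coeff_one, if_pos rfl]
      exact h0
    · have := IsOneUpTo.mul_expMono hε (enum_ne_zero hε hN) (F := remainder ε F N)
        (by rwa [ε.symm_apply_apply])
      rwa [ε.symm_apply_apply] at this

theorem isLieLike_remainder (hε : ∀ p q, p ≤ q → ε.symm p ≤ ε.symm q) (hS : IsGradedLie S)
    {F : MvPowerSeries σ A} (hF : IsLieLike S F) (h0 : coeff 0 F = 1) (N : ℕ) :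
    IsLieLike S (remainder ε F N) := by
  induction N with
  | zero => exact hF
  | succ N ih =>
    rcases eq_or_ne N 0 with rfl | hN
    · rw [remainder, enum_zero hε, expMono_zero_left, mul_one]
      exact ih
    · refine ih.mul (isLieLike_expMono hS (neg_mem (leading_coeff_mem hε ih
        (enum_ne_zero hε hN) ?_)))
      rw [ε.symm_apply_apply]
      exact isOneUpTo_remainder hε h0 N

theorem factorExp_mem (hε : ∀ p q, p ≤ q → ε.symm p ≤ ε.symm q) (hS : IsGradedLie S)
    {F : MvPowerSeries σ A} (hF : IsLieLike S F) (h0 : coeff 0 F = 1) {p : σ →₀ ℕ} (hp : p ≠ 0) :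
    factorExp ε F p ∈ S p :=
  leading_coeff_mem hε (isLieLike_remainder hε hS hF h0 _) hp (isOneUpTo_remainder hε h0 _)

theorem coeff_expProd (hε : ∀ p q, p ≤ q → ε.symm p ≤ ε.symm q) {F : MvPowerSeries σ A}
    (h0 : coeff 0 F = 1) {N : ℕ} {n : σ →₀ ℕ} (hn : ε.symm n < N) :
    coeff n (expProd ε (factorExp ε F) N) = coeff n F := by
  rw [← coeff_mul_of_isOneUpTo hε (isOneUpTo_remainder hε h0 N) hn, remainder_mul_expProd]

/-! ### Coefficients on the axes -/

/-- The series `F` and `G` have the same coefficients at the exponents `n` with `n s = 0`. -/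
def AgreeOnAxis (s : σ) (F G : MvPowerSeries σ A) : Prop :=
  ∀ n : σ →₀ ℕ, n s = 0 → coeff n F = coeff n G

theorem AgreeOnAxis.mul {s : σ} {F F' G G' : MvPowerSeries σ A} (h : AgreeOnAxis s F F')
    (h' : AgreeOnAxis s G G') : AgreeOnAxis s (F * G) (F' * G') := by
  classical
  intro n hn
  rw [coeff_mul, coeff_mul]
  refine Finset.sum_congr rfl fun p hp => ?_
  rw [Finset.HasAntidiagonal.mem_antidiagonal] at hp
  have := DFunLike.congr_fun hp s
  rw [Finsupp.add_apply, hn] at this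
  rw [h _ (by omega), h' _ (by omega)]

theorem AgreeOnAxis.refl (s : σ) (F : MvPowerSeries σ A) : AgreeOnAxis s F F := fun _ _ => rfl

theorem agreeOnAxis_expMono {s : σ} {p : σ →₀ ℕ} (hp : p s ≠ 0) (z : A) :
    AgreeOnAxis s (expMono p z) 1 := by
  classical
  intro n hn
  by_cases h0 : n = 0
  · rw [h0, coeff_zero_expMono, coeff_one, if_pos rfl]
  · rw [coeff_one, if_neg h0]
    refine coeff_expMono_of_ne _ fun k hk => h0 ?_
    have := DFunLike.congr_fun hk s
    rw [hn, Finsupp.smul_apply, smul_eq_mul, eq_comm, Nat.mul_eq_zero] at this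
    rw [hk, this.resolve_right hp, zero_smul]

/-- An exponent on the axis has coefficient 0 by induction, so its factor is trivial; an exponent
off the axis has a factor that is 1 along the axis. -/
theorem agreeOnAxis_remainder {F : MvPowerSeries σ A}
    {s : σ} (hF : AgreeOnAxis s F 1) (N : ℕ) : AgreeOnAxis s (remainder ε F N) 1 := by
  classical
  induction N with
  | zero => exact hF
  | succ N ih =>
    rw [remainder, ← one_mul (1 : MvPowerSeries σ A)]
    refine ih.mul ?_
    by_cases hs : ε N s = 0
    · by_cases h0 : ε N = 0
      · rw [h0, expMono_zero_left]
        exact AgreeOnAxis.refl _ _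
      · rw [ih _ hs, coeff_one, if_neg h0, neg_zero, expMono_zero]
        exact AgreeOnAxis.refl _ _
    · exact agreeOnAxis_expMono hs _

theorem factorExp_eq_zero {F : MvPowerSeries σ A}
    {s : σ} (hF : AgreeOnAxis s F 1) {p : σ →₀ ℕ} (hp : p ≠ 0) (hs : p s = 0) :
    factorExp ε F p = 0 := by
  classical
  rw [factorExp, agreeOnAxis_remainder hF _ _ hs, coeff_one, if_neg hp]

end Factorization

/-! ### The commutator of two exponentials as a series in two variables. -/

section Commutator

open MvPowerSeries

variable {A : Type*} [Ring A] [Algebra ℂ A]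

/-- The exponent of the product `U₀ U₁`. -/
def expOneOne : Fin 2 →₀ ℕ := Finsupp.single 0 1 + Finsupp.single 1 1

/-- The commutator of `exp(U₀ x)` and `exp(U₁ y)`. -/
def commSeries (x y : A) : MvPowerSeries (Fin 2) A :=
  expMono (Finsupp.single 0 1) x * expMono (Finsupp.single 1 1) y *
    expMono (Finsupp.single 0 1) (-x) * expMono (Finsupp.single 1 1) (-y)

/-- When one variable is set to zero, the commutator collapses to a product of an element and its
inverse. -/
theorem agreeOnAxis_commSeries (x y : A) (s : Fin 2) : AgreeOnAxis s (commSeries x y) 1 := by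
  fin_cases s
  · have h : ∀ a : A, AgreeOnAxis 0 (expMono (Finsupp.single (0 : Fin 2) 1) a) 1 :=
      fun a => agreeOnAxis_expMono (by simp) a
    have := (((h x).mul (AgreeOnAxis.refl 0 (expMono (Finsupp.single 1 1) y))).mul (h (-x))).mul
      (AgreeOnAxis.refl 0 (expMono (Finsupp.single 1 1) (-y)))
    rw [one_mul, mul_one, expMono_mul_neg] at this
    exact this
  · have h : ∀ a : A, AgreeOnAxis 1 (expMono (Finsupp.single (1 : Fin 2) 1) a) 1 :=
      fun a => agreeOnAxis_expMono (by simp) a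
    have := (((AgreeOnAxis.refl 1 (expMono (Finsupp.single 0 1) x)).mul (h y)).mul
      (AgreeOnAxis.refl 1 (expMono (Finsupp.single 0 1) (-x)))).mul (h (-y))
    rw [mul_one, mul_one, expMono_mul_neg] at this
    exact this

theorem coeff_zero_commSeries (x y : A) : coeff 0 (commSeries x y) = 1 := by
  rw [agreeOnAxis_commSeries x y 0 0 rfl, coeff_zero_one]

theorem coeff_expOneOne_mul (s t : Fin 2) (hst : s ≠ t) (x y : A) :
    coeff expOneOne (expMono (Finsupp.single s 1) x * expMono (Finsupp.single t 1) y) = x * y := by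
  classical
  have hs : (Finsupp.single s 1 : Fin 2 →₀ ℕ) ≠ 0 := by simp
  have ht : (Finsupp.single t 1 : Fin 2 →₀ ℕ) ≠ 0 := by simp
  have e : expOneOne = Finsupp.single s 1 + Finsupp.single t 1 := by
    ext i
    fin_cases s <;> fin_cases t <;> simp_all [expOneOne, add_comm]
  have c1 : ∀ (r : Fin 2) (a : A),
      coeff (Finsupp.single r 1) (expMono (Finsupp.single r 1) a) = a := by
    intro r a
    have := coeff_expMono_smul (p := Finsupp.single r 1) (by simp) a 1
    simpa using this
  rw [e, coeff_mul, Finset.sum_eq_single (Finsupp.single s 1, Finsupp.single t 1)]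
  · rw [c1, c1]
  · rintro ⟨a, b⟩ hab hne
    rw [Finset.HasAntidiagonal.mem_antidiagonal] at hab
    by_cases ha : ∃ k : ℕ, a = k • Finsupp.single s 1
    · by_cases hb : ∃ k : ℕ, b = k • Finsupp.single t 1
      · obtain ⟨k, rfl⟩ := ha
        obtain ⟨l, rfl⟩ := hb
        exfalso
        apply hne
        have h1 := DFunLike.congr_fun hab s
        have h2 := DFunLike.congr_fun hab t
        simp [hst, hst.symm] at h1 h2
        rw [h1, h2, one_smul, one_smul]
      · push Not at hb
        rw [coeff_expMono_of_ne y hb, mul_zero]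
    · push Not at ha
      rw [coeff_expMono_of_ne x ha, zero_mul]
  · intro h
    exact absurd (by rw [Finset.HasAntidiagonal.mem_antidiagonal]) h

theorem eq_expOneOne_or {a b : Fin 2 →₀ ℕ} (hab : a + b = expOneOne) :
    (a = 0 ∧ b = expOneOne) ∨ (a = expOneOne ∧ b = 0) ∨
      (a ≠ 0 ∧ b ≠ 0 ∧ ∃ s, a s = 0) := by
  by_cases ha : a = 0
  · exact Or.inl ⟨ha, by rwa [ha, zero_add] at hab⟩
  by_cases hb : b = 0
  · exact Or.inr (Or.inl ⟨by rwa [hb, add_zero] at hab, hb⟩)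
  refine Or.inr (Or.inr ⟨ha, hb, ?_⟩)
  by_contra! hcon
  apply hb
  ext s
  have h1 := DFunLike.congr_fun hab s
  have h2 := hcon s
  have h3 : expOneOne s = 1 := by fin_cases s <;> simp [expOneOne]
  rw [Finsupp.add_apply, h3] at h1
  simp only [Finsupp.coe_zero, Pi.zero_apply]
  omega

/-- The coefficient at `U₀ U₁` is additive on products with a series that is `1` on the axes. -/
theorem coeff_expOneOne_mul_of_agree {F G : MvPowerSeries (Fin 2) A}
    (hF : ∀ s, AgreeOnAxis s F 1) (hG : coeff 0 G = 1) :
    coeff expOneOne (F * G) = coeff expOneOne F + coeff expOneOne G := by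
  classical
  have h11 : expOneOne ≠ 0 := fun h => by simpa [expOneOne] using DFunLike.congr_fun h 0
  rw [coeff_mul, Finset.sum_eq_add (expOneOne, 0) (0, expOneOne)]
  · rw [hG, mul_one, hF 0 0 rfl, coeff_zero_one, one_mul]
  · intro h
    exact h11 (Prod.ext_iff.1 h).1
  · rintro ⟨a, b⟩ hab ⟨h1, h2⟩
    rw [Finset.HasAntidiagonal.mem_antidiagonal] at hab
    rcases eq_expOneOne_or hab with ⟨rfl, rfl⟩ | ⟨rfl, rfl⟩ | ⟨h3, h4, s, hs⟩
    · exact absurd rfl h2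
    · exact absurd rfl h1
    · rw [hF s a hs, coeff_one, if_neg h3, zero_mul]
  · intro h
    exact absurd (Finset.HasAntidiagonal.mem_antidiagonal.2 (add_zero _)) h
  · intro h
    exact absurd (Finset.HasAntidiagonal.mem_antidiagonal.2 (zero_add _)) h

/-- Compare the coefficients of U₀U₁ in C · (YX) = XY. Since C is 1 on the axes, the left one is the
sum of the coefficients of C and of YX. -/
theorem coeff_expOneOne_commSeries (x y : A) :
    coeff expOneOne (commSeries x y) = x * y - y * x := by
  have h : commSeries x y * (expMono (Finsupp.single 1 1) y * expMono (Finsupp.single 0 1) x) =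
      expMono (Finsupp.single 0 1) x * expMono (Finsupp.single 1 1) y := by
    have e : ∀ a b c d d' c' : MvPowerSeries (Fin 2) A, d * d' = 1 → c * c' = 1 →
        a * b * c * d * (d' * c') = a * b := by
      intro a b c d d' c' h1 h2
      rw [← mul_assoc, mul_assoc (a * b * c), h1, mul_one, mul_assoc (a * b), h2, mul_one]
    exact e _ _ _ _ _ _ (expMono_neg_mul _ _) (expMono_neg_mul _ _)
  have h0 : coeff 0 (expMono (Finsupp.single (1 : Fin 2) 1) y *
      expMono (Finsupp.single (0 : Fin 2) 1) x) = 1 := by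
    rw [coeff_zero_mul_eq, coeff_zero_expMono, coeff_zero_expMono, mul_one]
  have h1 := coeff_expOneOne_mul_of_agree (agreeOnAxis_commSeries x y) h0
  rw [h, coeff_expOneOne_mul 0 1 (by decide), coeff_expOneOne_mul 1 0 (by decide)] at h1
  rw [h1, add_sub_cancel_right]

/-- A factor removed before U₀U₁ either has its exponent on an axis, so it is trivial, or has an
exponent that is at least (1, 1), which the order excludes. The coefficient of the original
commutator is therefore still intact. -/
theorem factorExp_commSeries_expOneOne {ε : ℕ ≃ (Fin 2 →₀ ℕ)}
    (hε : ∀ p q, p ≤ q → ε.symm p ≤ ε.symm q) (x y : A) :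
    factorExp ε (commSeries x y) expOneOne = x * y - y * x := by
  classical
  have key : ∀ N, N ≤ ε.symm expOneOne →
      coeff expOneOne (remainder ε (commSeries x y) N) = x * y - y * x := by
    intro N hN
    induction N with
    | zero => exact coeff_expOneOne_commSeries x y
    | succ N ih =>
      rw [remainder, coeff_expOneOne_mul_of_agree
        (fun s => agreeOnAxis_remainder (agreeOnAxis_commSeries x y s) N)
        (coeff_zero_expMono _ _), ih (by omega), add_eq_left]
      have hne : expOneOne ≠ 0 := fun h => by simpa [expOneOne] using DFunLike.congr_fun h 0
      by_cases hs : ∃ s, ε N s = 0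
      · obtain ⟨s, hs⟩ := hs
        by_cases h0 : ε N = 0
        · rw [h0, expMono_zero_left, coeff_one, if_neg hne]
        · rw [agreeOnAxis_remainder (agreeOnAxis_commSeries x y s) N _ hs, coeff_one, if_neg h0,
            neg_zero, expMono_zero, coeff_one, if_neg hne]
      · push Not at hs
        refine coeff_expMono_of_ne _ fun k hk => ?_
        rcases k with _ | k
        · exact hne (by simpa using hk)
        · have h1 : expOneOne ≤ ε N := by
            intro s
            have := hs s
            have h3 : expOneOne s = 1 := by fin_cases s <;> simp [expOneOne]
            omega
          have := hε _ _ h1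
          rw [ε.symm_apply_apply] at this
          omega
  exact key _ le_rfl

end Commutator

/-! ### Homogeneous elements of the free Lie algebra -/

section FreeLie

open MvPowerSeries

variable {σ : Type}

/-- The elements of multidegree `n` of the free Lie algebra: linear combinations of right-normed
brackets of generators. -/
inductive IsHomLie : (σ →₀ ℕ) → FreeLieAlgebra ℂ σ → Prop
  | of (s : σ) : IsHomLie (Finsupp.single s 1) (FreeLieAlgebra.of ℂ s)
  | zero (n : σ →₀ ℕ) : IsHomLie n 0
  | add (n : σ →₀ ℕ) (a b : FreeLieAlgebra ℂ σ) (ha : IsHomLie n a) (hb : IsHomLie n b) :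
      IsHomLie n (a + b)
  | smul (n : σ →₀ ℕ) (t : ℂ) (a : FreeLieAlgebra ℂ σ) (ha : IsHomLie n a) : IsHomLie n (t • a)
  | lie (s : σ) (n : σ →₀ ℕ) (a : FreeLieAlgebra ℂ σ) (ha : IsHomLie n a) :
      IsHomLie (Finsupp.single s 1 + n) ⁅FreeLieAlgebra.of ℂ s, a⁆

/-- The identity [[s, a], b] = [s, [a, b]] − [a, [s, b]] shortens the left entry. Right-normed
brackets are used because Σ(α, β) also grows by one α or β at a time. -/
theorem IsHomLie.lie_mem {n m : σ →₀ ℕ} {a b : FreeLieAlgebra ℂ σ} (ha : IsHomLie n a)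
    (hb : IsHomLie m b) : IsHomLie (n + m) ⁅a, b⁆ := by
  induction ha generalizing m b with
  | of s => exact IsHomLie.lie s m b hb
  | zero n => rw [zero_lie]; exact IsHomLie.zero _
  | add n a a' _ _ ih ih' => rw [add_lie]; exact IsHomLie.add _ _ _ (ih hb) (ih' hb)
  | smul n t a _ ih => rw [smul_lie]; exact IsHomLie.smul _ _ _ (ih hb)
  | lie s n a _ ih =>
    rw [lie_lie, sub_eq_add_neg, ← neg_one_smul ℂ]
    refine IsHomLie.add _ _ _ ?_ (IsHomLie.smul _ _ _ ?_)
    · rw [add_assoc]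
      exact IsHomLie.lie _ _ _ (ih hb)
    · have := ih (IsHomLie.lie s m b hb)
      rwa [← add_assoc, add_comm n] at this

/-- The space of elements of multidegree `n` of the free Lie algebra. -/
def homLie (n : σ →₀ ℕ) : Submodule ℂ (FreeLieAlgebra ℂ σ) where
  carrier := {a | IsHomLie n a}
  zero_mem' := IsHomLie.zero n
  add_mem' ha hb := IsHomLie.add _ _ _ ha hb
  smul_mem' t _ ha := IsHomLie.smul _ t _ ha

/-- The map from the free Lie algebra to its universal enveloping algebra. -/
def envMap : FreeLieAlgebra ℂ σ →ₗ[ℂ] UniversalEnvelopingAlgebra ℂ (FreeLieAlgebra ℂ σ) :=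
  (UniversalEnvelopingAlgebra.ι ℂ : FreeLieAlgebra ℂ σ →ₗ⁅ℂ⁆ _)

theorem envMap_lie (a b : FreeLieAlgebra ℂ σ) :
    envMap ⁅a, b⁆ = envMap a * envMap b - envMap b * envMap a :=
  (UniversalEnvelopingAlgebra.ι ℂ : FreeLieAlgebra ℂ σ →ₗ⁅ℂ⁆ _).map_lie a b

theorem isGradedLie_homLie : IsGradedLie fun n : σ →₀ ℕ => (homLie n).map envMap := by
  rintro p q _ ⟨a, ha, rfl⟩ _ ⟨b, hb, rfl⟩
  exact ⟨⁅a, b⁆, IsHomLie.lie_mem ha hb, envMap_lie a b⟩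

theorem isLieLike_commSeries :
    IsLieLike (fun n : Fin 2 →₀ ℕ => (homLie n).map envMap)
      (commSeries (envMap (FreeLieAlgebra.of ℂ 0)) (envMap (FreeLieAlgebra.of ℂ 1))) := by
  have h : ∀ s : Fin 2, envMap (FreeLieAlgebra.of ℂ s) ∈
      (homLie (Finsupp.single s 1)).map envMap := fun s => ⟨_, IsHomLie.of s, rfl⟩
  exact (((isLieLike_expMono isGradedLie_homLie (h 0)).mul
    (isLieLike_expMono isGradedLie_homLie (h 1))).mul
    (isLieLike_expMono isGradedLie_homLie (neg_mem (h 0)))).mul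
    (isLieLike_expMono isGradedLie_homLie (neg_mem (h 1)))

theorem expProd_congr {A : Type*} [Ring A] [Algebra ℂ A] {ε : ℕ ≃ (Fin 2 →₀ ℕ)}
    {z z' : (Fin 2 →₀ ℕ) → A} {N : ℕ} (h : ∀ n, n ≠ 0 → ε.symm n < N → z n = z' n) :
    expProd ε z N = expProd ε z' N := by
  induction N with
  | zero => rfl
  | succ N ih =>
    rw [expProd, expProd, ih fun n hn hN => h n hn (by omega)]
    by_cases h0 : ε N = 0
    · rw [h0, expMono_zero_left, expMono_zero_left]
    · rw [h _ h0 (by rw [ε.symm_apply_apply]; omega)]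

/-- The factorization of the commutator of two exponentials, in the free Lie algebra. -/
theorem exists_universal_factorization {ε : ℕ ≃ (Fin 2 →₀ ℕ)}
    (hε : ∀ p q, p ≤ q → ε.symm p ≤ ε.symm q) :
    ∃ Z : (Fin 2 →₀ ℕ) → FreeLieAlgebra ℂ (Fin 2), (∀ p, IsHomLie p (Z p)) ∧
      (∀ p s, p s = 0 → Z p = 0) ∧
      Z expOneOne = ⁅FreeLieAlgebra.of ℂ (0 : Fin 2), FreeLieAlgebra.of ℂ (1 : Fin 2)⁆ ∧
      ∀ N n, ε.symm n < N → coeff n (expProd ε (fun p => envMap (Z p)) N) =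
        coeff n (commSeries (envMap (FreeLieAlgebra.of ℂ 0)) (envMap (FreeLieAlgebra.of ℂ 1))) := by
  set C := commSeries (envMap (FreeLieAlgebra.of ℂ (0 : Fin 2)))
    (envMap (FreeLieAlgebra.of ℂ (1 : Fin 2))) with hC
  have h0 : coeff 0 C = 1 := coeff_zero_commSeries _ _
  -- Any homogeneous preimage of the exponent will do, so `envMap` need not be injective. On the
  -- axes and at (1, 1) the preimages are prescribed: 0 and the bracket of the generators.
  have key : ∀ p : Fin 2 →₀ ℕ, ∃ z, IsHomLie p z ∧ (∀ s, p s = 0 → z = 0) ∧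
      (p = expOneOne → z = ⁅FreeLieAlgebra.of ℂ (0 : Fin 2), FreeLieAlgebra.of ℂ (1 : Fin 2)⁆) ∧
      (p ≠ 0 → envMap z = factorExp ε C p) := by
    intro p
    have h1 : ∀ s, expOneOne s = 1 := fun s => by fin_cases s <;> simp [expOneOne]
    by_cases hs : ∃ s, p s = 0
    · obtain ⟨s, hs⟩ := hs
      refine ⟨0, IsHomLie.zero p, fun _ _ => rfl, ?_, ?_⟩
      · rintro rfl
        rw [h1] at hs
        exact absurd hs one_ne_zero
      · intro hp
        rw [map_zero, factorExp_eq_zero (agreeOnAxis_commSeries _ _ s) hp hs]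
    · by_cases hp : p = expOneOne
      · subst hp
        refine ⟨_, IsHomLie.lie _ _ _ (IsHomLie.of _), fun s h => absurd ⟨s, h⟩ hs, fun _ => rfl,
          fun _ => ?_⟩
        rw [hC, factorExp_commSeries_expOneOne hε, envMap_lie]
      · have hp0 : p ≠ 0 := fun h => hs ⟨0, by rw [h]; rfl⟩
        obtain ⟨z, hz, e⟩ := factorExp_mem hε isGradedLie_homLie isLieLike_commSeries h0 hp0
        exact ⟨z, hz, fun s h => absurd ⟨s, h⟩ hs, fun h => absurd h hp, fun _ => e⟩
  choose Z hZ1 hZ2 hZ3 hZ4 using key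
  refine ⟨Z, hZ1, hZ2, hZ3 _ rfl, fun N n hn => ?_⟩
  rw [← coeff_expProd hε h0 hn]
  exact congrArg _ (expProd_congr fun p hp _ => hZ4 p hp)

/-! ### Specialization to the adjoint representation of a Lie algebra. -/

theorem map_expProd {A A' : Type*} [Ring A] [Algebra ℂ A] [Ring A'] [Algebra ℂ A']
    (φ : A →ₐ[ℂ] A') (ε : ℕ ≃ (Fin 2 →₀ ℕ)) (z : (Fin 2 →₀ ℕ) → A) (N : ℕ) :
    MvPowerSeries.map (φ : A →+* A') (expProd ε z N) = expProd ε (fun p => φ (z p)) N := by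
  induction N with
  | zero => exact map_one _
  | succ N ih => rw [expProd, expProd, map_mul, ih, map_expMono]

theorem map_commSeries {A A' : Type*} [Ring A] [Algebra ℂ A] [Ring A'] [Algebra ℂ A']
    (φ : A →ₐ[ℂ] A') (x y : A) :
    MvPowerSeries.map (φ : A →+* A') (commSeries x y) = commSeries (φ x) (φ y) := by
  simp only [commSeries, map_mul, map_expMono, map_neg]

/-- The factorization specializes to elements `x, y` of any Lie algebra, acting by the adjoint
representation. -/
theorem coeff_expProd_ad {L : Type*} [LieRing L] [LieAlgebra ℂ L] {ε : ℕ ≃ (Fin 2 →₀ ℕ)}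
    {Z : (Fin 2 →₀ ℕ) → FreeLieAlgebra ℂ (Fin 2)}
    (hZ : ∀ N n, ε.symm n < N → coeff n (expProd ε (fun p => envMap (Z p)) N) =
      coeff n (commSeries (envMap (FreeLieAlgebra.of ℂ 0)) (envMap (FreeLieAlgebra.of ℂ 1))))
    (x y : L) {N : ℕ} {n : Fin 2 →₀ ℕ} (hn : ε.symm n < N) :
    coeff n (expProd ε (fun p => LieAlgebra.ad ℂ L (FreeLieAlgebra.lift ℂ ![x, y] (Z p))) N) =
      coeff n (commSeries (LieAlgebra.ad ℂ L x) (LieAlgebra.ad ℂ L y)) := by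
  let ψ : FreeLieAlgebra ℂ (Fin 2) →ₗ⁅ℂ⁆ Module.End ℂ L :=
    (LieAlgebra.ad ℂ L).comp (FreeLieAlgebra.lift ℂ ![x, y])
  let φ := UniversalEnvelopingAlgebra.lift ℂ ψ
  have hφ : ∀ a, φ (envMap a) = LieAlgebra.ad ℂ L (FreeLieAlgebra.lift ℂ ![x, y] a) := fun a =>
    UniversalEnvelopingAlgebra.lift_ι_apply ℂ ψ a
  have h := congrArg φ (hZ N n hn)
  have e1 := congrArg (coeff n) (map_expProd φ ε (fun p => envMap (Z p)) N)
  have e2 := congrArg (coeff n) (map_commSeries φ (envMap (FreeLieAlgebra.of ℂ 0))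
    (envMap (FreeLieAlgebra.of ℂ 1)))
  rw [MvPowerSeries.coeff_map] at e1 e2
  simp only [hφ, FreeLieAlgebra.lift_of_apply, Matrix.cons_val_zero, Matrix.cons_val_one] at e1 e2
  exact e1.symm.trans (h.trans e2)

/-! ### Coefficients of partial products -/

/-- Apart from its constant term, the factor at position N lives on positive multiples of its
exponent, none of which comes before N. -/
theorem coeff_expProd_succ_of_lt {A : Type*} [Ring A] [Algebra ℂ A] {ε : ℕ ≃ (Fin 2 →₀ ℕ)}
    (hε : ∀ p q, p ≤ q → ε.symm p ≤ ε.symm q) (z : (Fin 2 →₀ ℕ) → A) {N : ℕ} {n : Fin 2 →₀ ℕ}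
    (hn : ε.symm n < N) : coeff n (expProd ε z (N + 1)) = coeff n (expProd ε z N) := by
  classical
  rw [expProd]
  refine coeff_mul_of_isOneUpTo hε (N := N) (fun m hm => ?_) hn
  rw [coeff_one]
  split_ifs with h
  · rw [h, coeff_zero_expMono]
  · refine coeff_expMono_of_ne _ fun k hk => ?_
    rcases k with _ | k
    · exact h (by simpa using hk)
    · have h1 : ε N ≤ m := by
        rw [hk, add_smul, one_smul]
        exact le_add_self
      have := hε _ _ h1
      rw [ε.symm_apply_apply] at this
      omega

theorem coeff_expProd_of_le {A : Type*} [Ring A] [Algebra ℂ A] {ε : ℕ ≃ (Fin 2 →₀ ℕ)}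
    (hε : ∀ p q, p ≤ q → ε.symm p ≤ ε.symm q) (z : (Fin 2 →₀ ℕ) → A) {N M : ℕ} {n : Fin 2 →₀ ℕ}
    (hn : ε.symm n < N) (hNM : N ≤ M) : coeff n (expProd ε z M) = coeff n (expProd ε z N) := by
  induction M, hNM using Nat.le_induction with
  | base => rfl
  | succ M hM ih => rw [coeff_expProd_succ_of_lt hε z (hn.trans_le hM), ih]

theorem coeff_zero_expProd {A : Type*} [Ring A] [Algebra ℂ A] (ε : ℕ ≃ (Fin 2 →₀ ℕ))
    (z : (Fin 2 →₀ ℕ) → A) (N : ℕ) : coeff 0 (expProd ε z N) = 1 := by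
  induction N with
  | zero => exact coeff_zero_one
  | succ N ih => rw [expProd, coeff_zero_mul_eq, coeff_zero_expMono, ih, mul_one]

theorem coeff_expMono_mul_self {A : Type*} [Ring A] [Algebra ℂ A] {p : Fin 2 →₀ ℕ} (hp : p ≠ 0)
    (z : A) {G : MvPowerSeries (Fin 2) A} (hG : coeff 0 G = 1) :
    coeff p (expMono p z * G) = z + coeff p G := by
  classical
  have hE : coeff p (expMono p z) = z := by
    have := coeff_expMono_smul hp z 1
    simpa using this
  rw [coeff_mul, Finset.sum_eq_add (p, 0) (0, p)]
  · rw [hE, hG, coeff_zero_expMono, mul_one, one_mul]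
  · intro h
    exact hp (Prod.ext_iff.1 h).1
  · rintro ⟨a, b⟩ hab ⟨h1, h2⟩
    rw [Finset.HasAntidiagonal.mem_antidiagonal] at hab
    have ha : coeff a (expMono p z) = 0 := by
      refine coeff_expMono_of_ne _ fun k hk => ?_
      rcases k with _ | _ | k
      · rw [zero_smul] at hk
        subst hk
        exact h2 (Prod.ext rfl (by simpa using hab))
      · rw [zero_add, one_smul] at hk
        subst hk
        exact h1 (Prod.ext rfl (by simpa using hab))
      · apply hp
        ext s
        have h3 := DFunLike.congr_fun hk s
        have h4 := DFunLike.congr_fun hab s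
        simp only [Finsupp.smul_apply, Finsupp.add_apply, smul_eq_mul, Finsupp.coe_zero,
          Pi.zero_apply] at h3 h4 ⊢
        nlinarith
    dsimp only
    rw [ha, zero_mul]
  · intro h
    exact absurd (Finset.HasAntidiagonal.mem_antidiagonal.2 (add_zero p)) h
  · intro h
    exact absurd (Finset.HasAntidiagonal.mem_antidiagonal.2 (zero_add p)) h

end FreeLie

/-! ### Operators on the completion -/

theorem finsum_antidiagonal {M N : Type*} [AddCommMonoid M] [AddMonoid N]
    [Finset.HasAntidiagonal N] (f : N × N → M) (hf : f.support.Finite) :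
    ∑ᶠ p, f p = ∑ᶠ k, ∑ p ∈ Finset.HasAntidiagonal.antidiagonal k, f p := by
  classical
  set s := hf.toFinset with hs
  have hmem : ∀ p, p ∉ s → f p = 0 := fun p hp => by
    simpa [hs] using hp
  have h1 : ∑ᶠ p, f p = ∑ p ∈ s, f p :=
    finsum_eq_sum_of_support_subset _ (by rw [hs, Set.Finite.coe_toFinset])
  have h2 : ∀ k, ∑ p ∈ Finset.HasAntidiagonal.antidiagonal k, f p =
      ∑ p ∈ s.filter (fun p => p.1 + p.2 = k), f p := by
    intro k
    symm
    refine Finset.sum_subset (fun p hp => ?_) (fun p hp hp' => hmem p fun h => hp' ?_)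
    · exact Finset.HasAntidiagonal.mem_antidiagonal.2 (Finset.mem_filter.1 hp).2
    · exact Finset.mem_filter.2 ⟨h, Finset.HasAntidiagonal.mem_antidiagonal.1 hp⟩
  rw [h1, finsum_eq_sum_of_support_subset (s := s.image fun p => p.1 + p.2)]
  · simp only [h2]
    exact (Finset.sum_fiberwise_of_maps_to (s := s) (t := s.image fun p => p.1 + p.2)
      (g := fun p => p.1 + p.2) (fun p hp => Finset.mem_image_of_mem _ hp) f).symm
  · intro k hk
    rw [Function.mem_support, h2] at hk
    obtain ⟨p, hp, -⟩ := Finset.exists_ne_zero_of_sum_ne_zero hk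
    obtain ⟨hps, rfl⟩ := Finset.mem_filter.1 hp
    exact Finset.mem_coe.2 (Finset.mem_image_of_mem _ hps)

theorem finsum_comp_injective {M ι κ : Type*} [AddCommMonoid M] {g : ι → κ}
    (hg : Function.Injective g) (f : κ → M) (hf : ∀ k, k ∉ Set.range g → f k = 0) :
    ∑ᶠ k, f k = ∑ᶠ i, f (g i) := by
  rw [← finsum_mem_range hg, finsum_mem_def, Set.indicator_eq_self.2]
  intro k hk
  by_contra h
  exact hk (hf k h)

theorem finsum_mem_submodule {ι M : Type*} [AddCommGroup M] [Module ℂ M] (p : Submodule ℂ M)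
    {f : ι → M} (hf : ∀ i, f i ∈ p) : ∑ᶠ i, f i ∈ p :=
  finsum_induction (· ∈ p) p.zero_mem (fun _ _ => p.add_mem) hf

section Operators

open MvPowerSeries

/-- The ring of operators on `𝔪`. -/
abbrev Op : Type := Module.End ℂ MLie

/-- The weight `n₀ α + n₁ β`. -/
def wt (α β : Wt) : (Fin 2 →₀ ℕ) →+ Wt where
  toFun n := n 0 • α + n 1 • β
  map_zero' := by simp
  map_add' n m := by
    simp only [Finsupp.add_apply, add_smul]
    abel

theorem wt_apply (α β : Wt) (n : Fin 2 →₀ ℕ) : wt α β n = n 0 • α + n 1 • β := rfl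

/-- The monomial `t ↦ tⁿ`. -/
def tpow (t : Fin 2 → ℂ) (n : Fin 2 →₀ ℕ) : ℂ := n.prod fun s k => t s ^ k

theorem tpow_add (t : Fin 2 → ℂ) (n m : Fin 2 →₀ ℕ) : tpow t (n + m) = tpow t n * tpow t m :=
  Finsupp.prod_add_index' (fun _ => pow_zero _) fun _ _ _ => pow_add _ _ _

theorem tpow_zero (t : Fin 2 → ℂ) : tpow t 0 = 1 := Finsupp.prod_zero_index

theorem tpow_eq (t : Fin 2 → ℂ) (n : Fin 2 →₀ ℕ) : tpow t n = t 0 ^ n 0 * t 1 ^ n 1 := by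
  rw [tpow, Finsupp.prod_fintype _ _ fun _ => pow_zero _, Fin.prod_univ_two]

theorem tpow_smul (t : Fin 2 → ℂ) (p : Fin 2 →₀ ℕ) (k : ℕ) : tpow t (k • p) = tpow t p ^ k := by
  induction k with
  | zero => rw [zero_smul, tpow_zero, pow_zero]
  | succ k ih => rw [add_smul, one_smul, tpow_add, ih, pow_succ]

/-- The operators of degree `κ` that map `𝔪_δ`, for `δ ∈ P`, to `0` unless `δ + κ ∈ P`. -/
structure IsHomOp (P : Set Wt) (κ : Wt) (b : Op) : Prop where
  map_mem : ∀ δ, ∀ y ∈ rootSpace δ, b y ∈ rootSpace (δ + κ)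
  add_mem : ∀ δ ∈ P, ∀ y ∈ rootSpace δ, b y ≠ 0 → δ + κ ∈ P

theorem isHomOp_zero (P : Set Wt) (κ : Wt) : IsHomOp P κ 0 :=
  ⟨fun _ _ _ => zero_mem _, fun _ _ _ _ h => absurd rfl h⟩

theorem isHomOp_one (P : Set Wt) : IsHomOp P 0 1 :=
  ⟨fun δ y hy => by rw [add_zero]; exact hy, fun δ hδ _ _ _ => by rwa [add_zero]⟩

theorem IsHomOp.add {P : Set Wt} {κ : Wt} {b c : Op} (hb : IsHomOp P κ b) (hc : IsHomOp P κ c) :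
    IsHomOp P κ (b + c) := by
  refine ⟨fun δ y hy => Submodule.add_mem _ (hb.1 δ y hy) (hc.1 δ y hy), fun δ hδ y hy h => ?_⟩
  by_cases h0 : b y = 0
  · refine hc.2 δ hδ y hy fun h1 => h ?_
    rw [LinearMap.add_apply, h0, h1, add_zero]
  · exact hb.2 δ hδ y hy h0

theorem IsHomOp.smul {P : Set Wt} {κ : Wt} {b : Op} (t : ℂ) (hb : IsHomOp P κ b) :
    IsHomOp P κ (t • b) := by
  refine ⟨fun δ y hy => Submodule.smul_mem _ _ (hb.1 δ y hy), fun δ hδ y hy h => ?_⟩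
  refine hb.2 δ hδ y hy fun h1 => h ?_
  rw [LinearMap.smul_apply, h1, smul_zero]

theorem IsHomOp.mul {P : Set Wt} {κ κ' : Wt} {b c : Op} (hb : IsHomOp P κ b)
    (hc : IsHomOp P κ' c) : IsHomOp P (κ + κ') (b * c) := by
  refine ⟨fun δ y hy => ?_, fun δ hδ y hy h => ?_⟩
  · have := hb.1 _ _ (hc.1 δ y hy)
    rwa [add_assoc, add_comm κ'] at this
  · rw [Module.End.mul_apply] at h
    have h1 : c y ≠ 0 := fun h0 => h (by rw [h0, map_zero])
    have := hb.2 _ (hc.2 δ hδ y hy h1) _ (hc.1 δ y hy) h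
    rwa [add_assoc, add_comm κ'] at this

theorem IsHomOp.pow {P : Set Wt} {κ : Wt} {b : Op} (hb : IsHomOp P κ b) (k : ℕ) :
    IsHomOp P (k • κ) (b ^ k) := by
  induction k with
  | zero => rw [zero_smul, pow_zero]; exact isHomOp_one P
  | succ k ih =>
    rw [pow_succ, add_smul, one_smul]
    exact ih.mul hb

theorem isHomOp_sum {ι : Type*} {P : Set Wt} {κ : Wt} (s : Finset ι) (f : ι → Op)
    (h : ∀ i ∈ s, IsHomOp P κ (f i)) : IsHomOp P κ (∑ i ∈ s, f i) :=
  Finset.sum_induction f (IsHomOp P κ) (fun _ _ => IsHomOp.add) (isHomOp_zero P κ) h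

/-- The power series whose coefficients are homogeneous operators. -/
def homMonoid (P : Set Wt) (α β : Wt) : Submonoid (MvPowerSeries (Fin 2) Op) where
  carrier := {F | ∀ n, IsHomOp P (wt α β n) (coeff n F)}
  one_mem' n := by
    classical
    rw [coeff_one]
    split_ifs with h
    · rw [h, map_zero]; exact isHomOp_one P
    · exact isHomOp_zero _ _
  mul_mem' {F G} hF hG n := by
    classical
    rw [coeff_mul]
    refine isHomOp_sum _ _ fun p hp => ?_
    rw [Finset.HasAntidiagonal.mem_antidiagonal] at hp
    rw [← hp, map_add]
    exact (hF p.1).mul (hG p.2)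

theorem expMono_mem_homMonoid {P : Set Wt} {α β : Wt} {p : Fin 2 →₀ ℕ} {b : Op}
    (hb : IsHomOp P (wt α β p) b) : expMono p b ∈ homMonoid P α β := by
  intro n
  by_cases hp : p = 0
  · rw [hp, expMono_zero_left]
    exact (homMonoid P α β).one_mem n
  by_cases hn : ∃ k : ℕ, n = k • p
  · obtain ⟨k, rfl⟩ := hn
    rw [coeff_expMono_smul hp, map_nsmul]
    exact (hb.pow k).smul _
  · push Not at hn
    rw [coeff_expMono_of_ne b hn]
    exact isHomOp_zero _ _

variable {P : Set Wt} {α β : Wt}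

/-- If [z, y] ≠ 0, its degree δ + κ is nonzero because P and −P are disjoint. So it is a root, and
closure puts it in P. -/
theorem IsAdmissible.isHomOp_ad (h : IsAdmissible P α β) {κ : Wt} (hκ : κ ∈ P) {z : MLie}
    (hz : z ∈ rootSpace κ) : IsHomOp P κ (LieAlgebra.ad ℂ MLie z) := by
  have hmem : ∀ δ, ∀ y ∈ rootSpace δ, ⁅z, y⁆ ∈ rootSpace (δ + κ) := fun δ y hy => by
    rw [add_comm]; exact lie_mem_rootSpace hz hy
  refine ⟨hmem, fun δ hδ y hy h0 => h.add_mem δ hδ κ hκ ?_⟩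
  exact mem_roots_of_rootSpace_ne_bot (h.add_ne_zero hδ hκ) (rootSpace_ne_bot (hmem δ y hy) h0)

theorem finite_preimage_pair {s : Set (ℕ × ℕ)} (hs : s.Finite) :
    {n : Fin 2 →₀ ℕ | (n 0, n 1) ∈ s}.Finite := by
  refine hs.preimage (Function.Injective.injOn fun n m h => ?_)
  rw [Prod.mk.injEq] at h
  ext s
  fin_cases s
  · exact h.1
  · exact h.2

theorem IsAdmissible.finite_wt_eq (h : IsAdmissible P α β) (δ : Wt) :
    {n : Fin 2 →₀ ℕ | wt α β n = δ}.Finite :=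
  finite_preimage_pair (h.summable.finite_eq h.left_mem δ)

/-- Degrees in P are handled by pro-summability. Outside P only finitely many components of y are
nonzero, and each is reached by finitely many exponents. -/
theorem IsAdmissible.finite_support (h : IsAdmissible P α β) (y : completion P) (γ : Wt) :
    {n : Fin 2 →₀ ℕ | y.1 (γ - wt α β n) ≠ 0}.Finite := by
  have h1 := finite_preimage_pair (h.summable γ)
  have h2 := y.2.2.biUnion fun μ _ => h.finite_wt_eq (γ - μ)
  refine (h1.union h2).subset fun n hn => ?_
  by_cases hP : γ - wt α β n ∈ P
  · left
    change _ ∈ P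
    rwa [sub_sub]
  · right
    simp only [Set.mem_iUnion]
    exact ⟨_, ⟨hP, hn⟩, (sub_sub_cancel _ _).symm⟩

theorem IsAdmissible.hasFiniteSupport (h : IsAdmissible P α β) (t : Fin 2 → ℂ)
    (F : MvPowerSeries (Fin 2) Op) (y : completion P) (γ : Wt) :
    (Function.support fun n => tpow t n • coeff n F (y.1 (γ - wt α β n))).Finite :=
  (h.finite_support y γ).subset fun n hn h0 => hn (by simp only [h0, map_zero, smul_zero])

/-- The component in degree `γ` of the image of `y` under the series `F`, evaluated at `t`. -/
def actFun (α β : Wt) (t : Fin 2 → ℂ) (F : MvPowerSeries (Fin 2) Op) (y : Wt → MLie) (γ : Wt) :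
    MLie :=
  ∑ᶠ n, tpow t n • coeff n F (y (γ - wt α β n))

/-- The operators never lead out of P, so a component of the image outside P comes from one of the
finitely many components of y outside P. From each of these, `finite_below` leaves finitely many
targets outside P. -/
theorem IsAdmissible.actFun_mem (h : IsAdmissible P α β) (t : Fin 2 → ℂ)
    {F : MvPowerSeries (Fin 2) Op} (hF : F ∈ homMonoid P α β) (y : completion P) :
    actFun α β t F y.1 ∈ completion P := by
  refine ⟨fun γ => finsum_mem_submodule _ fun n => Submodule.smul_mem _ _ ?_, ?_⟩
  · have := (hF n).1 _ _ (y.2.1 (γ - wt α β n))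
    rwa [sub_add_cancel] at this
  · have hfin := y.2.2.biUnion fun μ _ =>
      (finite_preimage_pair (h.finite_below μ)).image fun n => μ + wt α β n
    refine hfin.subset ?_
    rintro γ ⟨hγ, h0⟩
    obtain ⟨n, hn⟩ : ∃ n, tpow t n • coeff n F (y.1 (γ - wt α β n)) ≠ 0 := by
      by_contra! hcon
      exact h0 ((finsum_congr hcon).trans finsum_zero)
    have hn' : coeff n F (y.1 (γ - wt α β n)) ≠ 0 := fun h => hn (by rw [h, smul_zero])
    have hy : y.1 (γ - wt α β n) ≠ 0 := fun h => hn' (by rw [h, map_zero])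
    have hμ : γ - wt α β n ∉ P := by
      intro hμ
      have := (hF n).2 _ hμ _ (y.2.1 _) hn'
      rw [sub_add_cancel] at this
      exact hγ this
    have hm := (hF n).1 _ _ (y.2.1 (γ - wt α β n))
    simp only [Set.mem_iUnion]
    refine ⟨γ - wt α β n, ⟨hμ, hy⟩, n, ?_, sub_add_cancel _ _⟩
    have e : γ - wt α β n + n 0 • α + n 1 • β = γ := by rw [wt_apply]; abel
    change rootSpace (γ - wt α β n + n 0 • α + n 1 • β) ≠ ⊥ ∧ _ ∉ P
    rw [sub_add_cancel] at hm
    dsimp only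
    rw [e]
    exact ⟨rootSpace_ne_bot hm hn', hγ⟩

/-- The operator on the completion given by a series, evaluated at `t`. -/
def IsAdmissible.actLin (h : IsAdmissible P α β) (t : Fin 2 → ℂ) (F : homMonoid P α β) :
    Module.End ℂ (completion P) where
  toFun y := ⟨actFun α β t F y.1, h.actFun_mem t F.2 y⟩
  map_add' y y' := by
    refine Subtype.ext (funext fun γ => ?_)
    change actFun α β t F (y.1 + y'.1) γ = actFun α β t F y.1 γ + actFun α β t F y'.1 γ
    rw [actFun, actFun, actFun, ← finsum_add_distrib (h.hasFiniteSupport t F y γ)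
      (h.hasFiniteSupport t F y' γ)]
    refine finsum_congr fun n => ?_
    rw [Pi.add_apply, map_add, smul_add]
  map_smul' s y := by
    refine Subtype.ext (funext fun γ => ?_)
    change actFun α β t F (s • y.1) γ = s • actFun α β t F y.1 γ
    rw [actFun, actFun, smul_finsum' _ (h.hasFiniteSupport t F y γ)]
    refine finsum_congr fun n => ?_
    rw [Pi.smul_apply, map_smul, smul_comm]

/-- Both sides sum one finitely supported family over pairs of exponents, grouped by the total
exponent on one side and iterated on the other. -/
theorem IsAdmissible.actFun_mul (h : IsAdmissible P α β) (t : Fin 2 → ℂ)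
    (F G : homMonoid P α β) (y : completion P) (γ : Wt) :
    actFun α β t (F.1 * G.1) y.1 γ = actFun α β t F.1 (actFun α β t G.1 y.1) γ := by
  classical
  let f : (Fin 2 →₀ ℕ) × (Fin 2 →₀ ℕ) → MLie := fun p =>
    tpow t (p.1 + p.2) • coeff p.1 F.1 (coeff p.2 G.1 (y.1 (γ - wt α β (p.1 + p.2))))
  have hf : f.support.Finite := by
    have h1 := (h.finite_support y γ).biUnion fun n _ =>
      (Finset.HasAntidiagonal.antidiagonal n).finite_toSet
    refine h1.subset fun p hp => ?_
    simp only [Set.mem_iUnion]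
    refine ⟨p.1 + p.2, fun h0 => hp ?_, Finset.HasAntidiagonal.mem_antidiagonal.2 rfl⟩
    simp only [f, h0, map_zero, smul_zero]
  trans ∑ᶠ p, f p
  · rw [finsum_antidiagonal f hf, actFun]
    refine finsum_congr fun n => ?_
    rw [coeff_mul, LinearMap.sum_apply, Finset.smul_sum]
    refine Finset.sum_congr rfl fun p hp => ?_
    rw [Finset.HasAntidiagonal.mem_antidiagonal] at hp
    rw [Module.End.mul_apply, ← hp]
  · rw [finsum_curry f hf, actFun]
    refine finsum_congr fun n => ?_
    have h2 := h.hasFiniteSupport t G.1 y (γ - wt α β n)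
    rw [actFun, ← LinearMap.toAddMonoidHom_coe, AddMonoidHom.map_finsum _ h2, smul_finsum']
    · refine finsum_congr fun m => ?_
      simp only [f, LinearMap.toAddMonoidHom_coe]
      rw [map_smul, smul_smul, tpow_add, map_add, sub_sub]
    · refine h2.subset fun m hm h0 => hm ?_
      simp only at h0
      simp only [h0, map_zero]

/-- The action of the homogeneous series on the completion. -/
def IsAdmissible.act (h : IsAdmissible P α β) (t : Fin 2 → ℂ) :
    homMonoid P α β →* Module.End ℂ (completion P) where
  toFun := h.actLin t
  map_one' := by
    classical
    refine LinearMap.ext fun y => Subtype.ext (funext fun γ => ?_)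
    change actFun α β t 1 y.1 γ = y.1 γ
    rw [actFun, finsum_eq_single _ 0]
    · rw [tpow_zero, coeff_zero_one, map_zero, sub_zero, one_smul]
      rfl
    · intro n hn
      rw [coeff_one, if_neg hn, LinearMap.zero_apply, smul_zero]
  map_mul' F G := by
    refine LinearMap.ext fun y => Subtype.ext (funext fun γ => ?_)
    exact h.actFun_mul t F G y γ

/-- The automorphism of the completion given by an invertible homogeneous series. -/
def IsAdmissible.aut (h : IsAdmissible P α β) (t : Fin 2 → ℂ) : (homMonoid P α β)ˣ →* LinAut P :=
  (LinearMap.GeneralLinearGroup.generalLinearEquiv ℂ (completion P)).toMonoidHom.comp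
    (Units.map (h.act t))

theorem IsAdmissible.aut_apply (h : IsAdmissible P α β) (t : Fin 2 → ℂ) (F : (homMonoid P α β)ˣ)
    (y : completion P) (γ : Wt) : (h.aut t F y).1 γ = actFun α β t F.1.1 y.1 γ := rfl

/-- The exponential of a homogeneous operator, as an invertible series. -/
def expUnit {p : Fin 2 →₀ ℕ} {b : Op} (hb : IsHomOp P (wt α β p) b) : (homMonoid P α β)ˣ where
  val := ⟨expMono p b, expMono_mem_homMonoid hb⟩
  inv := ⟨expMono p (-b), expMono_mem_homMonoid (by
    have := hb.smul (-1)
    rwa [neg_one_smul] at this)⟩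
  val_inv := Subtype.ext (expMono_mul_neg p b)
  inv_val := Subtype.ext (expMono_neg_mul p b)

theorem isExpAd_of_actFun (h : IsAdmissible P α β) (t : Fin 2 → ℂ) {p : Fin 2 →₀ ℕ} (hp : p ≠ 0)
    (z : MLie) (φ : LinAut P)
    (hφ : ∀ (y : completion P) γ,
      (φ y).1 γ = actFun α β t (expMono p (LieAlgebra.ad ℂ MLie z)) y.1 γ) :
    IsExpAd (wt α β p) (tpow t p • z) φ := by
  intro y γ
  have hinj := smul_injective_of_ne_zero hp
  constructor
  · refine ((h.finite_support y γ).preimage hinj.injOn).subset fun k hk h0 => hk ?_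
    rw [map_nsmul] at h0
    rw [h0, map_zero]
  · rw [hφ, actFun, finsum_comp_injective hinj]
    · refine finsum_congr fun k => ?_
      have e : LieAlgebra.ad ℂ MLie (tpow t p • z) = tpow t p • LieAlgebra.ad ℂ MLie z :=
        map_smul (LieAlgebra.ad ℂ MLie) _ _
      rw [coeff_expMono_smul hp, e, smul_pow, tpow_smul, map_nsmul (wt α β),
        LinearMap.smul_apply, LinearMap.smul_apply, smul_comm]
    · intro n hn
      rw [coeff_expMono_of_ne, LinearMap.zero_apply, smul_zero]
      rintro k rfl
      exact hn ⟨k, rfl⟩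

theorem IsExpAd.unique {κ : Wt} {x : MLie} {φ ψ : LinAut P} (hφ : IsExpAd κ x φ)
    (hψ : IsExpAd κ x ψ) : φ = ψ := by
  refine LinearEquiv.ext fun y => Subtype.ext (funext fun γ => ?_)
  rw [(hφ y γ).2, (hψ y γ).2]

theorem isExpAd_aut (h : IsAdmissible P α β) (t : Fin 2 → ℂ) {p : Fin 2 →₀ ℕ} (hp : p ≠ 0)
    {z : MLie} (hz : IsHomOp P (wt α β p) (LieAlgebra.ad ℂ MLie z)) :
    IsExpAd (wt α β p) (tpow t p • z) (h.aut t (expUnit hz)) :=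
  isExpAd_of_actFun h t hp z _ fun _ _ => rfl

theorem isExpAd_aut_inv (h : IsAdmissible P α β) (t : Fin 2 → ℂ) {p : Fin 2 →₀ ℕ} (hp : p ≠ 0)
    {z : MLie} (hz : IsHomOp P (wt α β p) (LieAlgebra.ad ℂ MLie z)) :
    IsExpAd (wt α β p) (tpow t p • -z) (h.aut t (expUnit hz))⁻¹ := by
  rw [← map_inv]
  refine isExpAd_of_actFun h t hp _ _ fun y γ => ?_
  rw [h.aut_apply, map_neg]
  rfl

end Operators

/-! ### The commutator relation on an admissible completion -/

section CommutatorRelations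

open MvPowerSeries

/-- Pairs of natural numbers as exponents in two variables. -/
def pairEquiv : ℕ × ℕ ≃ (Fin 2 →₀ ℕ) :=
  (finTwoArrowEquiv ℕ).symm.trans Finsupp.equivFunOnFinite.symm

theorem pairEquiv_zero (p : ℕ × ℕ) : pairEquiv p 0 = p.1 := rfl

theorem pairEquiv_one (p : ℕ × ℕ) : pairEquiv p 1 = p.2 := rfl

theorem pairEquiv_ne_zero {α β : Wt} {p : ℕ × ℕ} (hp : p ∈ spanPairs α β) : pairEquiv p ≠ 0 := by
  intro h
  have h0 := DFunLike.congr_fun h 0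
  have h1 := hp.1
  rw [pairEquiv_zero, Finsupp.zero_apply] at h0
  omega

/-- The enumeration of exponents given by an enumeration of pairs. -/
def expEnum (e : ℕ ≃ ℕ × ℕ) : ℕ ≃ (Fin 2 →₀ ℕ) := e.trans pairEquiv

theorem expEnum_mono {e : ℕ ≃ ℕ × ℕ} (he : RespectsHeight e) (p q : Fin 2 →₀ ℕ) (h : p ≤ q) :
    (expEnum e).symm p ≤ (expEnum e).symm q :=
  he _ _ ⟨h 0, h 1⟩

variable {P : Set Wt} {α β : Wt}

theorem wt_single_zero (α β : Wt) : wt α β (Finsupp.single 0 1) = α := by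
  simp [wt_apply]

theorem wt_single_one (α β : Wt) : wt α β (Finsupp.single 1 1) = β := by
  simp [wt_apply]

theorem IsAdmissible.mem_of_rootSpan (h : IsAdmissible P α β) {γ : Wt} (hγ : RootSpan α β γ) :
    γ ∈ P := by
  induction hγ with
  | base hr => exact h.add_mem _ h.left_mem _ h.right_mem hr
  | left γ _ hr ih => exact h.add_mem _ ih _ h.left_mem hr
  | right γ _ hr ih => exact h.add_mem _ ih _ h.right_mem hr

/-- Induction over right-normed brackets. A generator bracketed with a multiple of itself gives 0,
with a multiple of the other it starts Σ(α, β) at α + β, and each later nonzero bracket extends Σ(α,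
β) by α or β. The first two alternatives record multiples of x and y themselves, since [x, x'] need
not vanish for another x' in the same root space. -/
theorem IsAdmissible.lift_homLie (h : IsAdmissible P α β) {x y : MLie} (hx : x ∈ rootSpace α)
    (hy : y ∈ rootSpace β) {n : Fin 2 →₀ ℕ} {a : FreeLieAlgebra ℂ (Fin 2)} (ha : IsHomLie n a) :
    FreeLieAlgebra.lift ℂ ![x, y] a ∈ rootSpace (wt α β n) ∧
      ((n = Finsupp.single 0 1 ∧ ∃ c : ℂ, FreeLieAlgebra.lift ℂ ![x, y] a = c • x) ∨
      (n = Finsupp.single 1 1 ∧ ∃ c : ℂ, FreeLieAlgebra.lift ℂ ![x, y] a = c • y) ∨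
      RootSpan α β (wt α β n) ∨ FreeLieAlgebra.lift ℂ ![x, y] a = 0) := by
  induction ha with
  | of s =>
    rw [FreeLieAlgebra.lift_of_apply]
    fin_cases s
    · refine ⟨?_, Or.inl ⟨rfl, 1, (one_smul ℂ x).symm⟩⟩
      change x ∈ rootSpace (wt α β (Finsupp.single 0 1))
      rwa [wt_single_zero]
    · refine ⟨?_, Or.inr (Or.inl ⟨rfl, 1, (one_smul ℂ y).symm⟩)⟩
      change y ∈ rootSpace (wt α β (Finsupp.single 1 1))
      rwa [wt_single_one]
  | zero n =>
    rw [map_zero]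
    exact ⟨zero_mem _, Or.inr (Or.inr (Or.inr rfl))⟩
  | add n a b _ _ iha ihb =>
    rw [map_add]
    refine ⟨Submodule.add_mem _ iha.1 ihb.1, ?_⟩
    rcases iha.2 with ⟨hn, c, hc⟩ | ⟨hn, c, hc⟩ | hr | h0
    · rcases ihb.2 with ⟨-, c', hc'⟩ | ⟨hn', -⟩ | hr | h0
      · exact Or.inl ⟨hn, c + c', by rw [hc, hc', add_smul]⟩
      · rw [hn] at hn'
        have := DFunLike.congr_fun hn' 0
        simp at this
      · exact Or.inr (Or.inr (Or.inl hr))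
      · exact Or.inl ⟨hn, c, by rw [hc, h0, add_zero]⟩
    · rcases ihb.2 with ⟨hn', -⟩ | ⟨-, c', hc'⟩ | hr | h0
      · rw [hn] at hn'
        have := DFunLike.congr_fun hn' 0
        simp at this
      · exact Or.inr (Or.inl ⟨hn, c + c', by rw [hc, hc', add_smul]⟩)
      · exact Or.inr (Or.inr (Or.inl hr))
      · exact Or.inr (Or.inl ⟨hn, c, by rw [hc, h0, add_zero]⟩)
    · exact Or.inr (Or.inr (Or.inl hr))
    · rw [h0, zero_add]
      exact ihb.2
  | smul n t a _ ih =>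
    rw [map_smul]
    refine ⟨Submodule.smul_mem _ _ ih.1, ?_⟩
    rcases ih.2 with ⟨hn, c, hc⟩ | ⟨hn, c, hc⟩ | hr | h0
    · exact Or.inl ⟨hn, t * c, by rw [hc, smul_smul]⟩
    · exact Or.inr (Or.inl ⟨hn, t * c, by rw [hc, smul_smul]⟩)
    · exact Or.inr (Or.inr (Or.inl hr))
    · exact Or.inr (Or.inr (Or.inr (by rw [h0, smul_zero])))
  | lie s n a _ ih =>
    rw [LieHom.map_lie, FreeLieAlgebra.lift_of_apply, map_add]
    have key : ∀ δ ∈ P, ∀ w ∈ rootSpace δ, ∀ (v : MLie), ⁅w, v⁆ ≠ 0 → ∀ γ ∈ P, v ∈ rootSpace γ →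
        δ + γ ∈ roots := fun δ hδ w hw v hne γ hγ hv =>
      mem_roots_of_rootSpace_ne_bot (h.add_ne_zero hδ hγ)
        (rootSpace_ne_bot (lie_mem_rootSpace hw hv) hne)
    fin_cases s
    · change ⁅x, _⁆ ∈ rootSpace (wt α β (Finsupp.single 0 1) + _) ∧ (_ ∨ _ ∨
        RootSpan α β (wt α β (Finsupp.single 0 1) + _) ∨ ⁅x, _⁆ = 0)
      rw [wt_single_zero]
      refine ⟨lie_mem_rootSpace hx ih.1, Or.inr (Or.inr ?_)⟩
      by_cases hne : ⁅x, FreeLieAlgebra.lift ℂ ![x, y] a⁆ = 0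
      · exact Or.inr hne
      left
      rcases ih.2 with ⟨hn, c, hc⟩ | ⟨hn, c, hc⟩ | hr | h0
      · rw [hc, lie_smul, lie_self, smul_zero] at hne
        exact absurd rfl hne
      · rw [hn, wt_single_one]
        refine RootSpan.base (key α h.left_mem x hx _ hne β h.right_mem ?_)
        rw [hc]
        exact Submodule.smul_mem _ _ hy
      · rw [add_comm]
        refine RootSpan.left _ hr ?_
        rw [add_comm]
        exact key α h.left_mem x hx _ hne _ (h.mem_of_rootSpan hr) ih.1
      · rw [h0, lie_zero] at hne
        exact absurd rfl hne
    · change ⁅y, _⁆ ∈ rootSpace (wt α β (Finsupp.single 1 1) + _) ∧ (_ ∨ _ ∨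
        RootSpan α β (wt α β (Finsupp.single 1 1) + _) ∨ ⁅y, _⁆ = 0)
      rw [wt_single_one]
      refine ⟨lie_mem_rootSpace hy ih.1, Or.inr (Or.inr ?_)⟩
      by_cases hne : ⁅y, FreeLieAlgebra.lift ℂ ![x, y] a⁆ = 0
      · exact Or.inr hne
      left
      rcases ih.2 with ⟨hn, c, hc⟩ | ⟨hn, c, hc⟩ | hr | h0
      · rw [hn, wt_single_zero, add_comm]
        refine RootSpan.base ?_
        rw [add_comm]
        refine key β h.right_mem y hy _ hne α h.left_mem ?_
        rw [hc]
        exact Submodule.smul_mem _ _ hx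
      · rw [hc, lie_smul, lie_self, smul_zero] at hne
        exact absurd rfl hne
      · rw [add_comm]
        refine RootSpan.right _ hr ?_
        rw [add_comm]
        exact key β h.right_mem y hy _ hne _ (h.mem_of_rootSpan hr) ih.1
      · rw [h0, lie_zero] at hne
        exact absurd rfl hne

/-- The family of the values of homogeneous elements of the free Lie algebra. -/
theorem IsAdmissible.isSpanFamily_lift (h : IsAdmissible P α β) {x y : MLie}
    (hx : x ∈ rootSpace α) (hy : y ∈ rootSpace β) {Z : (Fin 2 →₀ ℕ) → FreeLieAlgebra ℂ (Fin 2)}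
    (hZ : ∀ p, IsHomLie p (Z p)) (hZ0 : ∀ p s, p s = 0 → Z p = 0) :
    IsSpanFamily α β fun p => FreeLieAlgebra.lift ℂ ![x, y] (Z (pairEquiv p)) := by
  intro p
  have hp := h.lift_homLie hx hy (hZ (pairEquiv p))
  refine ⟨fun _ => hp.1, fun hn => ?_⟩
  by_cases h1 : p.1 = 0
  · dsimp only
    rw [hZ0 (pairEquiv p) 0 h1, map_zero]
  by_cases h2 : p.2 = 0
  · dsimp only
    rw [hZ0 (pairEquiv p) 1 h2, map_zero]
  rcases hp.2 with ⟨hn', -⟩ | ⟨hn', -⟩ | hr | h0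
  · have := DFunLike.congr_fun hn' 1
    rw [pairEquiv_one] at this
    simp at this
    exact absurd this h2
  · have := DFunLike.congr_fun hn' 0
    rw [pairEquiv_zero] at this
    simp at this
    exact absurd this h1
  · exact absurd ⟨Nat.one_le_iff_ne_zero.2 h1, Nat.one_le_iff_ne_zero.2 h2, hr⟩ hn
  · exact h0

/-! ### From the commutator relation for operators to a relation between power series. -/

theorem map_partialProd {G H : Type} [Group G] [Group H] (φ : G →* H) (e : ℕ ≃ ℕ × ℕ)
    (W : ℕ × ℕ → G) (N : ℕ) : φ (partialProd e W N) = partialProd e (fun p => φ (W p)) N := by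
  induction N with
  | zero => exact map_one φ
  | succ N ih => rw [partialProd, partialProd, map_mul, ih]

theorem IsAdmissible.isHomOp_spanFamily (h : IsAdmissible P α β) {z : ℕ × ℕ → MLie}
    (hz : IsSpanFamily α β z) (p : ℕ × ℕ) :
    IsHomOp P (wt α β (pairEquiv p)) (LieAlgebra.ad ℂ MLie (z p)) := by
  by_cases hp : p ∈ spanPairs α β
  · exact h.isHomOp_ad (h.mem_of_rootSpan hp.2.2) ((hz p).1 hp)
  · rw [(hz p).2 hp, map_zero]
    exact isHomOp_zero _ _

theorem IsAdmissible.isHomOp_left (h : IsAdmissible P α β) {x : MLie} (hx : x ∈ rootSpace α) :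
    IsHomOp P (wt α β (Finsupp.single 0 1)) (LieAlgebra.ad ℂ MLie x) := by
  rw [wt_single_zero]
  exact h.isHomOp_ad h.left_mem hx

theorem IsAdmissible.isHomOp_right (h : IsAdmissible P α β) {y : MLie} (hy : y ∈ rootSpace β) :
    IsHomOp P (wt α β (Finsupp.single 1 1)) (LieAlgebra.ad ℂ MLie y) := by
  rw [wt_single_one]
  exact h.isHomOp_ad h.right_mem hy

/-- The operators of a family on the exponents. -/
def adFamily (z : ℕ × ℕ → MLie) (n : Fin 2 →₀ ℕ) : Op := LieAlgebra.ad ℂ MLie (z (pairEquiv.symm n))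

theorem partialProd_expUnit {z : ℕ × ℕ → MLie}
    (hz : ∀ p, IsHomOp P (wt α β (pairEquiv p)) (LieAlgebra.ad ℂ MLie (z p))) (e : ℕ ≃ ℕ × ℕ)
    (N : ℕ) : (partialProd e (fun p => expUnit (hz p)) N).1.1 =
      expProd (expEnum e) (adFamily z) N := by
  induction N with
  | zero => rfl
  | succ N ih =>
    rw [expProd, ← ih]
    rfl

/-- The commutator relation, in terms of power series of operators. -/
def SeriesRelation (P : Set Wt) (e : ℕ ≃ ℕ × ℕ) (α β : Wt) (x y : MLie) (z : ℕ × ℕ → MLie) : Prop :=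
  ∀ (t : Fin 2 → ℂ) (w : completion P) (γ : Wt) (f : Module.Dual ℂ MLie),
    Tendsto (fun N => f (actFun α β t (expProd (expEnum e) (adFamily z) N) w.1 γ)) atTop
      (𝓝 (f (actFun α β t
        (commSeries (LieAlgebra.ad ℂ MLie x) (LieAlgebra.ad ℂ MLie y)) w.1 γ)))

/-- An operator satisfying `IsExpAd` is unique, so X, Y and W must be the images of the formal
exponentials under the group homomorphism `aut`. The group U enters only through containing all
these exponentials, so one argument covers Û⁺ and Û^Π. -/
theorem IsAdmissible.commutatorRelation_iff (h : IsAdmissible P α β) {U : Subgroup (LinAut P)}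
    (hU : ∀ γ ∈ P, ∀ x ∈ rootSpace γ, ∀ φ, IsExpAd γ x φ → φ ∈ U) (e : ℕ ≃ ℕ × ℕ) {x y : MLie}
    (hx : x ∈ rootSpace α) (hy : y ∈ rootSpace β) {z : ℕ × ℕ → MLie} (hz : IsSpanFamily α β z) :
    CommutatorRelation U e α β x y z ↔ SeriesRelation P e α β x y z := by
  have hz' := h.isHomOp_spanFamily hz
  have hX : ∀ t : Fin 2 → ℂ, IsExpAd α (t 0 • x) (h.aut t (expUnit (h.isHomOp_left hx))) := by
    intro t
    have := isExpAd_aut h t (p := Finsupp.single 0 1) (by simp) (h.isHomOp_left hx)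
    rw [wt_single_zero, tpow_eq] at this
    simpa using this
  have hY : ∀ t : Fin 2 → ℂ, IsExpAd β (t 1 • y) (h.aut t (expUnit (h.isHomOp_right hy))) := by
    intro t
    have := isExpAd_aut h t (p := Finsupp.single 1 1) (by simp) (h.isHomOp_right hy)
    rw [wt_single_one, tpow_eq] at this
    simpa using this
  have hW : ∀ (t : Fin 2 → ℂ) (p : ℕ × ℕ), p ∈ spanPairs α β →
      IsExpAd (p.1 • α + p.2 • β) ((t 0 ^ p.1 * t 1 ^ p.2) • z p)
        (h.aut t (expUnit (hz' p))) := by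
    intro t p hp
    have := isExpAd_aut h t (pairEquiv_ne_zero hp) (hz' p)
    rwa [tpow_eq] at this
  have hW1 : ∀ (t : Fin 2 → ℂ) (p : ℕ × ℕ), p ∉ spanPairs α β →
      h.aut t (expUnit (hz' p)) = 1 := by
    intro t p hp
    have : expUnit (hz' p) = 1 := by
      refine Units.ext (Subtype.ext ?_)
      change expMono _ _ = 1
      rw [(hz p).2 hp, map_zero, expMono_zero]
    rw [this, map_one]
  have hlim : ∀ t : Fin 2 → ℂ, TendstoPtwise (partialProd e fun p => h.aut t (expUnit (hz' p)))
      (h.aut t (expUnit (h.isHomOp_left hx)) * h.aut t (expUnit (h.isHomOp_right hy)) *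
        (h.aut t (expUnit (h.isHomOp_left hx)))⁻¹ * (h.aut t (expUnit (h.isHomOp_right hy)))⁻¹) ↔
      ∀ (w : completion P) (γ : Wt) (f : Module.Dual ℂ MLie),
        Tendsto (fun N => f (actFun α β t (expProd (expEnum e) (adFamily z) N) w.1 γ)) atTop
          (𝓝 (f (actFun α β t
            (commSeries (LieAlgebra.ad ℂ MLie x) (LieAlgebra.ad ℂ MLie y)) w.1 γ))) := by
    intro t
    rw [← map_inv, ← map_inv, ← map_mul, ← map_mul, ← map_mul]
    refine forall_congr' fun w => forall_congr' fun γ => forall_congr' fun f => ?_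
    have e1 : (fun N => f ((partialProd e (fun p => h.aut t (expUnit (hz' p))) N w).1 γ)) =
        fun N => f (actFun α β t (expProd (expEnum e) (adFamily z) N) w.1 γ) := by
      funext N
      rw [← map_partialProd (h.aut t), h.aut_apply, partialProd_expUnit]
    rw [e1, h.aut_apply]
    rfl
  constructor
  · intro hrel t
    obtain ⟨X, Y, W, -, hX', -, hY', hW', hW1', hlim'⟩ := hrel (t 0) (t 1)
    refine (hlim t).1 ?_
    have eW : W = fun p => h.aut t (expUnit (hz' p)) := by
      funext p
      by_cases hp : p ∈ spanPairs α β
      · exact (hW' p hp).2.unique (hW t p hp)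
      · rw [hW1' p hp, hW1 t p hp]
    rw [← hX'.unique (hX t), ← hY'.unique (hY t), ← eW]
    exact hlim'
  · intro hrel u v
    refine ⟨_, _, _, hU _ h.left_mem _ (Submodule.smul_mem _ _ hx) _ (hX ![u, v]), hX ![u, v],
      hU _ h.right_mem _ (Submodule.smul_mem _ _ hy) _ (hY ![u, v]), hY ![u, v],
      fun p hp => ⟨?_, hW ![u, v] p hp⟩, hW1 ![u, v], (hlim ![u, v]).2 (hrel ![u, v])⟩
    exact hU _ (h.mem_of_rootSpan hp.2.2) _ (Submodule.smul_mem _ _ ((hz p).1 hp)) _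
      (hW ![u, v] p hp)

/-- The partial products are eventually constant in each component. -/
theorem IsAdmissible.exists_stable (h : IsAdmissible P α β) {e : ℕ ≃ ℕ × ℕ}
    (he : RespectsHeight e) (z : (Fin 2 →₀ ℕ) → Op) (w : completion P) (γ : Wt) :
    ∃ N₀, (∀ n, w.1 (γ - wt α β n) ≠ 0 → (expEnum e).symm n < N₀) ∧
      ∀ N, N₀ ≤ N → ∀ t, actFun α β t (expProd (expEnum e) z N) w.1 γ =
        actFun α β t (expProd (expEnum e) z N₀) w.1 γ := by
  obtain ⟨b, hb⟩ := ((h.finite_support w γ).image (expEnum e).symm).bddAbove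
  have hb' : ∀ n, w.1 (γ - wt α β n) ≠ 0 → (expEnum e).symm n < b + 1 := fun n hn =>
    Nat.lt_succ_of_le (hb ⟨n, hn, rfl⟩)
  refine ⟨b + 1, hb', fun N hN t => finsum_congr fun n => ?_⟩
  by_cases hn : w.1 (γ - wt α β n) = 0
  · rw [hn, map_zero, map_zero]
  · rw [coeff_expProd_of_le (expEnum_mono he) z (hb' n hn) hN]

theorem IsAdmissible.seriesRelation_of_coeff (h : IsAdmissible P α β) {e : ℕ ≃ ℕ × ℕ}
    (he : RespectsHeight e) {x y : MLie} {z : ℕ × ℕ → MLie}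
    (hz : ∀ N n, (expEnum e).symm n < N → coeff n (expProd (expEnum e) (adFamily z) N) =
      coeff n (commSeries (LieAlgebra.ad ℂ MLie x) (LieAlgebra.ad ℂ MLie y))) :
    SeriesRelation P e α β x y z := by
  intro t w γ f
  obtain ⟨N₀, h1, h2⟩ := h.exists_stable he (adFamily z) w γ
  refine tendsto_const_nhds.congr' ?_
  filter_upwards [eventually_ge_atTop N₀] with N hN
  rw [h2 N hN]
  refine congrArg f (finsum_congr fun n => ?_)
  by_cases hn : w.1 (γ - wt α β n) = 0
  · rw [hn, map_zero, map_zero]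
  · rw [hz _ _ (h1 n hn)]

/-! ### Uniqueness of the exponents. -/

theorem eq_zero_of_sum_tpow {M : Type*} [AddCommGroup M] [Module ℂ M] (D : Finset (Fin 2 →₀ ℕ))
    (a : (Fin 2 →₀ ℕ) → M) (h : ∀ t, ∑ n ∈ D, tpow t n • a n = 0) {n : Fin 2 →₀ ℕ} (hn : n ∈ D) :
    a n = 0 := by
  classical
  refine (Module.forall_dual_apply_eq_zero_iff ℂ (a n)).1 fun f => ?_
  have hp : ∑ m ∈ D, MvPolynomial.monomial m (f (a m)) = 0 := by
    refine MvPolynomial.funext fun t => ?_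
    have := congrArg f (h t)
    rw [map_sum, map_zero] at this
    rw [map_sum, map_zero, ← this]
    refine Finset.sum_congr rfl fun m _ => ?_
    rw [MvPolynomial.eval_monomial, map_smul, smul_eq_mul, mul_comm]
    rfl
  have := congrArg (MvPolynomial.coeff n) hp
  rw [MvPolynomial.coeff_sum, Finset.sum_eq_single n] at this
  · simpa using this
  · intro m _ hm
    rw [MvPolynomial.coeff_monomial, if_neg hm]
  · exact fun h => absurd hn h

open Classical in
/-- The element of the completion with the component `heightM` in degree `0`. -/
def heightC (P : Set Wt) : completion P :=
  ⟨fun γ => if γ = 0 then heightM else 0, fun γ => by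
    dsimp only
    split_ifs with hγ
    · rw [hγ]
      exact heightM_mem
    · exact zero_mem _, (Set.finite_singleton (0 : Wt)).subset fun γ hγ => by
    by_contra h
    exact hγ.2 (if_neg h)⟩

theorem heightC_zero (P : Set Wt) : (heightC P).1 0 = heightM := if_pos rfl

theorem heightC_of_ne (P : Set Wt) {γ : Wt} (h : γ ≠ 0) : (heightC P).1 γ = 0 := if_neg h

/-- Evaluate both sides on `heightC` in degree wt p. If α and β are dependent, several exponents
share this weight; since the identity holds for all parameters t, they are separated as coefficients
of a polynomial. -/
theorem IsAdmissible.coeff_heightM (h : IsAdmissible P α β) {e : ℕ ≃ ℕ × ℕ}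
    (he : RespectsHeight e) {x y : MLie} {z : ℕ × ℕ → MLie} (hz : SeriesRelation P e α β x y z)
    (N : ℕ) : coeff (expEnum e N) (expProd (expEnum e) (adFamily z) (N + 1)) heightM =
      coeff (expEnum e N) (commSeries (LieAlgebra.ad ℂ MLie x) (LieAlgebra.ad ℂ MLie y))
        heightM := by
  set p := expEnum e N with hp
  set C := commSeries (LieAlgebra.ad ℂ MLie x) (LieAlgebra.ad ℂ MLie y) with hC
  obtain ⟨N₀, h1, h2⟩ := h.exists_stable he (adFamily z) (heightC P) (wt α β p)
  set F := expProd (expEnum e) (adFamily z) N₀ with hF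
  have hsupp : ∀ n, (heightC P).1 (wt α β p - wt α β n) ≠ 0 → wt α β n = wt α β p := by
    intro n hn
    by_contra hne
    exact hn (heightC_of_ne P (sub_ne_zero.2 (Ne.symm hne)))
  have hfin := h.finite_wt_eq (wt α β p)
  have hsum : ∀ (t : Fin 2 → ℂ) (G : MvPowerSeries (Fin 2) Op),
      actFun α β t G (heightC P).1 (wt α β p) =
        ∑ n ∈ hfin.toFinset, tpow t n • coeff n G heightM := by
    intro t G
    rw [actFun, finsum_eq_sum_of_support_subset (s := hfin.toFinset)]
    · refine Finset.sum_congr rfl fun n hn => ?_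
      have hn' : wt α β n = wt α β p := by simpa using hn
      rw [hn', sub_self, heightC_zero]
    · intro n hn
      rw [Set.Finite.coe_toFinset]
      refine hsupp n fun h0 => hn ?_
      simp only [h0, map_zero, smul_zero]
  have heq : ∀ t, actFun α β t F (heightC P).1 (wt α β p) =
      actFun α β t C (heightC P).1 (wt α β p) := by
    intro t
    rw [← sub_eq_zero]
    refine (Module.forall_dual_apply_eq_zero_iff ℂ _).1 fun f => ?_
    rw [map_sub, sub_eq_zero]
    refine tendsto_nhds_unique ?_ (hz t (heightC P) (wt α β p) f)
    refine tendsto_const_nhds.congr' ?_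
    filter_upwards [eventually_ge_atTop N₀] with M hM
    rw [h2 M hM]
  have hpD : p ∈ hfin.toFinset := by simp
  have hz0 := eq_zero_of_sum_tpow hfin.toFinset
    (fun n => coeff n F heightM - coeff n C heightM) (fun t => by
      simp only [smul_sub]
      rw [Finset.sum_sub_distrib, ← hsum, ← hsum, heq, sub_self]) hpD
  rw [← sub_eq_zero.1 hz0]
  -- The bound N₀ covers the position of p only if the degree-0 component `heightM` is nonzero;
  -- otherwise both sides are zero.
  by_cases hM : heightM = 0
  · rw [hM, map_zero, map_zero]
  have hlt := h1 p (by rw [sub_self, heightC_zero]; exact hM)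
  rw [hp, Equiv.symm_apply_apply] at hlt
  rw [hF, coeff_expProd_of_le (expEnum_mono he) (adFamily z) (N := N + 1) (M := N₀) _ hlt]
  rw [hp, Equiv.symm_apply_apply]
  exact N.lt_succ_self

/-- Once the earlier exponents agree, the coefficients at position N differ only by the linear term
of the newest exponential, ad z against ad z'. Evaluating on `heightM` gives z = z' there. -/
theorem IsAdmissible.spanFamily_unique (h : IsAdmissible P α β) {e : ℕ ≃ ℕ × ℕ}
    (he : RespectsHeight e) {x y : MLie} {z z' : ℕ × ℕ → MLie} (hz : IsSpanFamily α β z)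
    (hz' : IsSpanFamily α β z') (hr : SeriesRelation P e α β x y z)
    (hr' : SeriesRelation P e α β x y z') : z = z' := by
  have key : ∀ N, z (e N) = z' (e N) := by
    intro N
    induction N using Nat.strong_induction_on with
    | _ N ih =>
      by_cases hp : e N ∈ spanPairs α β
      · refine eq_of_lie_heightM_eq (h.subset (h.mem_of_rootSpan hp.2.2)) ((hz _).1 hp)
          ((hz' _).1 hp) ?_
        have h1 := h.coeff_heightM he hr N
        have hne : expEnum e N ≠ 0 := pairEquiv_ne_zero hp
        rw [← h.coeff_heightM he hr' N, expProd, expProd,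
          coeff_expMono_mul_self hne _ (coeff_zero_expProd _ _ _),
          coeff_expMono_mul_self hne _ (coeff_zero_expProd _ _ _),
          expProd_congr (z' := adFamily z') fun n _ hn => ?_, LinearMap.add_apply,
          LinearMap.add_apply, add_left_inj] at h1
        · exact h1
        · have := ih _ hn
          rw [show e ((expEnum e).symm n) = pairEquiv.symm n from e.apply_symm_apply _] at this
          rw [adFamily, adFamily, this]
      · rw [(hz _).2 hp, (hz' _).2 hp]
  funext p
  have := key (e.symm p)
  rwa [e.apply_symm_apply] at this

theorem IsAdmissible.commutatorRelation (h : IsAdmissible P α β) {U : Subgroup (LinAut P)}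
    (hU : ∀ γ ∈ P, ∀ x ∈ rootSpace γ, ∀ φ, IsExpAd γ x φ → φ ∈ U) {e : ℕ ≃ ℕ × ℕ}
    (he : RespectsHeight e) {x y : MLie} (hx : x ∈ rootSpace α) (hy : y ∈ rootSpace β)
    {Z : (Fin 2 →₀ ℕ) → FreeLieAlgebra ℂ (Fin 2)} (hZ : ∀ p, IsHomLie p (Z p))
    (hZ0 : ∀ p s, p s = 0 → Z p = 0)
    (hfac : ∀ N n, (expEnum e).symm n < N →
      coeff n (expProd (expEnum e) (fun p => envMap (Z p)) N) =
      coeff n (commSeries (envMap (FreeLieAlgebra.of ℂ 0)) (envMap (FreeLieAlgebra.of ℂ 1)))) :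
    (∃! z : ℕ × ℕ → MLie, IsSpanFamily α β z ∧ CommutatorRelation U e α β x y z) ∧
      ∀ z : ℕ × ℕ → MLie, IsSpanFamily α β z → CommutatorRelation U e α β x y z →
        ∀ p, z p = FreeLieAlgebra.lift ℂ ![x, y] (Z (pairEquiv p)) := by
  have h1 := h.isSpanFamily_lift hx hy hZ hZ0
  have h2 : SeriesRelation P e α β x y fun p => FreeLieAlgebra.lift ℂ ![x, y] (Z (pairEquiv p)) := by
    refine h.seriesRelation_of_coeff he fun N n hn => ?_
    rw [← coeff_expProd_ad hfac x y hn]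
    refine congrArg _ (expProd_congr fun m _ _ => ?_)
    rw [adFamily, Equiv.apply_symm_apply]
  have h3 : ∀ z : ℕ × ℕ → MLie, IsSpanFamily α β z → CommutatorRelation U e α β x y z →
      z = fun p => FreeLieAlgebra.lift ℂ ![x, y] (Z (pairEquiv p)) := fun z hz hr =>
    h.spanFamily_unique he hz h1 ((h.commutatorRelation_iff hU e hx hy hz).1 hr) h2
  exact ⟨⟨_, ⟨h1, (h.commutatorRelation_iff hU e hx hy h1).2 h2⟩, fun z hz => h3 z hz.1 hz.2⟩,
    fun z hz hr => congrFun (h3 z hz hr)⟩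

end CommutatorRelations

theorem mem_UHat {P : Set Wt} : ∀ γ ∈ P, ∀ x ∈ rootSpace γ, ∀ φ : LinAut P, IsExpAd γ x φ →
    φ ∈ UHat P := by
  intro γ hγ x hx φ hφ
  exact Subgroup.mem_sInf.2 fun K hK => hK.1 γ hγ x hx φ hφ

/-! ### Exponentials are unipotent automorphisms -/

section Unipotent

variable {γ : Wt}

theorem IsAdmissible.finite_steps {P : Set Wt} (h : IsAdmissible P γ γ) (y : completion P)
    (δ : Wt) : {n : ℕ | y.1 (δ - n • γ) ≠ 0}.Finite := by
  have hinj := smul_injective_of_ne_zero (p := Finsupp.single (0 : Fin 2) 1) (by simp)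
  refine ((h.finite_support y δ).preimage hinj.injOn).subset fun n hn => ?_
  change y.1 (δ - wt γ γ (n • Finsupp.single 0 1)) ≠ 0
  rwa [map_nsmul, wt_single_zero]

/-- Taking heights bounds n and the heights of both roots by the height of δ, and there are finitely
many sums of simple roots of bounded height. If the height of δ is not a natural number, there are
no pairs. -/
theorem finite_posRoots_pairs (hγ : γ ∈ posRoots) (δ : Wt) :
    {p : Wt × ℕ | p.1 ∈ posRoots ∧ δ - p.2 • γ - p.1 ∈ posRoots}.Finite := by
  obtain ⟨c, hc, hc1⟩ := height_posRoots hγ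
  by_cases hδ : ∃ N : ℕ, height δ = N
  · obtain ⟨N, hN⟩ := hδ
    refine ((finite_posCone_height_le N).prod (Set.finite_Iic N)).subset ?_
    rintro p ⟨h1, h2⟩
    obtain ⟨a, ha, -⟩ := height_posRoots h1
    obtain ⟨b, hb, -⟩ := height_posRoots h2
    rw [map_sub, map_sub, map_nsmul, ha, hc, hN, nsmul_eq_mul] at hb
    have e : (N : ℂ) = b + a + p.2 * c := by rw [← hb]; ring
    have e' : N = b + a + p.2 * c := by exact_mod_cast e
    refine ⟨⟨(mem_posRoots.1 h1).2, a, ha, by omega⟩, ?_⟩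
    change p.2 ≤ N
    nlinarith
  · convert Set.finite_empty
    ext p
    simp only [Set.mem_empty_iff_false, iff_false]
    rintro ⟨h1, h2⟩
    obtain ⟨a, ha, -⟩ := height_posRoots h1
    obtain ⟨b, hb, -⟩ := height_posRoots h2
    rw [map_sub, map_sub, map_nsmul, ha, hc, nsmul_eq_mul] at hb
    refine hδ ⟨b + a + p.2 * c, ?_⟩
    push_cast
    rw [← hb]
    ring

/-- If both degrees are in Δ₊, heights decide. If one is not, it takes finitely many values, and the
other component then allows finitely many n. -/
theorem finite_bracket_degrees (hγ : γ ∈ posRoots) (a b : completion posRoots) (δ : Wt) :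
    {p : Wt × ℕ | a.1 p.1 ≠ 0 ∧ b.1 (δ - p.2 • γ - p.1) ≠ 0}.Finite := by
  have h := isAdmissible_posRoots hγ hγ
  have h1 := a.2.2.biUnion fun μ _ => (h.finite_steps b (δ - μ)).image fun n => (μ, n)
  have h2 := b.2.2.biUnion fun ν _ =>
    (h.finite_steps a (δ - ν)).image fun n => (δ - ν - n • γ, n)
  refine ((finite_posRoots_pairs hγ δ).union (h1.union h2)).subset ?_
  rintro ⟨μ, n⟩ ⟨hμ, hν⟩
  dsimp only at hμ hν
  by_cases hμP : μ ∈ posRoots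
  · by_cases hνP : δ - n • γ - μ ∈ posRoots
    · exact Or.inl ⟨hμP, hνP⟩
    · refine Or.inr (Or.inr ?_)
      simp only [Set.mem_iUnion]
      have e : δ - (δ - n • γ - μ) - n • γ = μ := by abel
      refine ⟨_, ⟨hνP, hν⟩, n, ?_, Prod.ext e rfl⟩
      change a.1 (δ - (δ - n • γ - μ) - n • γ) ≠ 0
      rwa [e]
  · refine Or.inr (Or.inl ?_)
    simp only [Set.mem_iUnion]
    refine ⟨μ, ⟨hμP, hμ⟩, n, ?_, rfl⟩
    change b.1 (δ - μ - n • γ) ≠ 0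
    rwa [sub_right_comm]

/-- The terms of the exponential series of `ad x`. -/
def expTerm (x : MLie) (n : ℕ) : Op := (n.factorial : ℂ)⁻¹ • LieAlgebra.ad ℂ MLie x ^ n

theorem expTerm_lie (x : MLie) (n : ℕ) (a b : MLie) :
    expTerm x n ⁅a, b⁆ = ∑ p ∈ Finset.HasAntidiagonal.antidiagonal n,
      ⁅expTerm x p.1 a, expTerm x p.2 b⁆ := by
  rw [expTerm, LinearMap.smul_apply, LieAlgebra.ad_pow_lie, Finset.smul_sum]
  refine Finset.sum_congr rfl fun p hp => ?_
  rw [Finset.HasAntidiagonal.mem_antidiagonal] at hp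
  rw [expTerm, expTerm, LinearMap.smul_apply, LinearMap.smul_apply, smul_lie, lie_smul, smul_smul,
    ← Nat.cast_smul_eq_nsmul ℂ, smul_smul]
  congr 1
  subst hp
  rw [Nat.cast_add_choose]
  have := fun m : ℕ => Nat.cast_ne_zero (R := ℂ).2 m.factorial_ne_zero
  field_simp [this]

theorem finsum_lie {ι : Type*} {f : ι → MLie} (hf : f.support.Finite) (b : MLie) :
    ⁅∑ᶠ i, f i, b⁆ = ∑ᶠ i, ⁅f i, b⁆ :=
  map_finsum ((LieAlgebra.ad ℂ MLie : MLie →ₗ[ℂ] Op).flip b) hf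

theorem lie_finsum {ι : Type*} {f : ι → MLie} (hf : f.support.Finite) (a : MLie) :
    ⁅a, ∑ᶠ i, f i⁆ = ∑ᶠ i, ⁅a, f i⁆ :=
  map_finsum (LieAlgebra.ad ℂ MLie a) hf

theorem IsExpAd.apply_eq {P : Set Wt} {x : MLie} {φ : LinAut P} (hφ : IsExpAd γ x φ)
    (y : completion P) (δ : Wt) :
    (Function.support fun n => expTerm x n (y.1 (δ - n • γ))).Finite ∧
      (φ y).1 δ = ∑ᶠ n, expTerm x n (y.1 (δ - n • γ)) := by
  refine ⟨(hφ y δ).1.subset fun n hn h0 => hn ?_, (hφ y δ).2⟩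
  dsimp only
  rw [expTerm, LinearMap.smul_apply, h0, smul_zero]

/-- Both sides are the sum of one finitely supported family over (μ, k, l). For φ(c) it arises from
the Leibniz rule for (ad x)ⁿ/n!; for the bracket of φ(a) and φ(b) it arises by multiplying the two
series out and shifting the degree, ν = μ + kγ. -/
theorem isBracket_of_isExpAd (hγ : γ ∈ posRoots) {x : MLie} {φ : LinAut posRoots}
    (hφ : IsExpAd γ x φ) {a b c : completion posRoots} (h : IsBracket a b c) :
    IsBracket (φ a) (φ b) (φ c) := by
  classical
  intro δ
  constructor
  · refine ((finite_bracket_degrees hγ (φ a) (φ b) δ).image Prod.fst).subset fun μ hμ => ?_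
    refine ⟨(μ, 0), ⟨fun h0 => hμ ?_, fun h0 => hμ ?_⟩, rfl⟩
    · dsimp only at h0
      rw [h0, zero_lie]
    · dsimp only at h0
      rw [zero_smul, sub_zero] at h0
      rw [h0, lie_zero]
  let G : Wt × ℕ × ℕ → MLie := fun q =>
    ⁅expTerm x q.2.1 (a.1 q.1), expTerm x q.2.2 (b.1 (δ - (q.2.1 + q.2.2) • γ - q.1))⁆
  have hG : G.support.Finite := by
    have := (finite_bracket_degrees hγ a b δ).biUnion fun p _ =>
      ((Finset.HasAntidiagonal.antidiagonal p.2).finite_toSet).image fun k => (p.1, k)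
    refine this.subset ?_
    rintro ⟨μ, k, l⟩ hq
    simp only [Set.mem_iUnion]
    refine ⟨(μ, k + l), ⟨fun h0 => hq ?_, fun h0 => hq ?_⟩, (k, l),
      Finset.HasAntidiagonal.mem_antidiagonal.2 rfl, rfl⟩
    · dsimp only [G] at h0 ⊢
      rw [h0, map_zero, zero_lie]
    · dsimp only [G] at h0 ⊢
      rw [h0, map_zero, lie_zero]
  have hleft : (φ c).1 δ = ∑ᶠ q, G q := by
    let f : ℕ × ℕ → MLie := fun p => ∑ᶠ μ, G (μ, p)
    have hGp : ∀ p, (Function.support fun μ => G (μ, p)).Finite := fun p =>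
      hG.preimage (f := fun μ => (μ, p)) (fun _ _ _ _ h => (Prod.ext_iff.1 h).1)
    have hf : f.support.Finite := by
      refine (hG.image Prod.snd).subset fun p hp => ?_
      by_contra hcon
      refine hp ((finsum_congr fun μ => ?_).trans finsum_zero)
      by_contra h0
      exact hcon ⟨(μ, p), h0, rfl⟩
    have hswap : (Function.support fun q : (ℕ × ℕ) × Wt => G q.swap).Finite :=
      hG.preimage Prod.swap_injective.injOn
    rw [← finsum_comp_equiv (Equiv.prodComm (ℕ × ℕ) Wt)]
    change _ = ∑ᶠ q : (ℕ × ℕ) × Wt, G q.swap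
    rw [finsum_curry _ hswap]
    change _ = ∑ᶠ p, f p
    rw [finsum_antidiagonal f hf, (hφ.apply_eq c δ).2]
    refine finsum_congr fun n => ?_
    rw [(h _).2, map_finsum (expTerm x n) (h _).1, ← finsum_sum_comm _ _ fun p _ => hGp p]
    refine finsum_congr fun μ => ?_
    rw [expTerm_lie]
    refine Finset.sum_congr rfl fun p hp => ?_
    rw [Finset.HasAntidiagonal.mem_antidiagonal] at hp
    dsimp only [G]
    rw [hp]
  have hright : ∑ᶠ ν, ⁅(φ a).1 ν, (φ b).1 (δ - ν)⁆ = ∑ᶠ q, G q := by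
    let E : Wt × ℕ × ℕ ≃ Wt × ℕ × ℕ :=
      { toFun := fun q => (q.1 - q.2.1 • γ, q.2)
        invFun := fun q => (q.1 + q.2.1 • γ, q.2)
        left_inv := fun q => Prod.ext (sub_add_cancel _ _) rfl
        right_inv := fun q => Prod.ext (add_sub_cancel_right _ _) rfl }
    have hE : (Function.support fun q => G (E q)).Finite := hG.preimage E.injective.injOn
    rw [← finsum_comp_equiv E, finsum_curry _ hE]
    refine finsum_congr fun ν => ?_
    have hν : (Function.support fun p : ℕ × ℕ => G (E (ν, p))).Finite :=
      hE.preimage (f := fun p => (ν, p)) (fun _ _ _ _ h => (Prod.ext_iff.1 h).2)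
    rw [finsum_curry _ hν, (hφ.apply_eq a ν).2, finsum_lie (hφ.apply_eq a ν).1]
    refine finsum_congr fun k => ?_
    rw [(hφ.apply_eq b (δ - ν)).2, lie_finsum (hφ.apply_eq b (δ - ν)).1]
    refine finsum_congr fun l => ?_
    change _ = ⁅expTerm x k (a.1 (ν - k • γ)),
      expTerm x l (b.1 (δ - (k + l) • γ - (ν - k • γ)))⁆
    rw [show δ - (k + l) • γ - (ν - k • γ) = δ - ν - l • γ by rw [add_smul]; abel]
  rw [hleft, hright]

theorem IsExpAd.raisesDegree {P : Set Wt} (hγ : γ ∈ P) {x : MLie} {φ : LinAut P}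
    (hφ : IsExpAd γ x φ) : RaisesDegree φ := by
  intro y δ hne
  obtain ⟨n, hn0, hn⟩ : ∃ n : ℕ, n ≠ 0 ∧ y.1 (δ - n • γ) ≠ 0 := by
    by_contra! hcon
    refine hne ?_
    rw [(hφ.apply_eq y δ).2, finsum_eq_single _ 0]
    · simp [expTerm]
    · intro n hn
      rw [hcon n hn, map_zero]
  refine ⟨δ - n • γ, n • γ, hn, ?_, (sub_add_cancel _ _).symm⟩
  obtain ⟨n, rfl⟩ := Nat.exists_eq_succ_of_ne_zero hn0
  clear hn hn0
  induction n with
  | zero =>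
    rw [Nat.succ_eq_add_one, zero_add, one_smul]
    exact AddSubsemigroup.subset_closure hγ
  | succ n ih =>
    rw [Nat.succ_eq_add_one, add_smul, one_smul]
    exact AddSubsemigroup.add_mem _ ih (AddSubsemigroup.subset_closure hγ)

/-- By uniqueness φ is the image of the formal exponential at t = (1, 1), whose inverse series is
the exponential of −ad x. The pair (γ, γ) fits a single root into the two-variable setting. -/
theorem IsAdmissible.isExpAd_inv {P : Set Wt} (h : IsAdmissible P γ γ) {x : MLie}
    (hx : x ∈ rootSpace γ) {φ : LinAut P} (hφ : IsExpAd γ x φ) : IsExpAd γ (-x) φ⁻¹ := by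
  have ht : tpow (fun _ => 1) (Finsupp.single 0 1) = 1 := by
    rw [tpow_eq, one_pow, one_pow, one_mul]
  have h1 := isExpAd_aut h (fun _ => 1) (p := Finsupp.single 0 1) (by simp) (h.isHomOp_left hx)
  have h2 := isExpAd_aut_inv h (fun _ => 1) (p := Finsupp.single 0 1) (by simp)
    (h.isHomOp_left hx)
  rw [wt_single_zero, ht, one_smul] at h1 h2
  rwa [hφ.unique h1]

theorem mem_unipotentAut : ∀ γ ∈ posRoots, ∀ x ∈ rootSpace γ, ∀ φ : LinAut posRoots,
    IsExpAd γ x φ → φ ∈ unipotentAut posRoots := by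
  intro γ hγ x hx φ hφ
  have hinv := (isAdmissible_posRoots hγ hγ).isExpAd_inv hx hφ
  refine ⟨fun a b c => ⟨isBracket_of_isExpAd hγ hφ, fun h => ?_⟩, hφ.raisesDegree hγ,
    hinv.raisesDegree hγ⟩
  have := isBracket_of_isExpAd hγ hinv h
  have e : ∀ w, φ⁻¹ (φ w) = w := φ.symm_apply_apply
  rwa [e, e, e] at this

end Unipotent

end

end Monster

theorem mainTheorem1 (e : ℕ ≃ ℕ × ℕ) (he : Monster.RespectsHeight e) :
    (∀ α ∈ Monster.posRoots, ∀ β ∈ Monster.posRoots,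
      ∀ x ∈ Monster.rootSpace α, ∀ y ∈ Monster.rootSpace β,
        (∃! z : ℕ × ℕ → Monster.MLie, Monster.IsSpanFamily α β z ∧
          Monster.CommutatorRelation (Monster.unipotentAut Monster.posRoots) e α β x y z) ∧
        (∀ z : ℕ × ℕ → Monster.MLie, Monster.IsSpanFamily α β z →
          Monster.CommutatorRelation (Monster.unipotentAut Monster.posRoots) e α β x y z →
            z (1, 1) = ⁅x, y⁆)) ∧
    (∀ α ∈ Monster.roots, ∀ β ∈ Monster.roots,
      ∀ x ∈ Monster.rootSpace α, ∀ y ∈ Monster.rootSpace β,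
        ∃ Z : ℕ × ℕ → FreeLieAlgebra ℂ (Fin 2),
          ∀ P : Set Monster.Wt, Monster.IsPositiveSystem P → α ∈ P → β ∈ P →
            Monster.ProSummablePair P α β →
            (∃! z : ℕ × ℕ → Monster.MLie, Monster.IsSpanFamily α β z ∧
              Monster.CommutatorRelation (Monster.UHat P) e α β x y z) ∧
            (∀ z : ℕ × ℕ → Monster.MLie, Monster.IsSpanFamily α β z →
              Monster.CommutatorRelation (Monster.UHat P) e α β x y z →
                z (1, 1) = ⁅x, y⁆ ∧ ∀ p, z p = FreeLieAlgebra.lift ℂ ![x, y] (Z p))) := by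
  -- Z depends only on the enumeration; it is fixed before the roots, the vectors and Π are chosen.
  obtain ⟨Z, hZ, hZ0, hZ1, hfac⟩ :=
    Monster.exists_universal_factorization (Monster.expEnum_mono he)
  have h11 : Monster.pairEquiv (1, 1) = Monster.expOneOne := by
    ext s
    fin_cases s <;> simp [Monster.pairEquiv_zero, Monster.pairEquiv_one, Monster.expOneOne]
  have hbr : ∀ x y : Monster.MLie,
      FreeLieAlgebra.lift ℂ ![x, y] (Z (Monster.pairEquiv (1, 1))) = ⁅x, y⁆ := by
    intro x y
    rw [h11, hZ1, LieHom.map_lie, FreeLieAlgebra.lift_of_apply, FreeLieAlgebra.lift_of_apply]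
    rfl
  refine ⟨fun α hα β hβ x hx y hy => ?_, fun α _ β _ x hx y hy =>
    ⟨fun p => Z (Monster.pairEquiv p), fun P hP hα hβ hsum => ?_⟩⟩
  · obtain ⟨h1, h2⟩ := (Monster.isAdmissible_posRoots hα hβ).commutatorRelation
      Monster.mem_unipotentAut he hx hy hZ hZ0 hfac
    exact ⟨h1, fun z hz hr => (h2 z hz hr (1, 1)).trans (hbr x y)⟩
  · obtain ⟨h1, h2⟩ := (hP.isAdmissible hα hβ hsum).commutatorRelation
      Monster.mem_UHat he hx hy hZ hZ0 hfac
    exact ⟨h1, fun z hz hr => ⟨(h2 z hz hr (1, 1)).trans (hbr x y), h2 z hz hr⟩⟩
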